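/- **Setting.** Let $\mathfrak h$ and $\mathsf k$ be complex Hilbert spaces (inner products linear in the second argument), let $\mathcal A$ be a von Neumann algebra acting on $\mathfrak h$, and put $\widehat{\mathsf k}=\mathbb C\oplus\mathsf k$, $\widehat x=(1,x)$ for $x\in\mathsf k$, $\omega=\widehat 0=(1,0)$. For an interval $J\subseteq\mathbb R_+$ let $\mathcal F_J$ be the Boson Fock space over $L^2(J;\mathsf k)$, with exponential vectors $\varepsilon(f)$, $\langle\varepsilon(f),\varepsilon(g)\rangle=e^{\langle f,g\rangle}$, vacuum $\Omega_J=\varepsilon(0)$ and $\mathcal N_J=B(\mathcal F_J)$; write $\mathcal F=\mathcal F_{\mathbb R_+}$, $\mathcal N=B(\mathcal F)$, and identify $\mathcal F=\mathcal F_{[0,t)}\otimes\mathcal F_{[t,\infty)}$ via $\varepsilon(f+g)=\varepsilon(f)\otimes\varepsilon(g)$. Let $\overline\otimes$ denote the ultraweak tensor product, $|H\rangle=B(\mathbb C;H)$, $E_x=|x\rangle\otimes I$ and $E^x=(E_x)^*$; let $P_t=I_{\mathfrak h}\otimes I_{[0,t)}\otimes|\Omega_{[t,\infty)}\rangle\langle\Omega_{[t,\infty)}|$;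 let $S_t:\mathcal F\to\mathcal F_{[t,\infty)}$, $\varepsilon(f)\mapsto\varepsilon(f(\cdot-t))$, and $\sigma_t(T)=(I\otimes S_t)T(I\otimes S_t)^*$. A *vacuum-adapted quantum stochastic flow* on $\mathcal A$ is a family $j=(j_t)_{t\ge0}$ of normal completely bounded linear maps $j_t:\mathcal A\to\mathcal A\,\overline\otimes\,\mathcal N$ such that, for all $a\in\mathcal A$ and $s,t\ge0$: $j_0(a)=a\otimes|\Omega\rangle\langle\Omega|$; $j_t(a)=j_{t)}(a)\otimes|\Omega_{[t,\infty)}\rangle\langle\Omega_{[t,\infty)}|$ with $j_{t)}:\mathcal A\to\mathcal A\,\overline\otimes\,\mathcal N_{[0,t)}$ a unital $*$-homomorphism; $j_{s+t}=\widehat\jmath_s\circ\sigma_s\circ j_t$, where $\widehat\jmath_s=j_{s)}\,\overline\otimes\,\mathrm{id}_{\mathcal N_{[s,\infty)}}$; and $r\mapsto j_r(a)$ is ultraweakly continuous. Put $J_s=\widehat\jmath_s\circ\sigma_s$ and $\widetilde\jmath_s=\mathrm{id}_{B(\widehat{\mathsf k})}\,\overline\otimes\,j_s$. A *bounded process* in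 a von Neumann algebra $\mathcal B$ is a family $(Z_t)_{t\ge0}$ in $\mathcal B\,\overline\otimes\,\mathcal N$ with Borel measurable matrix elements $t\mapsto\langle\zeta',Z_t\zeta\rangle$; it is *vacuum adapted* if $Z_t=P_tZ_tP_t$ for all $t$ (with $P_t$ ampliated if necessary). An *integrand* is a vacuum-adapted bounded process $G$ in $B(\widehat{\mathsf k})\,\overline\otimes\,\mathcal A$ whose blocks $\begin{bmatrix}k&m\\l&n\end{bmatrix}$ have (measurable) norm functions $\|k\|,\|l\|,\|m\|,\|n\|$ belonging to $L^1,L^2,L^2,L^\infty$ of $[0,t)$, respectively, for every $t\ge0$. The integral $\int G\,d\Lambda$ is the vacuum-adapted bounded process $N$ in $\mathcal A$ determined by $$\langle u\,\varepsilon(f),N_t\,v\,\varepsilon(g)\rangle=\int_0^t\langle u\,\varepsilon(f),E^{\widehat{f(s)}}G_sE_{\widehat{g(s)}}\,v\,\varepsilon(g)\rangle\,ds\qquad(t\ge0,\ u,v\in\mathfrak h,\ f,g\in L^2(\mathbb R_+;\mathsf k)).$$ **Theorem.** Let $j$ be a vacuum-adapted quantum stochastic flow on $\mathcal A$ and let $c\in|\widehat{\mathsf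 k}\rangle\,\overline\otimes\,\mathcal A$. There is a unique bounded process $M^c=(M^c_t)_{t\ge0}$ in $\mathcal A$ such that $M^c-I$ is vacuum adapted, $\bigl(\widetilde\jmath_s(cE^\omega)(I_{\widehat{\mathsf k}}\otimes M^c_s)\bigr)_{s\ge0}$ is an integrand, and $$M^c_t=I_{\mathfrak h\otimes\mathcal F}+\int_0^t\widetilde\jmath_s(cE^\omega)(I_{\widehat{\mathsf k}}\otimes M^c_s)\,d\Lambda_s\qquad(t\ge0).$$ The process $M^c$ is a *multiplier* for $j$: each $M^c_t$ lies in $\mathcal A\,\overline\otimes\,\mathcal N$ and, for all $s,t\ge0$, 1. $M^c_0=I_{\mathfrak h\otimes\mathcal F}$; 2. $M^c_tP_t=P_tM^c_t$; 3. $M^c_{s+t}=J_s(M^c_t)\,M^c_s$; 4. $r\mapsto M^c_r$ is strongly continuous. -/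

import Mathlib

open MeasureTheory Set
open scoped TensorProduct InnerProductSpace NNReal ComplexOrder

noncomputable section

namespace QSC

/-! ### Hilbert space tensor products -/

section HilbertTensor
variable {H H' K K' : Type*}
  [NormedAddCommGroup H] [InnerProductSpace ℂ H]
  [NormedAddCommGroup H'] [InnerProductSpace ℂ H']
  [NormedAddCommGroup K] [InnerProductSpace ℂ K]
  [NormedAddCommGroup K'] [InnerProductSpace ℂ K']

/-- The Hilbert space tensor product `K ⊗ H`: the completion of the algebraic tensor product
for the inner product `⟪x ⊗ u, y ⊗ v⟫ = ⟪x, y⟫ ⟪u, v⟫`. -/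
def HTensor (K H : Type*) [NormedAddCommGroup K] [InnerProductSpace ℂ K]
    [NormedAddCommGroup H] [InnerProductSpace ℂ H] : Type _ :=
  UniformSpace.Completion (K ⊗[ℂ] H)

infixr:70 " ⊗ₕ " => HTensor

instance : NormedAddCommGroup (K ⊗ₕ H) :=
  inferInstanceAs (NormedAddCommGroup (UniformSpace.Completion (K ⊗[ℂ] H)))
instance : InnerProductSpace ℂ (K ⊗ₕ H) :=
  inferInstanceAs (InnerProductSpace ℂ (UniformSpace.Completion (K ⊗[ℂ] H)))
instance : CompleteSpace (K ⊗ₕ H) :=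
  inferInstanceAs (CompleteSpace (UniformSpace.Completion (K ⊗[ℂ] H)))

/-- The canonical isometry of the algebraic tensor product into the Hilbert space one. -/
def toHTensor (K H : Type*) [NormedAddCommGroup K] [InnerProductSpace ℂ K]
    [NormedAddCommGroup H] [InnerProductSpace ℂ H] : (K ⊗[ℂ] H) →ₗᵢ[ℂ] K ⊗ₕ H :=
  (UniformSpace.Completion.toComplₗᵢ : (K ⊗[ℂ] H) →ₗᵢ[ℂ] UniformSpace.Completion (K ⊗[ℂ] H))

theorem denseRange_toHTensor : DenseRange (toHTensor K H) :=
  UniformSpace.Completion.denseRange_coe (α := K ⊗[ℂ] H)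

/-- The simple tensor `x ⊗ u`. -/
def htmul (x : K) (u : H) : K ⊗ₕ H := toHTensor K H (x ⊗ₜ[ℂ] u)

/-- The tensor product `b ⊗ a` of bounded operators on the Hilbert space tensor products. -/
def hmap (b : K →L[ℂ] K') (a : H →L[ℂ] H') : K ⊗ₕ H →L[ℂ] K' ⊗ₕ H' :=
  ((TensorProduct.mapL b a).completion :
    UniformSpace.Completion (K ⊗[ℂ] H) →L[ℂ] UniformSpace.Completion (K' ⊗[ℂ] H'))

theorem hmap_toHTensor (b : K →L[ℂ] K') (a : H →L[ℂ] H') (z : K ⊗[ℂ] H) :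
    hmap b a (toHTensor K H z) = toHTensor K' H' (TensorProduct.mapL b a z) :=
  ContinuousLinearMap.completion_apply_coe (TensorProduct.mapL b a) z

/-- `E_x = |x⟩ ⊗ I : u ↦ x ⊗ u`. -/
def ketE (x : K) : H →L[ℂ] K ⊗ₕ H :=
  (toHTensor K H).toContinuousLinearMap ∘L TensorProduct.mkL ℂ K H x

/-- `E^x = ⟨x| ⊗ I`. -/
def braE [CompleteSpace H] (x : K) : K ⊗ₕ H →L[ℂ] H := (ketE x).adjoint

theorem inner_htmul (x y : K) (u v : H) :
    ⟪htmul x u, htmul y v⟫_ℂ = ⟪x, y⟫_ℂ * ⟪u, v⟫_ℂ := by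
  simp [htmul, LinearIsometry.inner_map_map]

theorem hmap_htmul (b : K →L[ℂ] K') (a : H →L[ℂ] H') (x : K) (u : H) :
    hmap b a (htmul x u) = htmul (b x) (a u) := by
  rw [htmul, hmap_toHTensor, TensorProduct.mapL_tmul, htmul]

theorem ketE_apply (x : K) (u : H) : ketE x u = htmul x u := rfl

/-- Simple tensors of total families form a total family. -/
theorem dense_span_htmul {ι κ : Type*} {v : ι → K} {w : κ → H}
    (hv : (Submodule.span ℂ (range v)).topologicalClosure = ⊤)
    (hw : (Submodule.span ℂ (range w)).topologicalClosure = ⊤) :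
    (Submodule.span ℂ (range fun p : ι × κ => htmul (v p.1) (w p.2))).topologicalClosure = ⊤ := by
  set S := (Submodule.span ℂ (range fun p : ι × κ => htmul (v p.1) (w p.2))).topologicalClosure
  have hS : IsClosed (S : Set (K ⊗ₕ H)) := Submodule.isClosed_topologicalClosure _
  have h1 : ∀ i (u : H), htmul (v i) u ∈ S := by
    intro i u
    have : (⊤ : Submodule ℂ H) ≤ S.comap (ketE (v i)).toLinearMap := by
      rw [← hw]
      refine Submodule.topologicalClosure_minimal _ (Submodule.span_le.2 ?_)
        (hS.preimage (ketE (v i)).continuous)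
      rintro _ ⟨j, rfl⟩
      exact Submodule.le_topologicalClosure _ (Submodule.subset_span ⟨(i, j), rfl⟩)
    exact this trivial
  have h2 : ∀ (x : K) (u : H), htmul x u ∈ S := by
    intro x u
    let R : K →L[ℂ] K ⊗ₕ H :=
      (toHTensor K H).toContinuousLinearMap ∘L
        (TensorProduct.mkL ℂ K H).flip u
    have : (⊤ : Submodule ℂ K) ≤ S.comap R.toLinearMap := by
      rw [← hv]
      refine Submodule.topologicalClosure_minimal _ (Submodule.span_le.2 ?_)
        (hS.preimage R.continuous)
      rintro _ ⟨j, rfl⟩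
      exact h1 j u
    exact this trivial
  rw [eq_top_iff]
  rintro z -
  refine denseRange_toHTensor.induction (P := fun z => z ∈ S) ?_ hS z
  rintro _ ⟨z, rfl⟩
  induction z using TensorProduct.induction_on with
  | zero => rw [map_zero]; exact S.zero_mem
  | tmul x u => exact h2 x u
  | add a b ha hb => rw [map_add]; exact S.add_mem ha hb

end HilbertTensor

section Gram
variable {H H' ι : Type*}
  [NormedAddCommGroup H] [InnerProductSpace ℂ H]
  [NormedAddCommGroup H'] [InnerProductSpace ℂ H'] [CompleteSpace H']

/-- A total family and a family with the same Gram matrix are related by an isometry. -/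
theorem exists_isometry_of_gram (v : ι → H) (w : ι → H')
    (hv : (Submodule.span ℂ (range v)).topologicalClosure = ⊤)
    (h : ∀ i j, ⟪v i, v j⟫_ℂ = ⟪w i, w j⟫_ℂ) :
    ∃ U : H →ₗᵢ[ℂ] H', ∀ i, U (v i) = w i := by
  classical
  set e := Finsupp.linearCombination ℂ v
  set f := Finsupp.linearCombination ℂ w
  have hd : DenseRange e := by
    have h1 := Submodule.dense_iff_topologicalClosure_eq_top.2 hv
    rwa [← Finsupp.range_linearCombination] at h1
  have hn : ∀ x, ‖f x‖ = ‖e x‖ := by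
    intro x
    have h2 : ⟪f x, f x⟫_ℂ = ⟪e x, e x⟫_ℂ := by
      simp only [e, f, Finsupp.linearCombination_apply, Finsupp.sum_inner, Finsupp.inner_sum,
        inner_smul_left, inner_smul_right, h]
    rw [inner_self_eq_norm_sq_to_K, inner_self_eq_norm_sq_to_K] at h2
    have h3 : ‖f x‖ ^ 2 = ‖e x‖ ^ 2 := by exact_mod_cast h2
    exact (pow_left_inj₀ (norm_nonneg _) (norm_nonneg _) two_ne_zero).1 h3
  have hb : ∃ C, ∀ x, ‖f x‖ ≤ C * ‖e x‖ := ⟨1, fun x => by simp [hn x]⟩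
  refine ⟨⟨(f.extendOfNorm e).toLinearMap, ?_⟩, ?_⟩
  · refine fun x => hd.induction (P := fun x => ‖f.extendOfNorm e x‖ = ‖x‖) ?_
      (isClosed_eq (by fun_prop) continuous_norm) x
    rintro _ ⟨y, rfl⟩
    rw [LinearMap.extendOfNorm_eq hd hb, hn]
  · intro i
    have := LinearMap.extendOfNorm_eq (f := f) hd hb (Finsupp.single i 1)
    simpa [e, f] using this

/-- Two total families with the same Gram matrix are related by a unitary. -/
theorem exists_unitary_of_gram [CompleteSpace H] (v : ι → H) (w : ι → H')
    (hv : (Submodule.span ℂ (range v)).topologicalClosure = ⊤)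
    (hw : (Submodule.span ℂ (range w)).topologicalClosure = ⊤)
    (h : ∀ i j, ⟪v i, v j⟫_ℂ = ⟪w i, w j⟫_ℂ) :
    ∃ U : H ≃ₗᵢ[ℂ] H', ∀ i, U (v i) = w i := by
  obtain ⟨U, hU⟩ := exists_isometry_of_gram v w hv h
  have hs : Function.Surjective U := by
    have hc : IsClosed (U.toLinearMap.range : Set H') := U.isometry.isClosedEmbedding.isClosed_range
    have : (⊤ : Submodule ℂ H') ≤ U.toLinearMap.range := by
      rw [← hw]
      refine Submodule.topologicalClosure_minimal _ (Submodule.span_le.2 ?_) hc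
      rintro _ ⟨i, rfl⟩
      exact ⟨v i, hU i⟩
    exact fun y => this trivial
  exact ⟨LinearIsometryEquiv.ofSurjective U hs, hU⟩

end Gram

/-! ### Boson Fock space -/

section Fock

theorem posSemidef_inner {X Y : Type*} [NormedAddCommGroup Y] [InnerProductSpace ℂ Y] (v : X → Y) :
    (Matrix.of fun f g : X => ⟪v f, v g⟫_ℂ).PosSemidef := by
  refine ⟨?_, fun c => ?_⟩
  · ext f g
    simp [Matrix.conjTranspose_apply]
  · have h : (c.sum fun i ci => c.sum fun j cj => star ci * (Matrix.of fun f g : X => ⟪v f, v g⟫_ℂ) i j * cj)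
        = ⟪c.sum fun i ci => ci • v i, c.sum fun i ci => ci • v i⟫_ℂ := by
      rw [Finsupp.sum_inner]
      refine Finsupp.sum_congr fun i _ => ?_
      rw [Finsupp.inner_sum]
      refine Finsupp.sum_congr fun j _ => ?_
      simp [inner_smul_left, inner_smul_right]
      ring
    rw [h, inner_self_eq_norm_sq_to_K]
    rw [← RCLike.ofReal_pow]
    exact Complex.zero_le_real.2 (sq_nonneg _)

variable (X : Type*) [NormedAddCommGroup X] [InnerProductSpace ℂ X]

/-- The kernel `(f, g) ↦ exp ⟪f, g⟫`, written as an operator-valued kernel on `ℂ`. -/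
def expKernel : Matrix X X (ℂ →L[ℂ] ℂ) :=
  Matrix.of fun f g => Complex.exp ⟪f, g⟫_ℂ • (1 : ℂ →L[ℂ] ℂ)

theorem posSemidef_exp_inner :
    (Matrix.of fun f g : X => Complex.exp ⟪f, g⟫_ℂ).PosSemidef := by
  have hpow : ∀ n : ℕ, (Matrix.of fun f g : X => ⟪f, g⟫_ℂ ^ n).PosSemidef := by
    intro n
    induction n with
    | zero => simpa using! posSemidef_inner (fun _ : X => (1 : ℂ))
    | succ n ih =>
      have := ih.hadamard (posSemidef_inner (id : X → X))
      convert! this using 1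
  refine ⟨?_, fun c => ?_⟩
  · ext f g
    simp [Matrix.conjTranspose_apply, ← Complex.exp_conj]
  · have hlim : Filter.Tendsto (fun N : ℕ => c.sum fun i ci => c.sum fun j cj =>
        star ci * (∑ n ∈ Finset.range N, ⟪i, j⟫_ℂ ^ n / (n.factorial : ℂ)) * cj) Filter.atTop
        (nhds (c.sum fun i ci => c.sum fun j cj => star ci * Complex.exp ⟪i, j⟫_ℂ * cj)) := by
      refine tendsto_finsetSum _ fun i _ => tendsto_finsetSum _ fun j _ => ?_
      refine (Filter.Tendsto.const_mul _ ?_).mul_const _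
      rw [Complex.exp_eq_exp_ℂ]
      exact (NormedSpace.expSeries_div_hasSum_exp (𝔸 := ℂ) _).tendsto_sum_nat
    refine ge_of_tendsto' hlim fun N => ?_
    have hN := Matrix.posSemidef_sum (x := fun n : ℕ => ((n.factorial : ℂ)⁻¹) •
      (Matrix.of fun f g : X => ⟪f, g⟫_ℂ ^ n)) (Finset.range N) (fun n _ => (hpow n).smul (by
        rw [← Complex.ofReal_natCast, ← Complex.ofReal_inv]
        exact Complex.zero_le_real.2 (by positivity)))
    have h3 := hN.2 c
    refine h3.trans_eq (Finsupp.sum_congr fun i _ => Finsupp.sum_congr fun j _ => ?_)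
    rw [Matrix.sum_apply]
    simp [div_eq_inv_mul]

instance : Fact (expKernel X).PosSemidef := by
  refine ⟨((RKHS.posSemidef_tfae (K := expKernel X)).out 0 2).mpr ?_⟩
  refine ⟨?_, fun v => ?_⟩
  · ext f g
    simp [expKernel, Matrix.conjTranspose_apply, ← Complex.exp_conj]
  · have h := (posSemidef_exp_inner X).2 v
    have h2 := (Complex.le_def.1 h).1
    convert! h2 using 2
    refine Finsupp.sum_congr fun i _ => Finsupp.sum_congr fun j _ => ?_
    simp [expKernel, ← Complex.exp_conj]
    ring

/-- The Boson Fock space over `X`: the Hilbert space generated by exponential vectors `ε(f)`, `f ∈ X`,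
with `⟪ε(f), ε(g)⟫ = exp ⟪f, g⟫`. It is realized as the reproducing kernel Hilbert space of the
exponential kernel; see `inner_expVec` and `dense_span_expVec`, which determine it (together with its
exponential vectors) up to a unique unitary. -/
def Fock : Type _ := RKHS.OfKernel (expKernel X)

instance : NormedAddCommGroup (Fock X) :=
  inferInstanceAs (NormedAddCommGroup (RKHS.OfKernel (expKernel X)))
instance : InnerProductSpace ℂ (Fock X) :=
  inferInstanceAs (InnerProductSpace ℂ (RKHS.OfKernel (expKernel X)))
instance : CompleteSpace (Fock X) :=
  inferInstanceAs (CompleteSpace (RKHS.OfKernel (expKernel X)))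

variable {X}

/-- `c ↦ c ε(f)`. -/
def kerCLM (f : X) : ℂ →L[ℂ] Fock X := RKHS.kerFun (RKHS.OfKernel (expKernel X)) f

/-- The exponential vector `ε(f)`. -/
def expVec (f : X) : Fock X := kerCLM f 1

theorem inner_expVec (f g : X) : ⟪expVec f, expVec g⟫_ℂ = Complex.exp ⟪f, g⟫_ℂ := by
  have h := RKHS.kernel_inner (RKHS.OfKernel (expKernel X)) g f (1 : ℂ) (1 : ℂ)
  rw [RKHS.OfKernel.kernel_ofKernel] at h
  refine (h.symm.trans ?_)
  simp [expKernel, ← Complex.exp_conj]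

theorem dense_span_expVec :
    (Submodule.span ℂ (range (expVec : X → Fock X))).topologicalClosure = ⊤ := by
  have h : (Submodule.span ℂ {z : Fock X | ∃ f c, kerCLM f c = z}).topologicalClosure = ⊤ :=
    RKHS.kerFun_dense (RKHS.OfKernel (expKernel X))
  rw [eq_top_iff, ← h]
  refine Submodule.topologicalClosure_mono (Submodule.span_le.2 ?_)
  rintro _ ⟨f, c, rfl⟩
  have : kerCLM f c = c • expVec f := by
    rw [expVec, ← map_smul, smul_eq_mul, mul_one]
  rw [this]
  exact Submodule.smul_mem _ _ (Submodule.subset_span ⟨f, rfl⟩)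

/-- The second quantization `ε(f) ↦ ε(V f)` of a unitary `V`. -/
theorem exists_secondQuant {Y : Type*} [NormedAddCommGroup Y] [InnerProductSpace ℂ Y]
    (V : X ≃ₗᵢ[ℂ] Y) : ∃ U : Fock X ≃ₗᵢ[ℂ] Fock Y, ∀ f, U (expVec f) = expVec (V f) := by
  refine exists_unitary_of_gram _ _ dense_span_expVec ?_ fun f g => ?_
  · have : range (fun f => expVec (V f)) = range (expVec : Y → Fock Y) :=
      V.surjective.range_comp expVec
    rw [this]
    exact dense_span_expVec
  · simp [inner_expVec]

end Fock

/-! ### The noise Fock spaces, their factorization and the right shift -/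

section Time
variable (𝔨 : Type*) [NormedAddCommGroup 𝔨] [InnerProductSpace ℂ 𝔨]

/-- `L²(J; 𝔨)`, as the space of those elements of `L²(ℝ; 𝔨)` which vanish outside `J`. -/
def L2 (J : Set ℝ) : Submodule ℂ (Lp 𝔨 2 (volume : Measure ℝ)) where
  carrier := {f | ∀ᵐ r, r ∉ J → f r = 0}
  zero_mem' := by
    filter_upwards [Lp.coeFn_zero 𝔨 2 (volume : Measure ℝ)] with r h0 _
    rw [h0, Pi.zero_apply]
  add_mem' := by
    intro f g hf hg
    filter_upwards [hf, hg, Lp.coeFn_add f g] with r h1 h2 h3 hr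
    rw [h3, Pi.add_apply, h1 hr, h2 hr, add_zero]
  smul_mem' := by
    intro c f hf
    filter_upwards [hf, Lp.coeFn_smul c f] with r h1 h3 hr
    rw [h3, Pi.smul_apply, h1 hr, smul_zero]

variable {𝔨}

theorem add_mem_L2 (t : ℝ≥0) {f g : Lp 𝔨 2 (volume : Measure ℝ)} (hf : f ∈ L2 𝔨 (Ici (t : ℝ)))
    (hg : g ∈ L2 𝔨 (Ico 0 (t : ℝ))) : f + g ∈ L2 𝔨 (Ici (0 : ℝ)) := by
  filter_upwards [hf, hg, Lp.coeFn_add f g] with r h1 h2 h3 hr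
  have ht := t.2
  simp only [mem_Ici, not_le] at hr
  rw [h3, Pi.add_apply, h1 (by simp only [mem_Ici, not_le]; exact hr.trans_le ht),
    h2 (by simp only [mem_Ico, not_and_or, not_le]; exact Or.inl hr), add_zero]

/-- `(f, g) ↦ f + g`, from `L²[t,∞) × L²[0,t)` onto `L²[0,∞)`. -/
def join (t : ℝ≥0) (f : L2 𝔨 (Ici (t : ℝ))) (g : L2 𝔨 (Ico 0 (t : ℝ))) : L2 𝔨 (Ici (0 : ℝ)) :=
  ⟨f.1 + g.1, add_mem_L2 t f.2 g.2⟩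

theorem inner_eq_zero_of_disjoint {I J : Set ℝ} (h : Disjoint I J) (f : L2 𝔨 I) (g : L2 𝔨 J) :
    ⟪(f : Lp 𝔨 2 (volume : Measure ℝ)), (g : Lp 𝔨 2 (volume : Measure ℝ))⟫_ℂ = 0 := by
  rw [L2.inner_def]
  refine integral_eq_zero_of_ae ?_
  filter_upwards [f.2, g.2] with r h1 h2
  by_cases hr : r ∈ I
  · simp [h2 (disjoint_left.1 h hr)]
  · simp [h1 hr]

theorem disjoint_Ici_Ico (t : ℝ≥0) : Disjoint (Ici (t : ℝ)) (Ico 0 (t : ℝ)) :=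
  disjoint_left.2 fun _ h1 h2 => absurd h2.2 (not_lt.2 h1)

theorem inner_join (t : ℝ≥0) (f f' : L2 𝔨 (Ici (t : ℝ))) (g g' : L2 𝔨 (Ico 0 (t : ℝ))) :
    ⟪join t f g, join t f' g'⟫_ℂ = ⟪f, f'⟫_ℂ + ⟪g, g'⟫_ℂ := by
  simp only [join, Submodule.coe_inner, inner_add_left, inner_add_right]
  rw [inner_eq_zero_of_disjoint (disjoint_Ici_Ico t),
    inner_eq_zero_of_disjoint (disjoint_Ici_Ico t).symm]
  ring

theorem exists_join_eq (t : ℝ≥0) (h : L2 𝔨 (Ici (0 : ℝ))) : ∃ f g, join t f g = h := by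
  have hm := Lp.memLp (h : Lp 𝔨 2 (volume : Measure ℝ))
  have h1 := hm.indicator (measurableSet_Ici (a := (t : ℝ)))
  have h2 := hm.indicator (measurableSet_Ico (a := (0 : ℝ)) (b := (t : ℝ)))
  refine ⟨⟨h1.toLp _, ?_⟩, ⟨h2.toLp _, ?_⟩, Subtype.ext (Lp.ext ?_)⟩
  · filter_upwards [h1.coeFn_toLp] with r hr hn
    rw [hr, indicator_of_notMem hn]
  · filter_upwards [h2.coeFn_toLp] with r hr hn
    rw [hr, indicator_of_notMem hn]
  · filter_upwards [h1.coeFn_toLp, h2.coeFn_toLp, Lp.coeFn_add (h1.toLp _) (h2.toLp _), h.2]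
      with r e1 e2 e3 e4
    change (h1.toLp _ + h2.toLp _ : Lp 𝔨 2 (volume : Measure ℝ)) r = _
    rw [e3, Pi.add_apply, e1, e2]
    by_cases hr : (t : ℝ) ≤ r
    · rw [indicator_of_mem (by exact hr), indicator_of_notMem (fun h => absurd h.2 (not_lt.2 hr)),
        add_zero]
    · rw [indicator_of_notMem (by exact hr), zero_add]
      by_cases h0 : 0 ≤ r
      · rw [indicator_of_mem (by exact ⟨h0, not_le.1 hr⟩)]
      · rw [indicator_of_notMem (fun h => h0 h.1), e4 h0]

/-- Translation `f ↦ f( · - a)` on `L²(ℝ; 𝔨)`. -/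
def translate (a : ℝ) : Lp 𝔨 2 (volume : Measure ℝ) →ₗᵢ[ℂ] Lp 𝔨 2 (volume : Measure ℝ) :=
  Lp.compMeasurePreservingₗᵢ ℂ (fun r => r - a) (measurePreserving_sub_right volume a)

theorem translate_ae (a : ℝ) (f : Lp 𝔨 2 (volume : Measure ℝ)) :
    translate a f =ᵐ[volume] fun r => f (r - a) :=
  Lp.coeFn_compMeasurePreserving f (measurePreserving_sub_right volume a)

theorem translate_mem (a b : ℝ) {f : Lp 𝔨 2 (volume : Measure ℝ)} (hf : f ∈ L2 𝔨 (Ici b)) :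
    translate a f ∈ L2 𝔨 (Ici (b + a)) := by
  have h1 := (measurePreserving_sub_right (volume : Measure ℝ) a).quasiMeasurePreserving.ae hf
  filter_upwards [translate_ae a f, h1] with r h2 h3 hr
  rw [h2]
  refine h3 fun h => hr ?_
  simp only [mem_Ici] at h ⊢
  linarith

theorem translate_translate_neg (a : ℝ) (f : Lp 𝔨 2 (volume : Measure ℝ)) :
    translate a (translate (-a) f) = f := by
  refine Lp.ext ?_
  have h1 := (measurePreserving_sub_right (volume : Measure ℝ) a).quasiMeasurePreserving.ae
    (translate_ae (-a) f)
  filter_upwards [translate_ae a (translate (-a) f), h1] with r h2 h3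
  rw [h2, h3]
  simp

/-- The right shift `s_t : L²(ℝ₊; 𝔨) → L²([t,∞); 𝔨)`, `f ↦ f( · - t)`. -/
def rightShift (t : ℝ≥0) : L2 𝔨 (Ici (0 : ℝ)) ≃ₗᵢ[ℂ] L2 𝔨 (Ici (t : ℝ)) :=
  LinearIsometryEquiv.ofSurjective
    { toFun := fun f => ⟨translate (t : ℝ) f.1, by simpa using translate_mem (t : ℝ) 0 f.2⟩
      map_add' := fun f g => Subtype.ext (map_add (translate (t : ℝ)) f.1 g.1)
      map_smul' := fun c f => Subtype.ext (map_smul (translate (t : ℝ)) c f.1)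
      norm_map' := fun f => (translate (t : ℝ)).norm_map f.1 }
    fun g => ⟨⟨translate (-(t : ℝ)) g.1, by simpa using translate_mem (-(t : ℝ)) t g.2⟩,
      Subtype.ext (translate_translate_neg (t : ℝ) g.1)⟩

/-- The Fock space over `L²(J; 𝔨)`. -/
abbrev NoiseFock (𝔨 : Type*) [NormedAddCommGroup 𝔨] [InnerProductSpace ℂ 𝔨] (J : Set ℝ) : Type _ :=
  Fock (L2 𝔨 J)

/-- The second quantized shift `S_t : ε(f) ↦ ε(s_t f)`. -/
def shiftFock (𝔨 : Type*) [NormedAddCommGroup 𝔨] [InnerProductSpace ℂ 𝔨] (t : ℝ≥0) :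
    NoiseFock 𝔨 (Ici 0) ≃ₗᵢ[ℂ] NoiseFock 𝔨 (Ici (t : ℝ)) :=
  (exists_secondQuant (rightShift (𝔨 := 𝔨) t)).choose

theorem shiftFock_expVec (t : ℝ≥0) (f : L2 𝔨 (Ici (0 : ℝ))) :
    shiftFock 𝔨 t (expVec f) = expVec (rightShift t f) :=
  (exists_secondQuant (rightShift (𝔨 := 𝔨) t)).choose_spec f

theorem exists_splitting (𝔨 H : Type*) [NormedAddCommGroup 𝔨] [InnerProductSpace ℂ 𝔨]
    [NormedAddCommGroup H] [InnerProductSpace ℂ H] (t : ℝ≥0) :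
    ∃ U : (NoiseFock 𝔨 (Ici (t : ℝ)) ⊗ₕ NoiseFock 𝔨 (Ico 0 (t : ℝ)) ⊗ₕ H) ≃ₗᵢ[ℂ]
        (NoiseFock 𝔨 (Ici 0) ⊗ₕ H),
      ∀ p : L2 𝔨 (Ici (t : ℝ)) × L2 𝔨 (Ico 0 (t : ℝ)) × H,
        U (htmul (expVec p.1) (htmul (expVec p.2.1) p.2.2)) =
          htmul (expVec (join t p.1 p.2.1)) p.2.2 := by
  have hid : (Submodule.span ℂ (range (id : H → H))).topologicalClosure = ⊤ := by
    rw [range_id, Submodule.span_univ]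
    exact top_le_iff.1 (Submodule.le_topologicalClosure _)
  have h1 := dense_span_htmul (dense_span_expVec (X := L2 𝔨 (Ico 0 (t : ℝ)))) hid
  have h2 := dense_span_htmul (dense_span_expVec (X := L2 𝔨 (Ici (t : ℝ)))) h1
  have h3 := dense_span_htmul (dense_span_expVec (X := L2 𝔨 (Ici (0 : ℝ)))) hid
  refine exists_unitary_of_gram
    (fun p : L2 𝔨 (Ici (t : ℝ)) × L2 𝔨 (Ico 0 (t : ℝ)) × H =>
      htmul (expVec p.1) (htmul (expVec p.2.1) p.2.2))
    (fun p => htmul (expVec (join t p.1 p.2.1)) p.2.2) h2 ?_ ?_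
  · have hr : range (fun p : L2 𝔨 (Ici (t : ℝ)) × L2 𝔨 (Ico 0 (t : ℝ)) × H =>
        htmul (expVec (join t p.1 p.2.1)) p.2.2) =
        range (fun p : L2 𝔨 (Ici (0 : ℝ)) × H => htmul (expVec p.1) (id p.2)) := by
      ext z
      constructor
      · rintro ⟨⟨f, g, u⟩, rfl⟩
        exact ⟨⟨join t f g, u⟩, rfl⟩
      · rintro ⟨⟨h, u⟩, rfl⟩
        obtain ⟨f, g, rfl⟩ := exists_join_eq t h
        exact ⟨⟨f, g, u⟩, rfl⟩
    rw [hr]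
    exact h3
  · rintro ⟨f, g, u⟩ ⟨f', g', u'⟩
    simp only [inner_htmul, inner_expVec, inner_join, Complex.exp_add]
    ring

/-- The identification of `F_[t,∞) ⊗ F_[0,t) ⊗ H` with `F ⊗ H`, where `F_J` is the Fock space over
`L²(J; 𝔨)` and `F = F_[0,∞)`: it is the unitary with `ε(f) ⊗ ε(g) ⊗ u ↦ ε(f + g) ⊗ u`. -/
def splitting (𝔨 H : Type*) [NormedAddCommGroup 𝔨] [InnerProductSpace ℂ 𝔨]
    [NormedAddCommGroup H] [InnerProductSpace ℂ H] (t : ℝ≥0) :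
    (NoiseFock 𝔨 (Ici (t : ℝ)) ⊗ₕ NoiseFock 𝔨 (Ico 0 (t : ℝ)) ⊗ₕ H) ≃ₗᵢ[ℂ]
        (NoiseFock 𝔨 (Ici 0) ⊗ₕ H) :=
  (exists_splitting 𝔨 H t).choose

theorem splitting_htmul {H : Type*} [NormedAddCommGroup H] [InnerProductSpace ℂ H]
    (t : ℝ≥0) (f : L2 𝔨 (Ici (t : ℝ))) (g : L2 𝔨 (Ico 0 (t : ℝ))) (u : H) :
    splitting 𝔨 H t (htmul (expVec f) (htmul (expVec g) u)) = htmul (expVec (join t f g)) u :=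
  (exists_splitting 𝔨 H t).choose_spec (f, g, u)

end Time

/-! ### Ultraweak topology, ultraweak tensor products and ampliations -/

section Ultraweak
variable {H H' K : Type*}
  [NormedAddCommGroup H] [InnerProductSpace ℂ H]
  [NormedAddCommGroup H'] [InnerProductSpace ℂ H']
  [NormedAddCommGroup K] [InnerProductSpace ℂ K]

/-- The ultraweak topology on `B(H; H')`: the coarsest topology for which the functionals
`T ↦ ∑ₙ ⟪ξₙ, T ηₙ⟫` with `∑ ‖ξₙ‖² < ∞` and `∑ ‖ηₙ‖² < ∞` are continuous. -/
abbrev ultraweak (H H' : Type*) [NormedAddCommGroup H] [InnerProductSpace ℂ H]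
    [NormedAddCommGroup H'] [InnerProductSpace ℂ H'] : TopologicalSpace (H →L[ℂ] H') :=
  ⨅ p : {p : (ℕ → H') × (ℕ → H) //
      (Summable fun n => ‖p.1 n‖ ^ 2) ∧ Summable fun n => ‖p.2 n‖ ^ 2},
    TopologicalSpace.induced (fun T : H →L[ℂ] H' => ∑' n, ⟪p.1.1 n, T (p.1.2 n)⟫_ℂ) inferInstance

/-- The ultraweak tensor product of `B(K)` and `S ⊆ B(H)`: the ultraweakly closed linear span in
`B(K ⊗ H)` of the operators `b ⊗ a`, `b ∈ B(K)`, `a ∈ S`. -/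
def opTensor (K : Type*) [NormedAddCommGroup K] [InnerProductSpace ℂ K] (S : Set (H →L[ℂ] H)) :
    Set (K ⊗ₕ H →L[ℂ] K ⊗ₕ H) :=
  @closure _ (ultraweak _ _)
    (Submodule.span ℂ {T | ∃ (b : K →L[ℂ] K) (a : H →L[ℂ] H), a ∈ S ∧ T = hmap b a} :
      Set (K ⊗ₕ H →L[ℂ] K ⊗ₕ H))

/-- The ultraweak tensor product of `|K⟩ = B(ℂ; K)` and `S ⊆ B(H)`: the ultraweakly closed linear
span in `B(H; K ⊗ H)` of the operators `|x⟩ ⊗ a : u ↦ x ⊗ a u`, `x ∈ K`, `a ∈ S`. -/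
def ketTensor (K : Type*) [NormedAddCommGroup K] [InnerProductSpace ℂ K] (S : Set (H →L[ℂ] H)) :
    Set (H →L[ℂ] K ⊗ₕ H) :=
  @closure _ (ultraweak _ _)
    (Submodule.span ℂ {T | ∃ (x : K) (a : H →L[ℂ] H), a ∈ S ∧ T = ketE x ∘L a} :
      Set (H →L[ℂ] K ⊗ₕ H))

variable [CompleteSpace H] [CompleteSpace H'] (A : VonNeumannAlgebra H)

/-- Normality of a map on a von Neumann algebra: continuity for the ultraweak topologies. -/
def IsNormal (φ : A.toStarSubalgebra → (H' →L[ℂ] H')) : Prop :=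
  @Continuous _ _ (TopologicalSpace.induced Subtype.val (ultraweak H H)) (ultraweak H' H') φ

/-- The operator on `ℂⁿ ⊗ H` with block matrix `a`. -/
def blockOp {n : ℕ} (a : Fin n → Fin n → (H →L[ℂ] H)) :
    EuclideanSpace ℂ (Fin n) ⊗ₕ H →L[ℂ] EuclideanSpace ℂ (Fin n) ⊗ₕ H :=
  ∑ i, ∑ j,
    ketE (EuclideanSpace.single i (1 : ℂ)) ∘L a i j ∘L braE (EuclideanSpace.single j (1 : ℂ))

/-- Complete boundedness: the entrywise maps on `n × n` matrices are bounded uniformly in `n`. -/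
def IsCompletelyBounded (φ : A.toStarSubalgebra → (H' →L[ℂ] H')) : Prop :=
  ∃ C : ℝ, ∀ (n : ℕ) (a : Fin n → Fin n → A.toStarSubalgebra),
    ‖blockOp fun i j => φ (a i j)‖ ≤ C * ‖blockOp fun i j => (a i j : H →L[ℂ] H)‖

/-- `R` is the image of `T` under the ampliation `id_{B(K)} ⊗̄ φ` of `φ : A → B(H')`, i.e.
`E^x R E_y = φ (E^x T E_y)` for all `x, y ∈ K`. -/
def IsAmpliation (φ : A.toStarSubalgebra → (H' →L[ℂ] H')) (T : K ⊗ₕ H →L[ℂ] K ⊗ₕ H)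
    (R : K ⊗ₕ H' →L[ℂ] K ⊗ₕ H') : Prop :=
  ∀ x y : K, ∃ hT : braE x ∘L T ∘L ketE y ∈ A.toStarSubalgebra,
    braE x ∘L R ∘L ketE y = φ ⟨braE x ∘L T ∘L ketE y, hT⟩

theorem ext_slices {R R' : K ⊗ₕ H' →L[ℂ] K ⊗ₕ H'}
    (h : ∀ x y : K, braE x ∘L R ∘L ketE y = braE x ∘L R' ∘L ketE y) : R = R' := by
  have hd : Dense (Submodule.span ℂ (range fun p : K × H' => htmul p.1 p.2) : Set (K ⊗ₕ H')) := by
    refine Submodule.dense_iff_topologicalClosure_eq_top.2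
      (dense_span_htmul (v := fun x : K => x) (w := fun u : H' => u) ?_ ?_)
    all_goals
      rw [range_id', Submodule.span_univ]
      exact top_le_iff.1 (Submodule.le_topologicalClosure _)
  refine ContinuousLinearMap.ext_on hd ?_
  rintro _ ⟨⟨y, v⟩, rfl⟩
  refine sub_eq_zero.1 (inner_self_eq_zero (𝕜 := ℂ).1 ?_)
  set d := R (htmul y v) - R' (htmul y v) with hdef
  have h0 : innerSL ℂ d = 0 := by
    refine ContinuousLinearMap.ext_on hd ?_
    rintro _ ⟨⟨x, u⟩, rfl⟩
    have h1 := congrArg (fun T : H' →L[ℂ] H' => ⟪u, T v⟫_ℂ) (h x y)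
    simp only [braE, ContinuousLinearMap.comp_apply, ContinuousLinearMap.adjoint_inner_right,
      ketE_apply] at h1
    simp only [innerSL_apply_apply, zero_apply]
    rw [← inner_conj_symm, hdef, inner_sub_right, h1, sub_self, map_zero]
  exact congrArg (fun l => l d) h0

/-- There is at most one ampliated operator. -/
theorem IsAmpliation.unique {φ : A.toStarSubalgebra → (H' →L[ℂ] H')} {T : K ⊗ₕ H →L[ℂ] K ⊗ₕ H}
    {R R' : K ⊗ₕ H' →L[ℂ] K ⊗ₕ H'} (h : IsAmpliation A φ T R) (h' : IsAmpliation A φ T R') :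
    R = R' :=
  ext_slices fun x y => by
    obtain ⟨_, h1⟩ := h x y
    obtain ⟨_, h2⟩ := h' x y
    rw [h1, h2]

theorem slice_hmap (b : K →L[ℂ] K) (a : H →L[ℂ] H) (x y : K) :
    braE x ∘L hmap b a ∘L ketE y = ⟪x, b y⟫_ℂ • a := by
  ext v
  refine ext_inner_left ℂ fun u => ?_
  simp only [braE, ContinuousLinearMap.comp_apply, ContinuousLinearMap.adjoint_inner_right,
    ketE_apply, hmap_htmul, inner_htmul, smul_apply, inner_smul_right]

/-- On elementary tensors the ampliation is `b ⊗ a ↦ b ⊗ φ a`. -/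
theorem isAmpliation_hmap (φ : A.toStarSubalgebra →ₗ[ℂ] (H' →L[ℂ] H')) (b : K →L[ℂ] K)
    (a : A.toStarSubalgebra) : IsAmpliation A φ (hmap b (a : H →L[ℂ] H)) (hmap b (φ a)) := by
  intro x y
  refine ⟨?_, ?_⟩
  · rw [slice_hmap]
    exact SMulMemClass.smul_mem _ a.2
  · rw [slice_hmap, ← map_smul]
    congr 1
    exact Subtype.ext (slice_hmap b (a : H →L[ℂ] H) x y).symm

open scoped Classical in
/-- The ampliation `id_{B(K)} ⊗̄ φ : B(K) ⊗̄ A → B(K ⊗ H')` of a normal completely bounded map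
`φ : A → B(H')`. (For such `φ` the ampliated operator exists for each `T ∈ B(K) ⊗̄ A`; the value `0`
is used only outside this setting.) -/
def ampliate (φ : A.toStarSubalgebra → (H' →L[ℂ] H')) (T : K ⊗ₕ H →L[ℂ] K ⊗ₕ H) :
    K ⊗ₕ H' →L[ℂ] K ⊗ₕ H' :=
  if h : ∃ R, IsAmpliation A φ T R then h.choose else 0

theorem IsAmpliation.ampliate_eq {φ : A.toStarSubalgebra → (H' →L[ℂ] H')}
    {T : K ⊗ₕ H →L[ℂ] K ⊗ₕ H} {R : K ⊗ₕ H' →L[ℂ] K ⊗ₕ H'} (h : IsAmpliation A φ T R) :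
    ampliate A φ T = R := by
  have hex : ∃ R, IsAmpliation A φ T R := ⟨R, h⟩
  rw [ampliate, dif_pos hex]
  exact hex.choose_spec.unique A h

end Ultraweak

/-! ### Vacuum-adapted cocycles, flows and multipliers

Throughout, `𝔥` is the initial space, `𝔨` the multiplicity space, `F = NoiseFock 𝔨 [0,∞)`, and
operators of the noise algebra tensored with those on `𝔥` act on `F ⊗ 𝔥` (the Fock space is
written on the left). Time runs through `ℝ≥0`. -/

section Cocycle
variable {𝔥 𝔨 : Type*}
  [NormedAddCommGroup 𝔥] [InnerProductSpace ℂ 𝔥] [CompleteSpace 𝔥]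
  [NormedAddCommGroup 𝔨] [InnerProductSpace ℂ 𝔨]

/-- The space `F ⊗ 𝔥`. -/
abbrev FH (𝔨 𝔥 : Type*) [NormedAddCommGroup 𝔥] [InnerProductSpace ℂ 𝔥]
    [NormedAddCommGroup 𝔨] [InnerProductSpace ℂ 𝔨] : Type _ :=
  NoiseFock 𝔨 (Ici 0) ⊗ₕ 𝔥

/-- The Fock vacuum `ε(0)`. -/
def vacuum (𝔨 : Type*) [NormedAddCommGroup 𝔨] [InnerProductSpace ℂ 𝔨] (J : Set ℝ) :
    NoiseFock 𝔨 J := expVec 0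

/-- The vacuum projection `|Ω_J⟩⟨Ω_J|`. -/
def vacuumProj (𝔨 : Type*) [NormedAddCommGroup 𝔨] [InnerProductSpace ℂ 𝔨] (J : Set ℝ) :
    NoiseFock 𝔨 J →L[ℂ] NoiseFock 𝔨 J :=
  InnerProductSpace.rankOne ℂ (vacuum 𝔨 J) (vacuum 𝔨 J)

/-- `U T U⁻¹` for a unitary `U`. -/
def conjBy {X Y : Type*} [NormedAddCommGroup X] [InnerProductSpace ℂ X]
    [NormedAddCommGroup Y] [InnerProductSpace ℂ Y] (U : X ≃ₗᵢ[ℂ] Y) (T : X →L[ℂ] X) : Y →L[ℂ] Y :=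
  U.toContinuousLinearEquiv.toContinuousLinearMap ∘L T ∘L
    U.symm.toContinuousLinearEquiv.toContinuousLinearMap

/-- The projection `P_t = |Ω_[t,∞)⟩⟨Ω_[t,∞)| ⊗ I_[0,t) ⊗ I_𝔥` on `F ⊗ 𝔥`. -/
def vacP (𝔨 𝔥 : Type*) [NormedAddCommGroup 𝔥] [InnerProductSpace ℂ 𝔥]
    [NormedAddCommGroup 𝔨] [InnerProductSpace ℂ 𝔨] (t : ℝ≥0) : FH 𝔨 𝔥 →L[ℂ] FH 𝔨 𝔥 :=
  conjBy (splitting 𝔨 𝔥 t)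
    (hmap (vacuumProj 𝔨 (Ici (t : ℝ))) (1 : NoiseFock 𝔨 (Ico 0 (t : ℝ)) ⊗ₕ 𝔥 →L[ℂ] _))

/-- `σ_t : T ↦ (S_t ⊗ I) T (S_t ⊗ I)*`, from operators on `F ⊗ 𝔥` to operators on
`F_[t,∞) ⊗ 𝔥`. -/
def sigma (t : ℝ≥0) (T : FH 𝔨 𝔥 →L[ℂ] FH 𝔨 𝔥) :
    NoiseFock 𝔨 (Ici (t : ℝ)) ⊗ₕ 𝔥 →L[ℂ] NoiseFock 𝔨 (Ici (t : ℝ)) ⊗ₕ 𝔥 :=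
  hmap (shiftFock 𝔨 t).toContinuousLinearEquiv.toContinuousLinearMap (1 : 𝔥 →L[ℂ] 𝔥) ∘L T ∘L
    hmap (shiftFock 𝔨 t).symm.toContinuousLinearEquiv.toContinuousLinearMap (1 : 𝔥 →L[ℂ] 𝔥)

variable (A : VonNeumannAlgebra 𝔥)

/-- The family `k_{t)}(a) = E^{Ω_[t,∞)} k_t(a) E_{Ω_[t,∞)}` of operators on `F_[0,t) ⊗ 𝔥`. -/
def localPart (k : ℝ≥0 → A.toStarSubalgebra →ₗ[ℂ] (FH 𝔨 𝔥 →L[ℂ] FH 𝔨 𝔥)) (t : ℝ≥0)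
    (a : A.toStarSubalgebra) :
    NoiseFock 𝔨 (Ico 0 (t : ℝ)) ⊗ₕ 𝔥 →L[ℂ] NoiseFock 𝔨 (Ico 0 (t : ℝ)) ⊗ₕ 𝔥 :=
  braE (vacuum 𝔨 (Ici (t : ℝ))) ∘L conjBy (splitting 𝔨 𝔥 t).symm (k t a) ∘L
    ketE (vacuum 𝔨 (Ici (t : ℝ)))

/-- `k̂_s = k_{s)} ⊗̄ id_[s,∞)`, from operators on `F_[s,∞) ⊗ 𝔥` to operators on `F ⊗ 𝔥`. -/
def hatMap (k : ℝ≥0 → A.toStarSubalgebra →ₗ[ℂ] (FH 𝔨 𝔥 →L[ℂ] FH 𝔨 𝔥)) (s : ℝ≥0)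
    (T : NoiseFock 𝔨 (Ici (s : ℝ)) ⊗ₕ 𝔥 →L[ℂ] NoiseFock 𝔨 (Ici (s : ℝ)) ⊗ₕ 𝔥) :
    FH 𝔨 𝔥 →L[ℂ] FH 𝔨 𝔥 :=
  conjBy (splitting 𝔨 𝔥 s) (ampliate A (localPart A k s) T)

/-- `J_s = ĵ_s ∘ σ_s`. -/
def bigJ (j : ℝ≥0 → A.toStarSubalgebra →ₗ[ℂ] (FH 𝔨 𝔥 →L[ℂ] FH 𝔨 𝔥)) (s : ℝ≥0)
    (T : FH 𝔨 𝔥 →L[ℂ] FH 𝔨 𝔥) : FH 𝔨 𝔥 →L[ℂ] FH 𝔨 𝔥 :=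
  hatMap A j s (sigma s T)

/-- Vacuum-adapted quantum stochastic cocycles on `A`. -/
structure IsVacuumAdaptedCocycle
    (k : ℝ≥0 → A.toStarSubalgebra →ₗ[ℂ] (FH 𝔨 𝔥 →L[ℂ] FH 𝔨 𝔥)) : Prop where
  mem : ∀ t a, k t a ∈ opTensor (NoiseFock 𝔨 (Ici 0)) (A : Set (𝔥 →L[ℂ] 𝔥))
  normal : ∀ t, IsNormal A (k t)
  completelyBounded : ∀ t, IsCompletelyBounded A (k t)
  zero : ∀ a : A.toStarSubalgebra, k 0 a = hmap (vacuumProj 𝔨 (Ici 0)) (a : 𝔥 →L[ℂ] 𝔥)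
  localPart_mem : ∀ (t : ℝ≥0) (a : A.toStarSubalgebra),
    localPart A k t a ∈ opTensor (NoiseFock 𝔨 (Ico 0 (t : ℝ))) (A : Set (𝔥 →L[ℂ] 𝔥))
  adapted : ∀ (t : ℝ≥0) (a : A.toStarSubalgebra), k t a =
    conjBy (splitting 𝔨 𝔥 t) (hmap (vacuumProj 𝔨 (Ici (t : ℝ))) (localPart A k t a))
  cocycle : ∀ s t a, k (s + t) a = hatMap A k s (sigma s (k t a))
  continuous : ∀ a, @Continuous ℝ≥0 _ inferInstance (ultraweak _ _) fun r => k r a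

/-- Vacuum-adapted quantum stochastic flows: cocycles for which each `k_{t)}` is a unital
`*`-homomorphism. -/
structure IsFlow (j : ℝ≥0 → A.toStarSubalgebra →ₗ[ℂ] (FH 𝔨 𝔥 →L[ℂ] FH 𝔨 𝔥)) : Prop
    extends IsVacuumAdaptedCocycle A j where
  map_one : ∀ t, localPart A j t 1 = 1
  map_mul : ∀ t a b, localPart A j t (a * b) = localPart A j t a * localPart A j t b
  map_star : ∀ t a, localPart A j t (star a) = star (localPart A j t a)

/-- Multipliers for a flow `j`. -/
structure IsMultiplier (j : ℝ≥0 → A.toStarSubalgebra →ₗ[ℂ] (FH 𝔨 𝔥 →L[ℂ] FH 𝔨 𝔥))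
    (M : ℝ≥0 → (FH 𝔨 𝔥 →L[ℂ] FH 𝔨 𝔥)) : Prop where
  mem : ∀ t, M t ∈ opTensor (NoiseFock 𝔨 (Ici 0)) (A : Set (𝔥 →L[ℂ] 𝔥))
  zero : M 0 = 1
  comm : ∀ t, M t * vacP 𝔨 𝔥 t = vacP 𝔨 𝔥 t * M t
  cocycle : ∀ s t, M (s + t) = bigJ A j s (M t) * M s
  continuous : ∀ ξ, Continuous fun r => M r ξ

/-! ### Processes, quantum stochastic integrals and the differential equation -/

/-- A bounded process in a set of operators: a family of elements with measurable matrix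
elements. -/
def IsBoundedProcess {X : Type*} [NormedAddCommGroup X] [InnerProductSpace ℂ X]
    (S : Set (X →L[ℂ] X)) (Z : ℝ≥0 → (X →L[ℂ] X)) : Prop :=
  (∀ t, Z t ∈ S) ∧ ∀ ζ' ζ : X, Measurable fun t => ⟪ζ', Z t ζ⟫_ℂ

/-- A bounded process in `A` is vacuum adapted if `Z_t = P_t Z_t P_t`. -/
def IsVacuumAdapted (Z : ℝ≥0 → (FH 𝔨 𝔥 →L[ℂ] FH 𝔨 𝔥)) : Prop :=
  ∀ t, Z t = vacP 𝔨 𝔥 t * Z t * vacP 𝔨 𝔥 t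

/-- The space `𝔨̂ = ℂ ⊕ 𝔨`. -/
abbrev KHat (𝔨 : Type*) [NormedAddCommGroup 𝔨] [InnerProductSpace ℂ 𝔨] : Type _ := WithLp 2 (ℂ × 𝔨)

/-- `ĉ = (1, c)`. -/
def hatVec (c : 𝔨) : KHat 𝔨 := WithLp.toLp 2 (1, c)

/-- `ω = (1, 0)`. -/
def omega (𝔨 : Type*) [NormedAddCommGroup 𝔨] [InnerProductSpace ℂ 𝔨] : KHat 𝔨 := hatVec 0

/-- The inclusion of `𝔨` in `𝔨̂`. -/
def inclK (𝔨 : Type*) [NormedAddCommGroup 𝔨] [InnerProductSpace ℂ 𝔨] : 𝔨 →L[ℂ] KHat 𝔨 :=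
  (WithLp.prodContinuousLinearEquiv 2 ℂ ℂ 𝔨).symm.toContinuousLinearMap ∘L
    ContinuousLinearMap.inr ℂ ℂ 𝔨

section Blocks
variable {X : Type*} [NormedAddCommGroup X] [InnerProductSpace ℂ X] [CompleteSpace X]
  (G : KHat 𝔨 ⊗ₕ X →L[ℂ] KHat 𝔨 ⊗ₕ X)

/-- The inclusion of `𝔨 ⊗ X` in `𝔨̂ ⊗ X = X ⊕ (𝔨 ⊗ X)`. -/
def inclKX (𝔨 X : Type*) [NormedAddCommGroup 𝔨] [InnerProductSpace ℂ 𝔨]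
    [NormedAddCommGroup X] [InnerProductSpace ℂ X] : 𝔨 ⊗ₕ X →L[ℂ] KHat 𝔨 ⊗ₕ X :=
  hmap (inclK 𝔨) 1

/-- The blocks of `G = [[k, m], [l, n]]` for the decomposition `𝔨̂ ⊗ X = X ⊕ (𝔨 ⊗ X)`:
this is `k`. -/
def blockK : X →L[ℂ] X := braE (omega 𝔨) ∘L G ∘L ketE (omega 𝔨)

/-- The lower left block `l`. -/
def blockL : X →L[ℂ] 𝔨 ⊗ₕ X := (inclKX 𝔨 X).adjoint ∘L G ∘L ketE (omega 𝔨)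

/-- The upper right block `m`. -/
def blockM : 𝔨 ⊗ₕ X →L[ℂ] X := braE (omega 𝔨) ∘L G ∘L inclKX 𝔨 X

/-- The lower right block `n`. -/
def blockN : 𝔨 ⊗ₕ X →L[ℂ] 𝔨 ⊗ₕ X := (inclKX 𝔨 X).adjoint ∘L G ∘L inclKX 𝔨 X

end Blocks

/-- Integrand processes: vacuum-adapted bounded processes in `B(𝔨̂) ⊗̄ A` whose blocks `k`, `l`, `m`,
`n` have norms which are respectively `L¹`, `L²`, `L²` and `L^∞` on `[0, t)`, for all `t`. -/
structure IsIntegrand (G : ℝ≥0 → (KHat 𝔨 ⊗ₕ FH 𝔨 𝔥 →L[ℂ] KHat 𝔨 ⊗ₕ FH 𝔨 𝔥)) : Prop where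
  process : IsBoundedProcess
    (opTensor (KHat 𝔨) (opTensor (NoiseFock 𝔨 (Ici 0)) (A : Set (𝔥 →L[ℂ] 𝔥)))) G
  adapted : ∀ t, G t = hmap (1 : KHat 𝔨 →L[ℂ] KHat 𝔨) (vacP 𝔨 𝔥 t) ∘L G t ∘L
    hmap (1 : KHat 𝔨 →L[ℂ] KHat 𝔨) (vacP 𝔨 𝔥 t)
  memLp_k : ∀ t : ℝ≥0,
    MemLp (fun s : ℝ => ‖blockK (G s.toNNReal)‖) 1 (volume.restrict (Ico 0 (t : ℝ)))
  memLp_l : ∀ t : ℝ≥0,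
    MemLp (fun s : ℝ => ‖blockL (G s.toNNReal)‖) 2 (volume.restrict (Ico 0 (t : ℝ)))
  memLp_m : ∀ t : ℝ≥0,
    MemLp (fun s : ℝ => ‖blockM (G s.toNNReal)‖) 2 (volume.restrict (Ico 0 (t : ℝ)))
  memLp_n : ∀ t : ℝ≥0,
    MemLp (fun s : ℝ => ‖blockN (G s.toNNReal)‖) ⊤ (volume.restrict (Ico 0 (t : ℝ)))

/-- `N = ∫ G dΛ`: `G` is an integrand process and `N` is the bounded vacuum-adapted process in `A`
with `⟪u ε(f), N_t v ε(g)⟫ = ∫₀ᵗ ⟪u ε(f), E^{f̂(s)} G_s E_{ĝ(s)} v ε(g)⟫ ds`. -/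
structure IsQSIntegral (G : ℝ≥0 → (KHat 𝔨 ⊗ₕ FH 𝔨 𝔥 →L[ℂ] KHat 𝔨 ⊗ₕ FH 𝔨 𝔥))
    (N : ℝ≥0 → (FH 𝔨 𝔥 →L[ℂ] FH 𝔨 𝔥)) : Prop where
  integrand : IsIntegrand A G
  process : IsBoundedProcess (opTensor (NoiseFock 𝔨 (Ici 0)) (A : Set (𝔥 →L[ℂ] 𝔥))) N
  adapted : IsVacuumAdapted N
  inner_eq : ∀ (t : ℝ≥0) (u v : 𝔥) (f g : L2 𝔨 (Ici (0 : ℝ))),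
    ⟪htmul (expVec f) u, N t (htmul (expVec g) v)⟫_ℂ =
      ∫ s in (0 : ℝ)..t, ⟪htmul (expVec f) u,
        (braE (hatVec ((f : Lp 𝔨 2 (volume : Measure ℝ)) s)) ∘L G s.toNNReal ∘L
          ketE (hatVec ((g : Lp 𝔨 2 (volume : Measure ℝ)) s))) (htmul (expVec g) v)⟫_ℂ

/-- `M` is a process in `A` such that `M - I` is vacuum adapted and
`M_t = I + ∫₀ᵗ j̃_s(c E^ω) (I ⊗ M_s) dΛ_s`, where `j̃_s = id_{B(𝔨̂)} ⊗̄ j_s`. -/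
structure IsQSDESolution (j : ℝ≥0 → A.toStarSubalgebra →ₗ[ℂ] (FH 𝔨 𝔥 →L[ℂ] FH 𝔨 𝔥))
    (c : 𝔥 →L[ℂ] KHat 𝔨 ⊗ₕ 𝔥) (M : ℝ≥0 → (FH 𝔨 𝔥 →L[ℂ] FH 𝔨 𝔥)) : Prop where
  process : IsBoundedProcess (opTensor (NoiseFock 𝔨 (Ici 0)) (A : Set (𝔥 →L[ℂ] 𝔥))) M
  equation : IsQSIntegral A
    (fun s => ampliate A (j s) (c ∘L braE (omega 𝔨)) ∘L hmap (1 : KHat 𝔨 →L[ℂ] KHat 𝔨) (M s)) (fun t => M t - 1)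

end Cocycle

end QSC

end

set_option linter.unusedSectionVars false

noncomputable section

namespace QSC

open Filter Topology

/-! ### Operators on Hilbert space tensor products -/

section TensorCalculus
variable {H H' H'' K K' K'' : Type*}
  [NormedAddCommGroup H] [InnerProductSpace ℂ H]
  [NormedAddCommGroup H'] [InnerProductSpace ℂ H']
  [NormedAddCommGroup H''] [InnerProductSpace ℂ H'']
  [NormedAddCommGroup K] [InnerProductSpace ℂ K]
  [NormedAddCommGroup K'] [InnerProductSpace ℂ K']
  [NormedAddCommGroup K''] [InnerProductSpace ℂ K'']

/-! The operator `c E^ω` has a single nonzero column, so the integrand has blocks `m = n = 0` and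
the function `g` drops out of the right-hand side. The equation therefore decouples into one
equation for each vector `ξ`: against the exponential vectors `v p = ε(f) ⊗ u` it reads `⟪v p, M_t
ξ⟫ = ⟪v p, ξ⟫ + ∫₀ᵗ (⟪v p, C₀(s) M_s ξ⟫ + ⟪f(s) ⊗ v p, C₁(s) M_s ξ⟫) ds` (`SolvesAt`), where `C₀`
and `C₁` are the two components of the column of `j̃_s(c E^ω)`. This is a linear Volterra equation
in a Hilbert space.

The estimate behind everything comes from vacuum adaptedness. If `l(s) = (I ⊗ P_s) l(s)` and `z = ∑
dᵢ vᵢ`, then `l(s)` only meets the gradient vector `∑ dᵢ fᵢ(s) ⊗ P_s vᵢ`, whose squared norm is the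
derivative of `‖P_s z‖²`. The gradient thus has total energy at most `‖z‖²`, and Cauchy-Schwarz
bounds the integral of `(k, l)` by `∫ ‖k‖ + (∫ ‖l‖²)^(1/2)`, with no exponential factor depending on
`f` (`IsExpFrame.norm_sum_integral_le`). Riesz representation then turns the prescribed moments into
vectors.

The coefficients are bounded by `‖c‖` and strongly continuous: the column behaves like `j_s(c)`, its
squared modulus being `j_s(c* c)`, so that weak continuity of the flow gives convergence of norms as
well as weak convergence (`tendsto_column`). In an exponentially weighted supremum norm on
continuous paths the integral operator has norm at most `1/2`, and a Neumann series gives the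
solution (`IsDriver.exists_solution`). The same contraction gives uniqueness among continuous paths.
An arbitrary solution process has continuous paths on exponential vectors, because the blocks of its
integrand are `L¹` and `L²`, so uniqueness holds for all of them (`IsDriver.solution_unique`).

The remaining claims compare two solutions of one equation or read off its moments. The solution
commutes with `I ⊗ a'` for `a'` in the commutant, which places it in `A ⊗̄ N`; truncation of
exponential vectors and uniqueness give `P_t (M_t - I) = M_t - I = (M_t - I) P_t`. For the cocycle
identity, `J_s` is built from the normal unital `*`-homomorphism `j_{s)}`. It is multiplicative, is
strongly continuous on bounded sets and satisfies `J_s(j_r(a)) = j_{s+r}(a)`. Since normal maps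
commute with weak integrals, `t ↦ J_s(M_t)` solves the equation started at time `s`
(`liftedShift_solves`), so it is the transition operator from `s` to `s + t`
(`IsDriver.solution_evolution`).

All of this is tested on slices `E^x T E_y`: an operator lies in `B(K) ⊗̄ A` exactly when its slices
lie in `A`, and an ampliation is determined by its slices. -/

theorem dense_htmul : Dense (Submodule.span ℂ (range fun p : K × H => htmul p.1 p.2) :
    Set (K ⊗ₕ H)) := by
  refine Submodule.dense_iff_topologicalClosure_eq_top.2
    (dense_span_htmul (v := fun x : K => x) (w := fun u : H => u) ?_ ?_)
  all_goals
    rw [range_id', Submodule.span_univ]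
    exact top_le_iff.1 (Submodule.le_topologicalClosure _)

/-- Continuous linear maps that agree on simple tensors are equal. -/
theorem ext_htmul {X : Type*} [NormedAddCommGroup X] [NormedSpace ℂ X] {S T : K ⊗ₕ H →L[ℂ] X}
    (h : ∀ x u, S (htmul x u) = T (htmul x u)) : S = T :=
  ContinuousLinearMap.ext_on dense_htmul (by rintro _ ⟨⟨x, u⟩, rfl⟩; exact h x u)

/-- A vector is determined by its inner products with a total family. -/
theorem ext_inner_of_total {ι X : Type*} [NormedAddCommGroup X] [InnerProductSpace ℂ X] {v : ι → X}
    (hv : (Submodule.span ℂ (range v)).topologicalClosure = ⊤) {x y : X}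
    (h : ∀ i, ⟪v i, x⟫_ℂ = ⟪v i, y⟫_ℂ) : x = y := by
  have h0 : innerSL ℂ (x - y) = 0 := by
    refine ContinuousLinearMap.ext_on (Submodule.dense_iff_topologicalClosure_eq_top.2 hv) ?_
    rintro _ ⟨i, rfl⟩
    rw [innerSL_apply_apply, zero_apply, ← inner_conj_symm, inner_sub_right, h, sub_self, map_zero]
  have h1 := congrArg (fun l => l (x - y)) h0
  exact sub_eq_zero.1 (inner_self_eq_zero (𝕜 := ℂ).1 h1)

theorem ext_inner_htmul {x y : K ⊗ₕ H}
    (h : ∀ k u, ⟪htmul k u, x⟫_ℂ = ⟪htmul k u, y⟫_ℂ) : x = y :=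
  ext_inner_of_total (v := fun p : K × H => htmul p.1 p.2)
    (Submodule.dense_iff_topologicalClosure_eq_top.1 dense_htmul) fun p => h p.1 p.2

theorem norm_htmul (x : K) (u : H) : ‖htmul x u‖ = ‖x‖ * ‖u‖ := by
  simp [htmul]

theorem htmul_add_left (x y : K) (u : H) : htmul (x + y) u = htmul x u + htmul y u := by
  simp [htmul, TensorProduct.add_tmul]

theorem htmul_smul_left (c : ℂ) (x : K) (u : H) : htmul (c • x) u = c • htmul x u := by
  simp [htmul, ← TensorProduct.smul_tmul']

theorem htmul_sum_left {ι : Type*} (s : Finset ι) (x : ι → K) (u : H) :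
    htmul (∑ i ∈ s, x i) u = ∑ i ∈ s, htmul (x i) u := by
  simp [htmul, TensorProduct.sum_tmul]

theorem continuous_htmul_left (u : H) : Continuous fun x : K => htmul x u :=
  (toHTensor K H).continuous.comp ((TensorProduct.mkL ℂ K H).flip u).continuous

theorem norm_ketE_le (x : K) : ‖(ketE x : H →L[ℂ] K ⊗ₕ H)‖ ≤ ‖x‖ :=
  ContinuousLinearMap.opNorm_le_bound _ (norm_nonneg _) fun u => (norm_htmul x u).le

theorem ketE_smul (c : ℂ) (x : K) : (ketE (c • x) : H →L[ℂ] K ⊗ₕ H) = c • ketE x :=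
  ContinuousLinearMap.ext fun u => htmul_smul_left c x u

theorem ketE_sum {ι : Type*} (s : Finset ι) (x : ι → K) :
    (ketE (∑ i ∈ s, x i) : H →L[ℂ] K ⊗ₕ H) = ∑ i ∈ s, ketE (x i) :=
  ContinuousLinearMap.ext fun u => by simp [ketE_apply, htmul_sum_left]

theorem norm_hmap_apply_le (b : K →L[ℂ] K') (a : H →L[ℂ] H') (z : K ⊗ₕ H) :
    ‖hmap b a z‖ ≤ ‖b‖ * ‖a‖ * ‖z‖ := by
  refine denseRange_toHTensor.induction (P := fun z => ‖hmap b a z‖ ≤ ‖b‖ * ‖a‖ * ‖z‖) ?_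
    (isClosed_le (by fun_prop) (by fun_prop)) z
  rintro _ ⟨z, rfl⟩
  rw [hmap_toHTensor, LinearIsometry.norm_map, LinearIsometry.norm_map]
  exact (ContinuousLinearMap.le_opNorm _ _).trans
    (mul_le_mul_of_nonneg_right (TensorProduct.norm_mapL_le b a) (norm_nonneg _))

theorem norm_hmap_le (b : K →L[ℂ] K') (a : H →L[ℂ] H') : ‖hmap b a‖ ≤ ‖b‖ * ‖a‖ :=
  ContinuousLinearMap.opNorm_le_bound _ (by positivity) (norm_hmap_apply_le b a)

theorem hmap_comp (b' : K' →L[ℂ] K'') (a' : H' →L[ℂ] H'') (b : K →L[ℂ] K') (a : H →L[ℂ] H') :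
    hmap b' a' ∘L hmap b a = hmap (b' ∘L b) (a' ∘L a) :=
  ext_htmul fun x u => by simp [hmap_htmul]

theorem hmap_one_one : hmap (1 : K →L[ℂ] K) (1 : H →L[ℂ] H) = 1 :=
  ext_htmul fun x u => by simp [hmap_htmul]

theorem hmap_comp_ketE (b : K →L[ℂ] K') (a : H →L[ℂ] H') (x : K) :
    hmap b a ∘L ketE x = ketE (b x) ∘L a :=
  ContinuousLinearMap.ext fun u => hmap_htmul b a x u

variable [CompleteSpace H] [CompleteSpace H']

theorem inner_braE (x : K) (u : H) (z : K ⊗ₕ H) : ⟪u, braE x z⟫_ℂ = ⟪htmul x u, z⟫_ℂ := by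
  rw [braE, ContinuousLinearMap.adjoint_inner_right, ketE_apply]

theorem braE_htmul (x y : K) (u : H) : braE x (htmul y u) = ⟪x, y⟫_ℂ • u :=
  ext_inner_left ℂ fun v => by rw [inner_braE, inner_htmul, inner_smul_right]

theorem braE_comp_ketE (x y : K) : braE x ∘L ketE y = ⟪x, y⟫_ℂ • (1 : H →L[ℂ] H) :=
  ContinuousLinearMap.ext fun u => braE_htmul x y u

theorem norm_braE_le (x : K) : ‖(braE x : K ⊗ₕ H →L[ℂ] H)‖ ≤ ‖x‖ := by
  rw [braE, LinearIsometryEquiv.norm_map]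
  exact norm_ketE_le x

theorem braE_sum {ι : Type*} (s : Finset ι) (x : ι → K) :
    (braE (∑ i ∈ s, x i) : K ⊗ₕ H →L[ℂ] H) = ∑ i ∈ s, braE (x i) := by
  simp only [braE, ketE_sum, map_sum]

theorem braE_smul (c : ℂ) (x : K) : (braE (c • x) : K ⊗ₕ H →L[ℂ] H) = star c • braE x := by
  simp only [braE, ketE_smul]
  exact map_smulₛₗ _ _ _

theorem adjoint_braE (x : K) : (braE x : K ⊗ₕ H →L[ℂ] H).adjoint = ketE x :=
  ContinuousLinearMap.adjoint_adjoint _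

theorem adjoint_hmap [CompleteSpace K] [CompleteSpace K'] (b : K →L[ℂ] K') (a : H →L[ℂ] H') :
    (hmap b a).adjoint = hmap b.adjoint a.adjoint := by
  refine ext_htmul fun x u => ext_inner_htmul fun y v => ?_
  rw [ContinuousLinearMap.adjoint_inner_right, hmap_htmul, hmap_htmul, inner_htmul, inner_htmul,
    ContinuousLinearMap.adjoint_inner_right, ContinuousLinearMap.adjoint_inner_right]

theorem inner_hmap_one_left [CompleteSpace K] (a : H →L[ℂ] H') (z : K ⊗ₕ H') (w : K ⊗ₕ H) :
    ⟪z, hmap (1 : K →L[ℂ] K) a w⟫_ℂ = ⟪hmap (1 : K →L[ℂ] K) a.adjoint z, w⟫_ℂ := by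
  rw [← ContinuousLinearMap.adjoint_inner_left, adjoint_hmap]
  congr 2
  simp [← ContinuousLinearMap.star_eq_adjoint]

theorem braE_comp_hmap [CompleteSpace K] [CompleteSpace K'] (b : K →L[ℂ] K') (a : H →L[ℂ] H')
    (x : K') : braE x ∘L hmap b a = a ∘L braE (b.adjoint x) :=
  ext_htmul fun y u => by
    simp only [ContinuousLinearMap.comp_apply, hmap_htmul, braE_htmul, map_smul,
      ContinuousLinearMap.adjoint_inner_left]

theorem braE_comp_hmap_one [CompleteSpace K] (a : H →L[ℂ] H') (x : K) :
    braE x ∘L hmap (1 : K →L[ℂ] K) a = a ∘L braE x :=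
  ext_htmul fun y u => by
    simp only [ContinuousLinearMap.comp_apply, hmap_htmul, braE_htmul, map_smul,
      one_apply_eq_self]

theorem hmap_rankOne (x y : K) (a : H →L[ℂ] H) :
    hmap (InnerProductSpace.rankOne ℂ x y) a = ketE x ∘L a ∘L braE y :=
  ext_htmul fun z u => by
    simp only [ContinuousLinearMap.comp_apply, hmap_htmul, braE_htmul, map_smul, ketE_apply,
      InnerProductSpace.rankOne_apply, htmul_smul_left]

/-- The projection `∑_{i ∈ F} |bᵢ⟩⟨bᵢ| ⊗ I` associated with finitely many basis vectors. -/
def basisProj {ι : Type*} (b : ι → K) (F : Finset ι) : K ⊗ₕ H →L[ℂ] K ⊗ₕ H :=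
  ∑ i ∈ F, ketE (b i) ∘L braE (b i)

theorem basisProj_eq_hmap {ι : Type*} (b : ι → K) (F : Finset ι) :
    (basisProj b F : K ⊗ₕ H →L[ℂ] K ⊗ₕ H) =
      hmap (∑ i ∈ F, InnerProductSpace.rankOne ℂ (b i) (b i)) 1 :=
  ext_htmul fun z u => by
    simp [basisProj, hmap_htmul, braE_htmul, ketE_apply, htmul_sum_left, htmul_smul_left]

theorem inner_basisProj {ι : Type*} (b : ι → K) (F : Finset ι) (z w : K ⊗ₕ H) :
    ⟪z, basisProj b F w⟫_ℂ = ∑ i ∈ F, ⟪braE (b i) z, braE (b i) w⟫_ℂ := by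
  simp only [basisProj, sum_apply, inner_sum, ContinuousLinearMap.comp_apply,
    ketE_apply]
  refine Finset.sum_congr rfl fun i _ => ?_
  rw [inner_braE]
  rw [← inner_conj_symm, ← inner_braE, inner_conj_symm, ← inner_braE]

theorem inner_basisProj_left {ι : Type*} (b : ι → K) (F : Finset ι) (z w : K ⊗ₕ H) :
    ⟪basisProj b F z, w⟫_ℂ = ⟪z, basisProj b F w⟫_ℂ := by
  rw [inner_basisProj, ← inner_conj_symm, inner_basisProj, map_sum]
  exact Finset.sum_congr rfl fun i _ => inner_conj_symm _ _

end TensorCalculus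

/-! ### Strong convergence of finite basis projections. -/

section BasisProj
variable {H K ι : Type*} [NormedAddCommGroup H] [InnerProductSpace ℂ H] [CompleteSpace H]
  [NormedAddCommGroup K] [InnerProductSpace ℂ K]

/-- A self-adjoint idempotent `P` satisfies `‖P z‖² = ⟪z, P z⟫ ≤ ‖z‖ ‖P z‖`. -/
theorem norm_basisProj_le {b : ι → K} (hb : Orthonormal ℂ b) (F : Finset ι) :
    ‖(basisProj b F : K ⊗ₕ H →L[ℂ] K ⊗ₕ H)‖ ≤ 1 := by
  classical
  refine ContinuousLinearMap.opNorm_le_bound _ zero_le_one fun z => ?_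
  rw [one_mul]
  set P : K ⊗ₕ H →L[ℂ] K ⊗ₕ H := basisProj b F
  have h1 : P (P z) = P z := by
    simp only [P, basisProj, sum_apply, ContinuousLinearMap.comp_apply, map_sum,
      ketE_apply, braE_htmul, orthonormal_iff_ite.1 hb]
    refine Finset.sum_congr rfl fun i hi => ?_
    rw [Finset.sum_eq_single_of_mem i hi fun k _ hk => by simp [hk, htmul]]
    simp
  have h2 : ⟪z, P z⟫_ℂ = ⟪P z, P z⟫_ℂ := by rw [inner_basisProj_left, h1]
  have h4 : ‖P z‖ ^ 2 ≤ ‖z‖ * ‖P z‖ := by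
    have := norm_inner_le_norm (𝕜 := ℂ) z (P z)
    rw [h2, inner_self_eq_norm_sq_to_K] at this
    simpa using this
  rcases (norm_nonneg (P z)).eq_or_lt with h | h
  · rw [← h]; positivity
  · nlinarith

/-- On simple tensors this is the basis expansion of the left leg; contractivity of the projections
extends it to the closure of their span. -/
theorem tendsto_basisProj (b : HilbertBasis ι ℂ K) (z : K ⊗ₕ H) :
    Tendsto (fun F : Finset ι => (basisProj b F : K ⊗ₕ H →L[ℂ] K ⊗ₕ H) z) atTop (𝓝 z) := by
  let S : Submodule ℂ (K ⊗ₕ H) :=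
    { carrier := {z | Tendsto (fun F : Finset ι => basisProj b F z) atTop (𝓝 z)}
      zero_mem' := by simp
      add_mem' := fun {x y} hx hy => by simpa using Tendsto.add hx hy
      smul_mem' := fun c x hx => by simpa using Tendsto.const_smul hx c }
  have hd : (Submodule.span ℂ (range fun p : K × H => htmul p.1 p.2)) ≤ S := by
    refine Submodule.span_le.2 ?_
    rintro _ ⟨⟨x, u⟩, rfl⟩
    change Tendsto _ _ _
    have h1 : Tendsto (fun F : Finset ι => htmul (∑ i ∈ F, b.repr x i • b i) u) atTop
        (𝓝 (htmul x u)) := ((continuous_htmul_left u).tendsto x).comp (b.hasSum_repr x)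
    refine h1.congr fun F => ?_
    rw [basisProj_eq_hmap, hmap_htmul]
    simp [sum_apply, b.repr_apply_apply]
  refine Metric.tendsto_nhds.2 fun ε hε => ?_
  obtain ⟨w, hw, hzw⟩ := Metric.mem_closure_iff.1 (dense_htmul z) (ε / 3) (by positivity)
  filter_upwards [Metric.tendsto_nhds.1 (hd hw) (ε / 3) (by positivity)] with F hF
  have h1 : dist (basisProj b F z) (basisProj b F w) ≤ dist z w := by
    rw [dist_eq_norm, dist_eq_norm, ← map_sub]
    exact (ContinuousLinearMap.le_of_opNorm_le _ (norm_basisProj_le b.orthonormal F) _).trans_eq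
      (one_mul _)
  have h2 := dist_triangle4 (basisProj b F z) (basisProj b F w) w z
  rw [dist_comm w z] at h2
  linarith

end BasisProj

/-! ### The ultraweak topology -/

section UltraweakTopology
variable {H H' ι : Type*}
  [NormedAddCommGroup H] [InnerProductSpace ℂ H]
  [NormedAddCommGroup H'] [InnerProductSpace ℂ H']

theorem tendsto_ultraweak_iff {F : ι → (H →L[ℂ] H')} {l : Filter ι} {T : H →L[ℂ] H'} :
    Tendsto F l (@nhds _ (ultraweak H H') T) ↔
      ∀ (ξ : ℕ → H') (η : ℕ → H), (Summable fun n => ‖ξ n‖ ^ 2) → (Summable fun n => ‖η n‖ ^ 2) →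
        Tendsto (fun i => ∑' n, ⟪ξ n, F i (η n)⟫_ℂ) l (𝓝 (∑' n, ⟪ξ n, T (η n)⟫_ℂ)) := by
  rw [nhds_iInf, tendsto_iInf]
  simp only [nhds_induced, tendsto_comap_iff]
  exact ⟨fun h ξ η h1 h2 => h ⟨(ξ, η), h1, h2⟩, fun h p => h p.1.1 p.1.2 p.2.1 p.2.2⟩

/-- A vector functional is one of the defining series, with both sequences supported at index `0`.
-/
theorem continuous_inner_ultraweak (ξ : H') (η : H) :
    @Continuous _ _ (ultraweak H H') _ fun T : H →L[ℂ] H' => ⟪ξ, T η⟫_ℂ := by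
  let := ultraweak H H'
  refine continuous_iff_continuousAt.2 fun T => ?_
  have h := tendsto_ultraweak_iff.1 (tendsto_id (x := @nhds _ (ultraweak H H') T))
    (Pi.single 0 ξ) (Pi.single 0 η) ?_ ?_
  · have h1 : ∀ T : H →L[ℂ] H', ∑' n, ⟪(Pi.single 0 ξ : ℕ → H') n,
        T ((Pi.single 0 η : ℕ → H) n)⟫_ℂ = ⟪ξ, T η⟫_ℂ := by
      intro T
      rw [tsum_eq_single 0 fun n hn => by simp [Pi.single_eq_of_ne hn]]
      simp
    simpa only [h1, id] using! h
  all_goals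
    refine summable_of_ne_finset_zero (s := {0}) fun n hn => ?_
    rw [Finset.mem_singleton] at hn
    simp [Pi.single_eq_of_ne hn]

theorem tendsto_inner_of_ultraweak {F : ι → (H →L[ℂ] H')} {l : Filter ι} {T : H →L[ℂ] H'}
    (h : Tendsto F l (@nhds _ (ultraweak H H') T)) (ξ : H') (η : H) :
    Tendsto (fun i => ⟪ξ, F i η⟫_ℂ) l (𝓝 ⟪ξ, T η⟫_ℂ) := by
  let := ultraweak H H'
  exact ((continuous_inner_ultraweak ξ η).tendsto T).comp h

theorem summable_norm_mul_norm {X Y : Type*} [NormedAddCommGroup X] [NormedAddCommGroup Y]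
    {ξ : ℕ → X} {η : ℕ → Y} (h1 : Summable fun n => ‖ξ n‖ ^ 2)
    (h2 : Summable fun n => ‖η n‖ ^ 2) : Summable fun n => ‖ξ n‖ * ‖η n‖ :=
  Summable.of_nonneg_of_le (fun n => by positivity)
    (fun n => by nlinarith [sq_nonneg (‖ξ n‖ - ‖η n‖)]) ((h1.add h2).div_const 2)

/-- On bounded sets the ultraweak topology is the weak operator topology. -/
theorem tendsto_ultraweak_of_bounded {F : ι → (H →L[ℂ] H')} {l : Filter ι} {T : H →L[ℂ] H'}
    (C : ℝ) (hC : ∀ᶠ i in l, ‖F i‖ ≤ C)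
    (h : ∀ ξ η, Tendsto (fun i => ⟪ξ, F i η⟫_ℂ) l (𝓝 ⟪ξ, T η⟫_ℂ)) :
    Tendsto F l (@nhds _ (ultraweak H H') T) := by
  refine tendsto_ultraweak_iff.2 fun ξ η h1 h2 => ?_
  refine tendsto_tsum_of_dominated_convergence (bound := fun n => C * (‖ξ n‖ * ‖η n‖))
    ((summable_norm_mul_norm h1 h2).mul_left C) (fun n => h _ _) ?_
  filter_upwards [hC] with i hi n
  calc ‖⟪ξ n, F i (η n)⟫_ℂ‖ ≤ ‖ξ n‖ * ‖F i (η n)‖ := norm_inner_le_norm _ _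
    _ ≤ ‖ξ n‖ * (C * ‖η n‖) := by
      gcongr
      exact ContinuousLinearMap.le_of_opNorm_le _ hi _
    _ = C * (‖ξ n‖ * ‖η n‖) := by ring

/-- After moving `b` to the other side of the inner product, the relation is a system of equations
between vector functionals of `T`. This is how commutation passes from generators to ultraweak
closures. -/
theorem isClosed_ultraweak_intertwine [CompleteSpace H'] (a : H →L[ℂ] H)
    (b : H' →L[ℂ] H') :
    @IsClosed _ (ultraweak H H') {T : H →L[ℂ] H' | T ∘L a = b ∘L T} := by
  let := ultraweak H H'
  have h : {T : H →L[ℂ] H' | T ∘L a = b ∘L T} =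
      ⋂ (ξ : H') (η : H), {T | ⟪ξ, T (a η)⟫_ℂ = ⟪b.adjoint ξ, T η⟫_ℂ} := by
    ext T
    simp only [mem_ofPred_eq, mem_iInter, ContinuousLinearMap.adjoint_inner_left]
    refine ⟨fun h ξ η => congrArg (fun S : H →L[ℂ] H' => ⟪ξ, S η⟫_ℂ) h, fun h => ?_⟩
    exact ContinuousLinearMap.ext fun η => ext_inner_left ℂ fun ξ => h ξ η
  rw [h]
  exact isClosed_iInter fun ξ => isClosed_iInter fun η =>
    isClosed_eq (continuous_inner_ultraweak _ _) (continuous_inner_ultraweak _ _)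

end UltraweakTopology

/-! ### Ultraweak tensor products with `B(K)` -/

section OpTensor
variable {H K : Type*}
  [NormedAddCommGroup H] [InnerProductSpace ℂ H] [CompleteSpace H]
  [NormedAddCommGroup K] [InnerProductSpace ℂ K] [CompleteSpace K]

/-- The compressions of `T` by finite basis projections are finite sums of rank-one operators
tensored with slices of `T`; they are bounded by `‖T‖` and converge weakly, hence ultraweakly, to
`T`. Nothing is assumed about `S`, so the result also applies when `S` is itself an ultraweak tensor
product. -/
theorem mem_opTensor_of_slices {S : Set (H →L[ℂ] H)} {T : K ⊗ₕ H →L[ℂ] K ⊗ₕ H}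
    (h : ∀ x y : K, braE x ∘L T ∘L ketE y ∈ S) : T ∈ opTensor K S := by
  obtain ⟨w, b, -⟩ := exists_hilbertBasis ℂ K
  have h1 : Tendsto (fun F : Finset w => basisProj b F ∘L T ∘L basisProj b F) atTop
      (@nhds _ (ultraweak _ _) T) := by
    refine tendsto_ultraweak_of_bounded (1 * (‖T‖ * 1)) (Eventually.of_forall fun F => ?_) ?_
    · refine (ContinuousLinearMap.opNorm_comp_le _ _).trans (mul_le_mul
        (norm_basisProj_le b.orthonormal F) ((ContinuousLinearMap.opNorm_comp_le _ _).trans ?_)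
        (norm_nonneg _) zero_le_one)
      exact mul_le_mul_of_nonneg_left (norm_basisProj_le b.orthonormal F) (norm_nonneg _)
    · intro ξ η
      have h2 := (tendsto_basisProj b ξ).inner (𝕜 := ℂ)
        ((T.continuous.tendsto _).comp (tendsto_basisProj b η))
      refine h2.congr fun F => ?_
      exact inner_basisProj_left _ _ _ _
  let := ultraweak (K ⊗ₕ H) (K ⊗ₕ H)
  refine mem_closure_of_tendsto h1 (Eventually.of_forall fun F => ?_)
  have h3 : basisProj b F ∘L T ∘L basisProj b F = ∑ i ∈ F, ∑ j ∈ F,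
      hmap (InnerProductSpace.rankOne ℂ (b i) (b j)) (braE (b i) ∘L T ∘L ketE (b j)) := by
    refine ContinuousLinearMap.ext fun z => ?_
    simp only [basisProj, hmap_rankOne, sum_apply, ContinuousLinearMap.comp_apply, map_sum]
    exact Finset.sum_comm
  rw [h3]
  exact Submodule.sum_mem _ fun i _ => Submodule.sum_mem _ fun j _ =>
    Submodule.subset_span ⟨_, _, h _ _, rfl⟩

variable (A : VonNeumannAlgebra H)

/-- This is the double commutant theorem. -/
theorem mem_iff_commute {a : H →L[ℂ] H} :
    a ∈ A.toStarSubalgebra ↔ ∀ a' ∈ A.commutant, a ∘L a' = a' ∘L a := by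
  have h : a ∈ A.toStarSubalgebra ↔ a ∈ A.commutant.commutant := by
    rw [VonNeumannAlgebra.commutant_commutant]; rfl
  rw [h, VonNeumannAlgebra.mem_commutant_iff]
  exact forall₂_congr fun _ _ => ⟨Eq.symm, Eq.symm⟩

theorem slice_mem_of_commute {T : K ⊗ₕ H →L[ℂ] K ⊗ₕ H}
    (h : ∀ a' ∈ A.commutant, T ∘L hmap 1 a' = hmap 1 a' ∘L T) (x y : K) :
    braE x ∘L T ∘L ketE y ∈ A.toStarSubalgebra := by
  refine (mem_iff_commute A).2 fun a' ha' => ?_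
  have h1 : ketE y ∘L a' = hmap (1 : K →L[ℂ] K) a' ∘L ketE y := by
    rw [hmap_comp_ketE]; rfl
  calc (braE x ∘L T ∘L ketE y) ∘L a' = braE x ∘L T ∘L (ketE y ∘L a') := rfl
    _ = braE x ∘L (T ∘L hmap 1 a') ∘L ketE y := by rw [h1]; rfl
    _ = (braE x ∘L hmap 1 a') ∘L T ∘L ketE y := by rw [h a' ha']; rfl
    _ = a' ∘L (braE x ∘L T ∘L ketE y) := by rw [braE_comp_hmap_one]; rfl

/-- `B(K) ⊗̄ A` is the commutant of `I ⊗ A'`. -/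
theorem mem_opTensor_iff_commute {T : K ⊗ₕ H →L[ℂ] K ⊗ₕ H} :
    T ∈ opTensor K (A : Set (H →L[ℂ] H)) ↔
      ∀ a' ∈ A.commutant, T ∘L hmap 1 a' = hmap 1 a' ∘L T := by
  refine ⟨fun hT a' ha' => ?_, fun h => mem_opTensor_of_slices (slice_mem_of_commute A h)⟩
  let := ultraweak (K ⊗ₕ H) (K ⊗ₕ H)
  have hc := isClosed_ultraweak_intertwine (hmap (1 : K →L[ℂ] K) a')
    (hmap (1 : K →L[ℂ] K) a')
  refine closure_minimal ?_ hc hT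
  intro S hS
  induction hS using Submodule.span_induction with
  | mem S hS =>
    obtain ⟨b, a, ha, rfl⟩ := hS
    change _ = _
    rw [hmap_comp, hmap_comp, (mem_iff_commute A).1 ha a' ha']
    rfl
  | zero => simp
  | add S S' _ _ h1 h2 =>
    simp only [mem_ofPred_eq, ContinuousLinearMap.add_comp, ContinuousLinearMap.comp_add] at *
    rw [h1, h2]
  | smul c S _ h1 =>
    simp only [mem_ofPred_eq, ContinuousLinearMap.smul_comp, ContinuousLinearMap.comp_smul] at *
    rw [h1]

theorem mem_opTensor_iff_slices {T : K ⊗ₕ H →L[ℂ] K ⊗ₕ H} :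
    T ∈ opTensor K (A : Set (H →L[ℂ] H)) ↔
      ∀ x y : K, braE x ∘L T ∘L ketE y ∈ A.toStarSubalgebra :=
  ⟨fun h => slice_mem_of_commute A ((mem_opTensor_iff_commute A).1 h), mem_opTensor_of_slices⟩

theorem comp_mem_opTensor {S T : K ⊗ₕ H →L[ℂ] K ⊗ₕ H}
    (hS : S ∈ opTensor K (A : Set (H →L[ℂ] H))) (hT : T ∈ opTensor K (A : Set (H →L[ℂ] H))) :
    S ∘L T ∈ opTensor K (A : Set (H →L[ℂ] H)) := by
  rw [mem_opTensor_iff_commute] at *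
  intro a' ha'
  rw [ContinuousLinearMap.comp_assoc, hT a' ha', ← ContinuousLinearMap.comp_assoc, hS a' ha',
    ContinuousLinearMap.comp_assoc]

theorem sub_mem_opTensor {S T : K ⊗ₕ H →L[ℂ] K ⊗ₕ H}
    (hS : S ∈ opTensor K (A : Set (H →L[ℂ] H))) (hT : T ∈ opTensor K (A : Set (H →L[ℂ] H))) :
    S - T ∈ opTensor K (A : Set (H →L[ℂ] H)) := by
  rw [mem_opTensor_iff_commute] at *
  intro a' ha'
  rw [ContinuousLinearMap.sub_comp, ContinuousLinearMap.comp_sub, hS a' ha', hT a' ha']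

theorem one_mem_opTensor : (1 : K ⊗ₕ H →L[ℂ] K ⊗ₕ H) ∈ opTensor K (A : Set (H →L[ℂ] H)) :=
  (mem_opTensor_iff_commute A).2 fun _ _ => rfl

theorem adjoint_mem_opTensor {T : K ⊗ₕ H →L[ℂ] K ⊗ₕ H}
    (hT : T ∈ opTensor K (A : Set (H →L[ℂ] H))) :
    T.adjoint ∈ opTensor K (A : Set (H →L[ℂ] H)) := by
  rw [mem_opTensor_iff_commute] at *
  intro a' ha'
  have h1 := congrArg ContinuousLinearMap.adjoint (hT (star a') (star_mem ha'))
  rw [ContinuousLinearMap.adjoint_comp, ContinuousLinearMap.adjoint_comp, adjoint_hmap,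
    ← ContinuousLinearMap.star_eq_adjoint, ← ContinuousLinearMap.star_eq_adjoint, star_star,
    star_one] at h1
  exact h1.symm

/-- The relation `c a' = (I ⊗ a') c` holds on the generators `|x⟩ ⊗ a` and survives ultraweak
closure; slicing it shows that `E^x c` commutes with the commutant. -/
theorem braE_comp_mem_of_mem_ketTensor {c : H →L[ℂ] K ⊗ₕ H}
    (hc : c ∈ ketTensor K (A : Set (H →L[ℂ] H))) (x : K) :
    braE x ∘L c ∈ A.toStarSubalgebra := by
  refine (mem_iff_commute A).2 fun a' ha' => ?_
  suffices h : c ∘L a' = hmap 1 a' ∘L c by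
    rw [ContinuousLinearMap.comp_assoc, h, ← ContinuousLinearMap.comp_assoc, braE_comp_hmap_one]
    rfl
  let := ultraweak H (K ⊗ₕ H)
  refine closure_minimal ?_ (isClosed_ultraweak_intertwine a' (hmap (1 : K →L[ℂ] K) a'))
    hc
  intro S hS
  induction hS using Submodule.span_induction with
  | mem S hS =>
    obtain ⟨x, a, ha, rfl⟩ := hS
    change _ = _
    rw [ContinuousLinearMap.comp_assoc, (mem_iff_commute A).1 ha a' ha',
      ← ContinuousLinearMap.comp_assoc, ← ContinuousLinearMap.comp_assoc, hmap_comp_ketE]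
    rfl
  | zero => simp
  | add S S' _ _ h1 h2 =>
    simp only [mem_ofPred_eq, ContinuousLinearMap.add_comp, ContinuousLinearMap.comp_add] at *
    rw [h1, h2]
  | smul c S _ h1 =>
    simp only [mem_ofPred_eq, ContinuousLinearMap.smul_comp, ContinuousLinearMap.comp_smul] at *
    rw [h1]

end OpTensor

/-! ### Vectors and operators with prescribed moments -/

section Moments
variable {X Y ι κ : Type*}
  [NormedAddCommGroup X] [InnerProductSpace ℂ X] [CompleteSpace X]
  [NormedAddCommGroup Y] [InnerProductSpace ℂ Y]

/-- Existence of a vector with given inner products with a total family. -/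
theorem exists_vector_of_moments {v : ι → X}
    (hv : (Submodule.span ℂ (range v)).topologicalClosure = ⊤) (m : ι → ℂ) {B : ℝ} (hB : 0 ≤ B)
    (h : ∀ c : ι →₀ ℂ, ‖c.sum fun i a => star a * m i‖ ≤ B * ‖c.sum fun i a => a • v i‖) :
    ∃ x : X, ‖x‖ ≤ B ∧ ∀ i, ⟪v i, x⟫_ℂ = m i := by
  set e := Finsupp.linearCombination ℂ v
  set f := Finsupp.linearCombination ℂ fun i => star (m i)
  have hd : DenseRange e := by
    have h1 := Submodule.dense_iff_topologicalClosure_eq_top.2 hv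
    rwa [← Finsupp.range_linearCombination] at h1
  have hn : ∀ c, ‖f c‖ ≤ B * ‖e c‖ := by
    intro c
    refine le_trans (le_of_eq ?_) (h c)
    rw [← norm_star (c.sum _)]
    congr 1
    simp only [f, Finsupp.linearCombination_apply, Finsupp.sum, star_sum, star_mul', star_star,
      smul_eq_mul]
  set l : X →L[ℂ] ℂ := f.extendOfNorm e
  refine ⟨(InnerProductSpace.toDual ℂ X).symm l, ?_, fun i => ?_⟩
  · rw [LinearIsometryEquiv.norm_map]
    exact LinearMap.opNorm_extendOfNorm_le hd hB hn
  · have h1 : l (v i) = star (m i) := by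
      simpa [e, f, l] using LinearMap.extendOfNorm_eq (f := f) hd ⟨B, hn⟩ (Finsupp.single i 1)
    rw [← inner_conj_symm, InnerProductSpace.toDual_symm_apply, h1]
    exact star_star _

/-- Existence of an operator with given matrix elements with respect to total families. -/
theorem exists_operator_of_moments {v : ι → X} {w : κ → Y}
    (hv : (Submodule.span ℂ (range v)).topologicalClosure = ⊤)
    (hw : (Submodule.span ℂ (range w)).topologicalClosure = ⊤) (k : ι → κ → ℂ) {B : ℝ} (hB : 0 ≤ B)
    (h : ∀ (c : ι →₀ ℂ) (d : κ →₀ ℂ), ‖c.sum fun i a => d.sum fun j b => star a * b * k i j‖ ≤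
      B * ‖c.sum fun i a => a • v i‖ * ‖d.sum fun j b => b • w j‖) :
    ∃ R : Y →L[ℂ] X, ‖R‖ ≤ B ∧ ∀ i j, ⟪v i, R (w j)⟫_ℂ = k i j := by
  have h1 : ∀ d : κ →₀ ℂ, ∃ x : X, ‖x‖ ≤ B * ‖d.sum fun j b => b • w j‖ ∧
      ∀ i, ⟪v i, x⟫_ℂ = d.sum fun j b => b * k i j := by
    intro d
    refine exists_vector_of_moments hv _ (by positivity) fun c => ?_
    refine le_trans (le_of_eq ?_) ((h c d).trans_eq (by ring))
    congr 1
    refine Finset.sum_congr rfl fun i _ => ?_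
    simp only [Finsupp.sum, Finset.mul_sum, mul_assoc]
  choose x hx1 hx2 using h1
  set e := Finsupp.linearCombination ℂ w
  have hd : DenseRange e := by
    have h1 := Submodule.dense_iff_topologicalClosure_eq_top.2 hw
    rwa [← Finsupp.range_linearCombination] at h1
  let f : (κ →₀ ℂ) →ₗ[ℂ] X :=
    { toFun := x
      map_add' := fun c d => ext_inner_of_total hv fun i => by
        rw [inner_add_right, hx2, hx2, hx2, Finsupp.sum_add_index']
        · simp
        · intros; ring
      map_smul' := fun c d => ext_inner_of_total hv fun i => by
        rw [RingHom.id_apply, inner_smul_right, hx2, hx2, Finsupp.sum_smul_index' (by simp),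
          Finsupp.mul_sum]
        simp only [smul_eq_mul, mul_assoc] }
  have hn : ∀ c, ‖f c‖ ≤ B * ‖e c‖ := fun c => by
    rw [Finsupp.linearCombination_apply]
    exact hx1 c
  refine ⟨f.extendOfNorm e, LinearMap.opNorm_extendOfNorm_le hd hB hn, fun i j => ?_⟩
  have h2 := LinearMap.extendOfNorm_eq (f := f) hd ⟨B, hn⟩ (Finsupp.single j 1)
  have h3 : e (Finsupp.single j 1) = w j := by simp [e]
  rw [h3] at h2
  rw [h2]
  change ⟪v i, x _⟫_ℂ = _
  rw [hx2]
  simp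

end Moments

/-! ### Normal functionals -/

section Normal
variable {H H' : Type*}
  [NormedAddCommGroup H] [InnerProductSpace ℂ H] [CompleteSpace H]
  [NormedAddCommGroup H'] [InnerProductSpace ℂ H'] [CompleteSpace H']
  (A : VonNeumannAlgebra H)

theorem summable_inner_seq {H : Type*} [NormedAddCommGroup H] [InnerProductSpace ℂ H] {ξ η : ℕ → H} (h : Summable fun n => ‖ξ n‖ * ‖η n‖) (a : H →L[ℂ] H) :
    Summable fun n => ⟪ξ n, a (η n)⟫_ℂ :=
  Summable.of_norm_bounded (h.mul_left ‖a‖) fun n =>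
    (norm_inner_le_norm _ _).trans (by
      rw [mul_left_comm]
      exact mul_le_mul_of_nonneg_left (a.le_opNorm _) (norm_nonneg _))

/-- The functional `a ↦ ∑ₙ ⟪ξₙ, a ηₙ⟫` on `A`. -/
def seqFunctional (ξ η : ℕ → H) (h : Summable fun n => ‖ξ n‖ * ‖η n‖) :
    A.toStarSubalgebra →ₗ[ℂ] ℂ where
  toFun a := ∑' n, ⟪ξ n, (a : H →L[ℂ] H) (η n)⟫_ℂ
  map_add' a b := by
    rw [← (summable_inner_seq h _).tsum_add (summable_inner_seq h _)]
    simp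
  map_smul' c a := by
    rw [RingHom.id_apply, smul_eq_mul, ← tsum_mul_left]
    simp

/-- Vector functionals composed with a normal map are of the form `a ↦ ∑ₙ ⟪ξₙ, a ηₙ⟫`. -/
theorem IsNormal.exists_hasSum {φ : A.toStarSubalgebra →ₗ[ℂ] (H' →L[ℂ] H')} (hφ : IsNormal A φ)
    (ζ ζ' : H') : ∃ ξ η : ℕ → H, (Summable fun n => ‖ξ n‖ ^ 2) ∧ (Summable fun n => ‖η n‖ ^ 2) ∧
      ∀ a : A.toStarSubalgebra, HasSum (fun n => ⟪ξ n, (a : H →L[ℂ] H) (η n)⟫_ℂ) ⟪ζ, φ a ζ'⟫_ℂ := by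
  let ψ : A.toStarSubalgebra →ₗ[ℂ] ℂ :=
    { toFun := fun a => ⟪ζ, φ a ζ'⟫_ℂ
      map_add' := by simp
      map_smul' := by simp }
  let f (p : {p : (ℕ → H) × (ℕ → H) //
      (Summable fun n => ‖p.1 n‖ ^ 2) ∧ Summable fun n => ‖p.2 n‖ ^ 2}) :
      A.toStarSubalgebra →ₗ[ℂ] ℂ :=
    seqFunctional A p.1.1 p.1.2 (summable_norm_mul_norm p.2.1 p.2.2)
  have hc : ψ ∈ Submodule.span ℂ (range f) := by
    -- A linear functional that is continuous for the initial topology of a family of linear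
    -- functionals is a finite linear combination of them.
    refine (LinearMap.mem_span_iff_continuous ψ).2 ?_
    have h1 : Continuous[TopologicalSpace.induced Subtype.val (ultraweak H H), inferInstance] ψ :=
      @Continuous.comp _ _ _ (TopologicalSpace.induced Subtype.val (ultraweak H H))
        (ultraweak H' H') _ _ _ (continuous_inner_ultraweak ζ ζ') hφ
    have h0 : TopologicalSpace.induced (Subtype.val : A.toStarSubalgebra → _) (ultraweak H H) =
        ⨅ p, TopologicalSpace.induced (f p) inferInstance := by
      rw [induced_iInf]
      exact iInf_congr fun p => induced_compose
    rwa [h0] at h1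
  have key : ∀ χ ∈ Submodule.span ℂ (range f), ∃ ξ η : ℕ → H, (Summable fun n => ‖ξ n‖ ^ 2) ∧
      (Summable fun n => ‖η n‖ ^ 2) ∧
      ∀ a : A.toStarSubalgebra, HasSum (fun n => ⟪ξ n, (a : H →L[ℂ] H) (η n)⟫_ℂ) (χ a) := by
    intro χ hχ
    induction hχ using Submodule.span_induction with
    | mem χ hχ =>
      obtain ⟨p, rfl⟩ := hχ
      exact ⟨p.1.1, p.1.2, p.2.1, p.2.2, fun a =>
        (summable_inner_seq (summable_norm_mul_norm p.2.1 p.2.2) _).hasSum⟩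
    | zero => exact ⟨0, 0, by simp, by simp,
        fun a => by simp⟩
    | add χ χ' _ _ h1 h2 =>
      obtain ⟨ξ, η, a1, a2, a3⟩ := h1
      obtain ⟨ξ', η', b1, b2, b3⟩ := h2
      -- Placing one representation on the even indices and the other on the odd indices represents
      -- the sum by a single pair of sequences.
      have ev : ∀ n, (2 * n) % 2 = 0 := fun n => by omega
      have od : ∀ n, (2 * n + 1) % 2 ≠ 0 := fun n => by omega
      have ev2 : ∀ n, (2 * n) / 2 = n := fun n => by omega
      have od2 : ∀ n, (2 * n + 1) / 2 = n := fun n => by omega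
      refine ⟨fun n => if n % 2 = 0 then ξ (n / 2) else ξ' (n / 2),
        fun n => if n % 2 = 0 then η (n / 2) else η' (n / 2), ?_, ?_, fun a => ?_⟩
      · exact (HasSum.even_add_odd (f := fun n => ‖if n % 2 = 0 then ξ (n / 2) else ξ' (n / 2)‖ ^ 2)
          (by simpa only [ev, ev2, if_true] using a1.hasSum)
          (by simpa only [od, od2, if_false] using b1.hasSum)).summable
      · exact (HasSum.even_add_odd (f := fun n => ‖if n % 2 = 0 then η (n / 2) else η' (n / 2)‖ ^ 2)
          (by simpa only [ev, ev2, if_true] using a2.hasSum)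
          (by simpa only [od, od2, if_false] using b2.hasSum)).summable
      · exact HasSum.even_add_odd (by simpa only [ev, ev2, if_true] using a3 a)
          (by simpa only [od, od2, if_false] using b3 a)
    | smul c χ _ h1 =>
      obtain ⟨ξ, η, a1, a2, a3⟩ := h1
      refine ⟨ξ, fun n => c • η n, a1, ?_, fun a => ?_⟩
      · simpa only [norm_smul, mul_pow] using a2.mul_left (‖c‖ ^ 2)
      · rw [LinearMap.smul_apply, smul_eq_mul]
        simpa only [map_smul, inner_smul_right] using (a3 a).mul_left c
  exact key ψ hc

end Normal

/-! ### Existence and algebraic properties of ampliations -/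

section Ampliation
variable {H H' K : Type*}
  [NormedAddCommGroup H] [InnerProductSpace ℂ H] [CompleteSpace H]
  [NormedAddCommGroup H'] [InnerProductSpace ℂ H'] [CompleteSpace H']
  [NormedAddCommGroup K] [InnerProductSpace ℂ K] [CompleteSpace K]
  (A : VonNeumannAlgebra H)

theorem inner_htmul_blockOp {n : ℕ} (a : Fin n → Fin n → (H →L[ℂ] H))
    (x y : EuclideanSpace ℂ (Fin n)) (u v : H) :
    ⟪htmul x u, blockOp a (htmul y v)⟫_ℂ = ∑ i, ∑ j, star (x i) * y j * ⟪u, a i j v⟫_ℂ := by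
  simp only [blockOp, sum_apply, ContinuousLinearMap.comp_apply, braE_htmul, ketE_apply, map_smul,
    inner_sum, inner_smul_right, inner_htmul]
  refine Finset.sum_congr rfl fun i _ => Finset.sum_congr rfl fun j _ => ?_
  rw [EuclideanSpace.inner_single_left, EuclideanSpace.inner_single_right]
  simp only [RCLike.star_def, map_one, one_mul]
  ring

/-- Reassembling the slices of `T` gives `P T P` for the contraction `P` built from the standard
basis. -/
theorem norm_blockOp_slices_le {n : ℕ} (T : EuclideanSpace ℂ (Fin n) ⊗ₕ H →L[ℂ]
      EuclideanSpace ℂ (Fin n) ⊗ₕ H) :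
    ‖blockOp fun i j => braE (EuclideanSpace.single i (1 : ℂ)) ∘L T ∘L
      ketE (EuclideanSpace.single j (1 : ℂ))‖ ≤ ‖T‖ := by
  have ho : Orthonormal ℂ fun i : Fin n => EuclideanSpace.single i (1 : ℂ) :=
    EuclideanSpace.orthonormal_single
  set P := (basisProj (fun i : Fin n => EuclideanSpace.single i (1 : ℂ)) Finset.univ :
    EuclideanSpace ℂ (Fin n) ⊗ₕ H →L[ℂ] EuclideanSpace ℂ (Fin n) ⊗ₕ H)
  have hP : ‖P‖ ≤ 1 := norm_basisProj_le ho _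
  have h : (blockOp fun i j => braE (EuclideanSpace.single i (1 : ℂ)) ∘L T ∘L
      ketE (EuclideanSpace.single j (1 : ℂ))) = P ∘L T ∘L P := by
    refine ContinuousLinearMap.ext fun z => ?_
    simp only [P, basisProj, blockOp, sum_apply, ContinuousLinearMap.comp_apply, map_sum]
    exact Finset.sum_comm
  rw [h]
  calc ‖P ∘L T ∘L P‖ ≤ ‖P‖ * (‖T‖ * ‖P‖) := (ContinuousLinearMap.opNorm_comp_le _ _).trans
        (mul_le_mul_of_nonneg_left (ContinuousLinearMap.opNorm_comp_le _ _) (norm_nonneg _))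
    _ ≤ 1 * (‖T‖ * 1) := by gcongr
    _ = ‖T‖ := by ring

/-- An orthonormal basis of the span of `s` does this. It reduces questions about finitely many
vectors of `K` to `ℂⁿ`, where complete boundedness is formulated. -/
theorem exists_isometry_onto_span {K : Type*} [NormedAddCommGroup K] [InnerProductSpace ℂ K]
    (s : Finset K) :
    ∃ (n : ℕ) (V : EuclideanSpace ℂ (Fin n) →ₗᵢ[ℂ] K), ∀ x ∈ s, ∃ a, V a = x := by
  let W := Submodule.span ℂ (s : Set K)
  have : FiniteDimensional ℂ W := FiniteDimensional.span_of_finite ℂ s.finite_toSet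
  let e := stdOrthonormalBasis ℂ W
  refine ⟨_, W.subtypeₗᵢ.comp e.repr.symm.toLinearIsometry, fun x hx => ?_⟩
  exact ⟨e.repr ⟨x, Submodule.subset_span hx⟩, by simp⟩

/-- A completely bounded map has ampliations, of uniformly bounded norm. -/
theorem exists_isAmpliation (K : Type*) [NormedAddCommGroup K] [InnerProductSpace ℂ K]
    [CompleteSpace K] {φ : A.toStarSubalgebra →ₗ[ℂ] (H' →L[ℂ] H')}
    (hφ : IsCompletelyBounded A φ) : ∃ C : ℝ, 0 ≤ C ∧ ∀ T : K ⊗ₕ H →L[ℂ] K ⊗ₕ H,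
      T ∈ opTensor K (A : Set (H →L[ℂ] H)) → ∃ R, IsAmpliation A φ T R ∧ ‖R‖ ≤ C * ‖T‖ := by
  classical
  obtain ⟨C, hC⟩ := hφ
  refine ⟨|C|, abs_nonneg C, fun T hT => ?_⟩
  rw [mem_opTensor_iff_slices] at hT
  have ht : (Submodule.span ℂ (range fun p : K × H' => htmul p.1 p.2)).topologicalClosure = ⊤ :=
    Submodule.dense_iff_topologicalClosure_eq_top.1 dense_htmul
  -- The slice condition prescribes every matrix element of `R` between simple tensors; only
  -- boundedness of the resulting form is at stake.
  suffices hb : ∀ c d : K × H' →₀ ℂ,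
      ‖c.sum fun p a => d.sum fun q b => star a * b * ⟪p.2, φ ⟨_, hT p.1 q.1⟩ q.2⟫_ℂ‖ ≤
        |C| * ‖T‖ * ‖c.sum fun p a => a • htmul p.1 p.2‖ * ‖d.sum fun q b => b • htmul q.1 q.2‖ by
    obtain ⟨R, hR, hR2⟩ := exists_operator_of_moments ht ht
      (fun p q => ⟪p.2, φ ⟨_, hT p.1 q.1⟩ q.2⟫_ℂ) (by positivity) hb
    refine ⟨R, fun x y => ⟨hT x y, ?_⟩, hR⟩
    refine ContinuousLinearMap.ext fun v => ext_inner_left ℂ fun u => ?_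
    rw [ContinuousLinearMap.comp_apply, ContinuousLinearMap.comp_apply, inner_braE, ketE_apply]
    exact hR2 (x, u) (y, v)
  intro c d
  -- Only finitely many vectors of `K` enter the two sums. After identifying their span with part of
  -- `ℂⁿ`, the form becomes that of the block matrix `φ (t i j)`, and the bound from complete
  -- boundedness does not depend on `n`.
  obtain ⟨n, V, hV⟩ := exists_isometry_onto_span
    (c.support.image Prod.fst ∪ d.support.image Prod.fst)
  set V' : EuclideanSpace ℂ (Fin n) →L[ℂ] K := V.toContinuousLinearMap
  have hVV : ∀ a, V'.adjoint (V a) = a := fun a => ext_inner_left ℂ fun b => by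
    rw [ContinuousLinearMap.adjoint_inner_right]
    exact V.inner_map_map b a
  have hV1 : ‖V'‖ ≤ 1 := V.norm_toContinuousLinearMap_le
  have hV2 : ‖V'.adjoint‖ ≤ 1 := by rwa [LinearIsometryEquiv.norm_map]
  let E (i : Fin n) : EuclideanSpace ℂ (Fin n) := EuclideanSpace.single i 1
  let t (i j : Fin n) : A.toStarSubalgebra := ⟨_, hT (V (E i)) (V (E j))⟩
  set S := blockOp fun i j => φ (t i j)
  have hS : ‖S‖ ≤ |C| * ‖T‖ := by
    refine (hC n t).trans (mul_le_mul (le_abs_self C) ?_ (norm_nonneg _) (abs_nonneg C))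
    -- The entries `t i j` are the slices of the compression of `T` to `ℂⁿ ⊗ H`, so their block
    -- operator is bounded by `‖T‖`.
    set T' := hmap V'.adjoint (1 : H →L[ℂ] H) ∘L T ∘L hmap V' (1 : H →L[ℂ] H)
    have h1 : ∀ i j, (t i j : H →L[ℂ] H) = braE (E i) ∘L T' ∘L ketE (E j) := by
      intro i j
      have e1 : braE (E i) ∘L hmap V'.adjoint (1 : H →L[ℂ] H) = braE (V (E i)) := by
        rw [braE_comp_hmap, ContinuousLinearMap.adjoint_adjoint]; rfl
      have e2 : hmap V' (1 : H →L[ℂ] H) ∘L ketE (E j) = ketE (V (E j)) := by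
        rw [hmap_comp_ketE]; rfl
      change braE (V (E i)) ∘L T ∘L ketE (V (E j)) = _
      rw [← e1, ← e2]
      rfl
    have h2 : (blockOp fun i j => (t i j : H →L[ℂ] H)) =
        blockOp fun i j => braE (E i) ∘L T' ∘L ketE (E j) := by
      congr 1
      funext i j
      exact h1 i j
    rw [h2]
    refine (norm_blockOp_slices_le T').trans ?_
    have n1 := norm_hmap_le V'.adjoint (1 : H →L[ℂ] H)
    have n2 := norm_hmap_le V' (1 : H →L[ℂ] H)
    have n3 : ‖(1 : H →L[ℂ] H)‖ ≤ 1 := ContinuousLinearMap.norm_id_le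
    have n1' : ‖hmap V'.adjoint (1 : H →L[ℂ] H)‖ ≤ 1 :=
      n1.trans (mul_le_one₀ hV2 (norm_nonneg _) n3)
    have n2' : ‖hmap V' (1 : H →L[ℂ] H)‖ ≤ 1 := n2.trans (mul_le_one₀ hV1 (norm_nonneg _) n3)
    calc ‖T'‖ ≤ ‖hmap V'.adjoint (1 : H →L[ℂ] H)‖ * (‖T‖ * ‖hmap V' (1 : H →L[ℂ] H)‖) :=
          (ContinuousLinearMap.opNorm_comp_le _ _).trans
            (mul_le_mul_of_nonneg_left (ContinuousLinearMap.opNorm_comp_le _ _) (norm_nonneg _))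
      _ ≤ 1 * (‖T‖ * 1) := by gcongr
      _ = ‖T‖ := by ring
  have key : ∀ p ∈ c.support, ∀ q ∈ d.support, ⟪p.2, φ ⟨_, hT p.1 q.1⟩ q.2⟫_ℂ =
      ⟪hmap V'.adjoint 1 (htmul p.1 p.2), S (hmap V'.adjoint 1 (htmul q.1 q.2))⟫_ℂ := by
    rintro ⟨x, u⟩ hp ⟨y, v⟩ hq
    obtain ⟨a, rfl⟩ := hV x (Finset.mem_union_left _ (Finset.mem_image_of_mem _ hp))
    obtain ⟨b, rfl⟩ := hV y (Finset.mem_union_right _ (Finset.mem_image_of_mem _ hq))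
    rw [hmap_htmul, hmap_htmul, hVV, hVV, one_apply_eq_self, one_apply_eq_self,
      inner_htmul_blockOp]
    have hsum : ∀ a : EuclideanSpace ℂ (Fin n), V a = ∑ i, a i • V (E i) := by
      intro a
      have : a = ∑ i, a i • E i := by
        ext k
        simp [E, Pi.single_apply]
      conv_lhs => rw [this]
      simp
    have h1 : (⟨_, hT (V a) (V b)⟩ : A.toStarSubalgebra) =
        ∑ i, ∑ j, (star (a i) * b j) • t i j := by
      refine Subtype.ext ?_
      change _ = A.toStarSubalgebra.subtype _
      simp only [map_sum, map_smul]
      change _ = ∑ i, ∑ j, (star (a i) * b j) • (braE (V (E i)) ∘L T ∘L ketE (V (E j)))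
      rw [hsum a, hsum b, braE_sum, ketE_sum]
      refine ContinuousLinearMap.ext fun z => ?_
      simp only [sum_apply, ContinuousLinearMap.comp_apply, map_sum, braE_smul, ketE_smul,
        smul_apply, map_smul, smul_smul, Finset.smul_sum]
      rw [Finset.sum_comm]
      refine Finset.sum_congr rfl fun i _ => Finset.sum_congr rfl fun j _ => ?_
      rw [mul_comm]
    rw [h1]
    simp only [map_sum, map_smul, sum_apply, smul_apply, inner_sum, inner_smul_right]
  have h2 : (c.sum fun p a => d.sum fun q b => star a * b * ⟪p.2, φ ⟨_, hT p.1 q.1⟩ q.2⟫_ℂ) =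
      ⟪hmap V'.adjoint 1 (c.sum fun p a => a • htmul p.1 p.2),
        S (hmap V'.adjoint 1 (d.sum fun q b => b • htmul q.1 q.2))⟫_ℂ := by
    simp only [Finsupp.sum, map_sum, map_smul, sum_inner, inner_smul_left]
    simp only [inner_sum, inner_smul_right, Finset.mul_sum]
    refine Finset.sum_congr rfl fun p hp => Finset.sum_congr rfl fun q hq => ?_
    rw [key p hp q hq]
    simp only [RCLike.star_def]
    ring
  rw [h2]
  have n3 : ‖(1 : H' →L[ℂ] H')‖ ≤ 1 := ContinuousLinearMap.norm_id_le
  have n1 : ‖hmap V'.adjoint (1 : H' →L[ℂ] H')‖ ≤ 1 :=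
      (norm_hmap_le _ _).trans (mul_le_one₀ hV2 (norm_nonneg _) n3)
  have n2 : ∀ z, ‖hmap V'.adjoint (1 : H' →L[ℂ] H') z‖ ≤ ‖z‖ := fun z =>
    (ContinuousLinearMap.le_of_opNorm_le _ n1 z).trans_eq (one_mul _)
  refine (norm_inner_le_norm _ _).trans ?_
  set z := c.sum fun p a => a • htmul p.1 p.2
  set z' := d.sum fun q b => b • htmul q.1 q.2
  calc _ ≤ ‖z‖ * (‖S‖ * ‖hmap V'.adjoint (1 : H' →L[ℂ] H') z'‖) :=
        mul_le_mul (n2 z) (ContinuousLinearMap.le_opNorm _ _) (norm_nonneg _) (norm_nonneg _)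
    _ ≤ ‖z‖ * ((|C| * ‖T‖) * ‖z'‖) := by
        gcongr
        exact n2 z'
    _ = _ := by ring

end Ampliation

/-! ### Criteria for strong and weak convergence. -/

section Convergence
variable {ι κ X Y : Type*}
  [NormedAddCommGroup X] [InnerProductSpace ℂ X] [NormedAddCommGroup Y] [InnerProductSpace ℂ Y]

/-- Strong convergence of a bounded net of operators can be tested on a total family. -/
theorem tendsto_apply_of_total {v : κ → X}
    (hv : (Submodule.span ℂ (range v)).topologicalClosure = ⊤) {l : Filter ι}
    {T : ι → (X →L[ℂ] Y)} {S : X →L[ℂ] Y} (B : ℝ) (hB : ∀ᶠ i in l, ‖T i‖ ≤ B)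
    (h : ∀ k, Tendsto (fun i => T i (v k)) l (𝓝 (S (v k)))) (x : X) :
    Tendsto (fun i => T i x) l (𝓝 (S x)) := by
  let M : Submodule ℂ X :=
    { carrier := {z | Tendsto (fun i => T i z) l (𝓝 (S z))}
      zero_mem' := by simpa using tendsto_const_nhds
      add_mem' := fun {x y} hx hy => by simpa using Tendsto.add hx hy
      smul_mem' := fun c x hx => by simpa using Tendsto.const_smul hx c }
  have hd : Submodule.span ℂ (range v) ≤ M := by
    refine Submodule.span_le.2 ?_
    rintro _ ⟨k, rfl⟩
    exact h k
  refine Metric.tendsto_nhds.2 fun ε hε => ?_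
  set C := |B| + ‖S‖ + 1
  have hC : 0 < C := by positivity
  obtain ⟨w, hw, hzw⟩ := Metric.mem_closure_iff.1
    (Submodule.dense_iff_topologicalClosure_eq_top.2 hv x) (ε / (3 * C)) (by positivity)
  have hCx : C * dist x w < ε / 3 := by
    rw [lt_div_iff₀ (by positivity)] at hzw
    linarith
  filter_upwards [Metric.tendsto_nhds.1 (hd hw) (ε / 3) (by positivity), hB] with i hF hi
  have h1 : dist (T i x) (T i w) ≤ C * dist x w := by
    rw [dist_eq_norm, dist_eq_norm, ← map_sub]
    refine (ContinuousLinearMap.le_opNorm _ _).trans (mul_le_mul_of_nonneg_right ?_ (norm_nonneg _))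
    linarith [le_abs_self B, norm_nonneg S]
  have h3 : dist (S w) (S x) ≤ C * dist x w := by
    rw [dist_comm, dist_eq_norm, dist_eq_norm, ← map_sub]
    refine (ContinuousLinearMap.le_opNorm _ _).trans (mul_le_mul_of_nonneg_right ?_ (norm_nonneg _))
    linarith [abs_nonneg B]
  have h2 := dist_triangle4 (T i x) (T i w) (S w) (S x)
  linarith

/-- Weak convergence of a bounded net of vectors can be tested on a total family. -/
theorem tendsto_inner_of_total {v : κ → X}
    (hv : (Submodule.span ℂ (range v)).topologicalClosure = ⊤) {l : Filter ι}
    {y : ι → X} {x : X} (B : ℝ) (hB : ∀ᶠ i in l, ‖y i‖ ≤ B)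
    (h : ∀ k, Tendsto (fun i => ⟪v k, y i⟫_ℂ) l (𝓝 ⟪v k, x⟫_ℂ)) (z : X) :
    Tendsto (fun i => ⟪z, y i⟫_ℂ) l (𝓝 ⟪z, x⟫_ℂ) := by
  have h1 := tendsto_apply_of_total hv (T := fun i => innerSL ℂ (y i)) (S := innerSL ℂ x) B
    (by simpa [innerSL_apply_norm] using hB) (fun k => ?_) z
  · have h2 := (Complex.continuous_conj.tendsto _).comp h1
    simpa [Function.comp_def] using! h2
  · have h2 := (Complex.continuous_conj.tendsto _).comp (h k)
    simpa [Function.comp_def] using! h2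

/-- Weak convergence together with convergence of the norms implies norm convergence. -/
theorem tendsto_of_weak_of_norm {l : Filter ι} {y : ι → X} {x : X}
    (h : ∀ z, Tendsto (fun i => ⟪z, y i⟫_ℂ) l (𝓝 ⟪z, x⟫_ℂ))
    (hn : Tendsto (fun i => ‖y i‖ ^ 2) l (𝓝 (‖x‖ ^ 2))) : Tendsto y l (𝓝 x) := by
  rw [tendsto_iff_norm_sub_tendsto_zero]
  have h1 : Tendsto (fun i => ‖y i - x‖ ^ 2) l (𝓝 0) := by
    have h2 : ∀ i, ‖y i - x‖ ^ 2 = ‖y i‖ ^ 2 - 2 * RCLike.re ⟪x, y i⟫_ℂ + ‖x‖ ^ 2 := fun i => by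
      rw [norm_sub_sq (𝕜 := ℂ), ← inner_conj_symm, RCLike.conj_re]
    simp only [h2]
    have h3 := ((hn.sub (((RCLike.continuous_re.tendsto _).comp (h x)).const_mul 2)).add_const
      (‖x‖ ^ 2))
    have h4 : ‖x‖ ^ 2 - 2 * RCLike.re ⟪x, x⟫_ℂ + ‖x‖ ^ 2 = 0 := by
      rw [inner_self_eq_norm_sq]; ring
    rw [h4] at h3
    exact h3
  have h5 := h1.sqrt
  simpa using h5

end Convergence

/-! ### Ampliations of normal `*`-homomorphisms. -/

section AmpliationAlgebra
variable {H H' K : Type*}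
  [NormedAddCommGroup H] [InnerProductSpace ℂ H] [CompleteSpace H]
  [NormedAddCommGroup H'] [InnerProductSpace ℂ H'] [CompleteSpace H']
  [NormedAddCommGroup K] [InnerProductSpace ℂ K] [CompleteSpace K]
  {A : VonNeumannAlgebra H} {φ : A.toStarSubalgebra →ₗ[ℂ] (H' →L[ℂ] H')}

theorem IsNormal.tendsto {ι : Type*} (hφ : IsNormal A φ) {l : Filter ι}
    {a : ι → A.toStarSubalgebra} {b : A.toStarSubalgebra}
    (h : Tendsto (fun i => (a i : H →L[ℂ] H)) l (@nhds _ (ultraweak H H) b)) (ξ η : H') :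
    Tendsto (fun i => ⟪ξ, φ (a i) η⟫_ℂ) l (𝓝 ⟪ξ, φ b η⟫_ℂ) := by
  refine tendsto_inner_of_ultraweak (F := fun i => φ (a i)) ?_ ξ η
  refine Tendsto.comp (@Continuous.tendsto _ _ (TopologicalSpace.induced Subtype.val
    (ultraweak H H)) (ultraweak H' H') _ hφ b) ?_
  rw [@nhds_induced _ _ (ultraweak H H) Subtype.val b]
  exact tendsto_comap_iff.2 h

theorem IsCompletelyBounded.isAmpliation_ampliate (hφ : IsCompletelyBounded A φ)
    {T : K ⊗ₕ H →L[ℂ] K ⊗ₕ H} (hT : T ∈ opTensor K (A : Set (H →L[ℂ] H))) :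
    IsAmpliation A φ T (ampliate A φ T) := by
  obtain ⟨C, -, h⟩ := exists_isAmpliation A K hφ
  obtain ⟨R, hR, -⟩ := h T hT
  rwa [hR.ampliate_eq]

theorem IsAmpliation.mem_opTensor {T : K ⊗ₕ H →L[ℂ] K ⊗ₕ H} {R : K ⊗ₕ H' →L[ℂ] K ⊗ₕ H'}
    (h : IsAmpliation A φ T R) : T ∈ opTensor K (A : Set (H →L[ℂ] H)) :=
  (mem_opTensor_iff_slices A).2 fun x y => (h x y).1

/-- Ampliations of normal multiplicative maps are multiplicative. -/
theorem IsAmpliation.comp (hφ : IsNormal A φ) (hm : ∀ a b, φ (a * b) = φ a * φ b)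
    {T T' : K ⊗ₕ H →L[ℂ] K ⊗ₕ H} {R R' : K ⊗ₕ H' →L[ℂ] K ⊗ₕ H'}
    (h : IsAmpliation A φ T R) (h' : IsAmpliation A φ T' R') :
    IsAmpliation A φ (T ∘L T') (R ∘L R') := by
  intro x y
  have hmem := (mem_opTensor_iff_slices A).1 (comp_mem_opTensor A h.mem_opTensor h'.mem_opTensor) x y
  refine ⟨hmem, ContinuousLinearMap.ext fun ζ' => ext_inner_left ℂ fun ζ => ?_⟩
  obtain ⟨w, b, -⟩ := exists_hilbertBasis ℂ K
  let t (i : w) : A.toStarSubalgebra := ⟨_, (h x (b i)).1⟩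
  let t' (i : w) : A.toStarSubalgebra := ⟨_, (h' (b i) y).1⟩
  -- This is the slice of `T P_F T'` for a finite basis projection `P_F`. It converges ultraweakly
  -- to the slice of `T T'`, while multiplicativity makes its image the slice of `R P_F R'`;
  -- normality compares the two limits.
  let a (F : Finset w) : A.toStarSubalgebra := ∑ i ∈ F, t i * t' i
  have ha : ∀ F, (a F : H →L[ℂ] H) = braE x ∘L T ∘L basisProj b F ∘L T' ∘L ketE y := by
    intro F
    change A.toStarSubalgebra.subtype _ = _
    simp only [map_sum, map_mul]
    refine ContinuousLinearMap.ext fun z => ?_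
    simp only [basisProj, sum_apply, ContinuousLinearMap.comp_apply, map_sum]
    rfl
  have h1 : Tendsto (fun F => (a F : H →L[ℂ] H)) atTop
      (@nhds _ (ultraweak H H) (braE x ∘L (T ∘L T') ∘L ketE y)) := by
    refine tendsto_ultraweak_of_bounded (‖x‖ * (‖T‖ * (1 * (‖T'‖ * ‖y‖))))
      (Eventually.of_forall fun F => ?_) fun ξ η => ?_
    · rw [ha]
      refine (ContinuousLinearMap.opNorm_comp_le _ _).trans ?_
      gcongr
      · exact norm_braE_le x
      refine (ContinuousLinearMap.opNorm_comp_le _ _).trans ?_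
      gcongr
      refine (ContinuousLinearMap.opNorm_comp_le _ _).trans ?_
      gcongr
      · exact norm_basisProj_le b.orthonormal F
      refine (ContinuousLinearMap.opNorm_comp_le _ _).trans ?_
      gcongr
      exact norm_ketE_le y
    · simp only [ha]
      have h2 := (tendsto_basisProj b (T' (ketE y η)))
      exact ((continuous_const.inner (braE x ∘L T).continuous).tendsto _).comp h2
  have h2 := hφ.tendsto (b := ⟨_, hmem⟩) h1 ζ ζ'
  refine tendsto_nhds_unique ?_ h2
  have h3 : ∀ F, φ (a F) = braE x ∘L R ∘L basisProj b F ∘L R' ∘L ketE y := by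
    intro F
    simp only [a, map_sum, hm]
    refine ContinuousLinearMap.ext fun z => ?_
    simp only [basisProj, sum_apply, ContinuousLinearMap.comp_apply, map_sum]
    refine Finset.sum_congr rfl fun i _ => ?_
    have e1 := (h x (b i)).2
    have e2 := (h' (b i) y).2
    change (φ (t i)) (φ (t' i) z) = _
    rw [← e1, ← e2]
    rfl
  simp only [h3]
  have h2 := (tendsto_basisProj b (R' (ketE y ζ')))
  exact ((continuous_const.inner (braE x ∘L R).continuous).tendsto _).comp h2

/-- Ampliations of `*`-preserving maps are `*`-preserving. -/
theorem IsAmpliation.adjoint (hs : ∀ a, φ (star a) = star (φ a))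
    {T : K ⊗ₕ H →L[ℂ] K ⊗ₕ H} {R : K ⊗ₕ H' →L[ℂ] K ⊗ₕ H'}
    (h : IsAmpliation A φ T R) : IsAmpliation A φ T.adjoint R.adjoint := by
  intro x y
  refine ⟨(mem_opTensor_iff_slices A).1 (adjoint_mem_opTensor A h.mem_opTensor) x y, ?_⟩
  obtain ⟨h1, h2⟩ := h y x
  have h3 := hs ⟨_, h1⟩
  rw [← h2] at h3
  have e1 : star (braE y ∘L R ∘L ketE x) = braE x ∘L R.adjoint ∘L ketE y := by
    rw [ContinuousLinearMap.star_eq_adjoint, ContinuousLinearMap.adjoint_comp,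
      ContinuousLinearMap.adjoint_comp, adjoint_braE]
    rfl
  have e2 : star (⟨_, h1⟩ : A.toStarSubalgebra) = ⟨_, (mem_opTensor_iff_slices A).1
      (adjoint_mem_opTensor A h.mem_opTensor) x y⟩ := by
    refine Subtype.ext ?_
    change star (braE y ∘L T ∘L ketE x) = _
    rw [ContinuousLinearMap.star_eq_adjoint, ContinuousLinearMap.adjoint_comp,
      ContinuousLinearMap.adjoint_comp, adjoint_braE]
    rfl
  rw [← e1, ← h3, e2]

/-- A linear multiplicative `*`-preserving map on a von Neumann algebra is contractive. -/
theorem norm_apply_le_of_starHom (hm : ∀ a b, φ (a * b) = φ a * φ b)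
    (hs : ∀ a, φ (star a) = star (φ a)) (a : A.toStarSubalgebra) :
    ‖φ a‖ ≤ ‖(a : H →L[ℂ] H)‖ := by
  -- Norm closedness makes the algebra a C*-algebra, so that automatic contractivity of
  -- `*`-homomorphisms applies.
  have hc : IsClosed (A.toStarSubalgebra : Set (H →L[ℂ] H)) := by
    have : (A.toStarSubalgebra : Set (H →L[ℂ] H)) =
      ⋂ a' ∈ A.commutant, {a : H →L[ℂ] H | a ∘L a' = a' ∘L a} := by
      ext a
      simp only [mem_iInter]
      exact mem_iff_commute A
    rw [this]
    exact isClosed_biInter fun a' _ => isClosed_eq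
      ((ContinuousLinearMap.compL ℂ H H H).flip a').continuous
      ((ContinuousLinearMap.compL ℂ H H H) a').continuous
  let ψ : A.toStarSubalgebra →⋆ₙₐ[ℂ] (H' →L[ℂ] H') :=
    { φ with
      map_zero' := map_zero φ
      map_mul' := hm
      map_star' := hs }
  exact NonUnitalStarAlgHom.norm_apply_le ψ a

end AmpliationAlgebra

/-! ### Maps that are ampliated by a vacuum projection -/

theorem adjoint_isometryEquiv {X Y : Type*} [NormedAddCommGroup X] [InnerProductSpace ℂ X]
    [CompleteSpace X] [NormedAddCommGroup Y] [InnerProductSpace ℂ Y] [CompleteSpace Y]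
    (U : X ≃ₗᵢ[ℂ] Y) : U.toContinuousLinearEquiv.toContinuousLinearMap.adjoint =
      U.symm.toContinuousLinearEquiv.toContinuousLinearMap :=
  U.adjoint_eq_symm

theorem conjBy_apply {X Y : Type*} [NormedAddCommGroup X] [InnerProductSpace ℂ X]
    [NormedAddCommGroup Y] [InnerProductSpace ℂ Y] (U : X ≃ₗᵢ[ℂ] Y) (T : X →L[ℂ] X) (y : Y) :
    conjBy U T y = U (T (U.symm y)) := rfl

section Compression
variable {H P X : Type*}
  [NormedAddCommGroup H] [InnerProductSpace ℂ H] [CompleteSpace H]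
  [NormedAddCommGroup P] [InnerProductSpace ℂ P] [CompleteSpace P]
  [NormedAddCommGroup X] [InnerProductSpace ℂ X] [CompleteSpace X]
  {A : VonNeumannAlgebra H} (W : P →ₗᵢ[ℂ] X) (ψ : A.toStarSubalgebra →ₗ[ℂ] (X →L[ℂ] X))

theorem adjoint_isometry_apply (w : P) : W.toContinuousLinearMap.adjoint (W w) = w :=
  ext_inner_left ℂ fun v => by
    rw [ContinuousLinearMap.adjoint_inner_right]
    exact W.inner_map_map v w

/-- The compression `a ↦ W* ψ(a) W`. -/
def compression : A.toStarSubalgebra →ₗ[ℂ] (P →L[ℂ] P) where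
  toFun a := W.toContinuousLinearMap.adjoint ∘L ψ a ∘L W.toContinuousLinearMap
  map_add' a b := by
    simp only [map_add, ContinuousLinearMap.add_comp, ContinuousLinearMap.comp_add]
  map_smul' c a := by
    simp only [map_smul, ContinuousLinearMap.smul_comp,
      ContinuousLinearMap.comp_smul, RingHom.id_apply]

theorem compression_apply (a : A.toStarSubalgebra) : compression W ψ a =
    W.toContinuousLinearMap.adjoint ∘L ψ a ∘L W.toContinuousLinearMap := rfl

theorem inner_compression (a : A.toStarSubalgebra) (u v : P) :
    ⟪u, compression W ψ a v⟫_ℂ = ⟪W u, ψ a (W v)⟫_ℂ := by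
  rw [compression_apply, ContinuousLinearMap.comp_apply, ContinuousLinearMap.adjoint_inner_right]
  rfl

variable {ψ}

/-- The ultraweak functional given by `ξ` and `η` pulls back to the one given by `W ξ` and `W η`,
and `W` preserves square summability. -/
theorem IsNormal.compression (h : IsNormal A ψ) : IsNormal A (compression W ψ) := by
  let := TopologicalSpace.induced (Subtype.val : A.toStarSubalgebra → _) (ultraweak H H)
  let := ultraweak P P
  refine continuous_iff_continuousAt.2 fun a => tendsto_ultraweak_iff.2 fun ξ η h1 h2 => ?_
  have h3 := @Continuous.tendsto _ _ _ (ultraweak X X) _ h a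
  have h4 := tendsto_ultraweak_iff.1 h3 (fun n => W (ξ n))
    (fun n => W (η n)) (by simpa only [W.norm_map] using h1)
    (by simpa only [W.norm_map] using h2)
  simpa only [inner_compression] using h4

/-- The block operator of the compression is the original block operator between the contractions `I
⊗ W*` and `I ⊗ W`, so the same constant serves. -/
theorem IsCompletelyBounded.compression (h : IsCompletelyBounded A ψ) :
    IsCompletelyBounded A (compression W ψ) := by
  obtain ⟨C, hC⟩ := h
  refine ⟨C, fun n a => le_trans ?_ (hC n a)⟩
  set V := W.toContinuousLinearMap
  have hV1 : ‖V‖ ≤ 1 := W.norm_toContinuousLinearMap_le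
  have hV2 : ‖V.adjoint‖ ≤ 1 := by rwa [LinearIsometryEquiv.norm_map]
  have h : (blockOp fun i k => QSC.compression W ψ (a i k)) =
      hmap (1 : EuclideanSpace ℂ (Fin n) →L[ℂ] _) V.adjoint ∘L
        (blockOp fun i k => ψ (a i k)) ∘L hmap (1 : EuclideanSpace ℂ (Fin n) →L[ℂ] _) V := by
    refine ContinuousLinearMap.ext fun z => ?_
    simp only [blockOp, sum_apply, ContinuousLinearMap.comp_apply, map_sum, compression_apply]
    refine Finset.sum_congr rfl fun i _ => Finset.sum_congr rfl fun k _ => ?_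
    have e1 := congrArg (fun T : _ →L[ℂ] _ => T z)
      (braE_comp_hmap_one V (EuclideanSpace.single k (1 : ℂ)))
    have e2 : ∀ w, hmap (1 : EuclideanSpace ℂ (Fin n) →L[ℂ] _) V.adjoint
        (ketE (EuclideanSpace.single i (1 : ℂ)) w) =
        ketE (EuclideanSpace.single i (1 : ℂ)) (V.adjoint w) := fun w => hmap_htmul _ _ _ _
    rw [e2]
    simp only [ContinuousLinearMap.comp_apply] at e1
    rw [e1]
  have n1 : ‖(1 : EuclideanSpace ℂ (Fin n) →L[ℂ] EuclideanSpace ℂ (Fin n))‖ ≤ 1 :=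
    ContinuousLinearMap.norm_id_le
  rw [h]
  refine (ContinuousLinearMap.opNorm_comp_le _ _).trans ?_
  refine (mul_le_mul ((norm_hmap_le _ _).trans (mul_le_one₀ n1 (norm_nonneg _) hV2))
    (ContinuousLinearMap.opNorm_comp_le _ _) (norm_nonneg _) zero_le_one).trans ?_
  rw [one_mul]
  exact mul_le_of_le_one_right (norm_nonneg _)
    ((norm_hmap_le _ _).trans (mul_le_one₀ n1 (norm_nonneg _) hV1))

variable (had : ∀ a, ψ a = W.toContinuousLinearMap ∘L compression W ψ a ∘L
  W.toContinuousLinearMap.adjoint)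
include had

/-- By `had`, the map `ψ` lives on the range of `W`. Since `W* W = 1`, algebraic identities for the
compression lift to `ψ`, even though `ψ` need not be unital. -/
theorem apply_mul_of_compression
    (hm : ∀ a b, compression W ψ (a * b) = compression W ψ a * compression W ψ b)
    (a b : A.toStarSubalgebra) : ψ (a * b) = ψ a * ψ b := by
  rw [had (a * b), hm, had a, had b]
  refine ContinuousLinearMap.ext fun z => ?_
  simp only [ContinuousLinearMap.mul_def, ContinuousLinearMap.comp_apply,
    LinearIsometry.coe_toContinuousLinearMap, adjoint_isometry_apply]

theorem apply_star_of_compression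
    (hs : ∀ a, compression W ψ (star a) = star (compression W ψ a))
    (a : A.toStarSubalgebra) : ψ (star a) = star (ψ a) := by
  rw [had (star a), hs, had a, ContinuousLinearMap.star_eq_adjoint,
    ContinuousLinearMap.star_eq_adjoint, ContinuousLinearMap.adjoint_comp,
    ContinuousLinearMap.adjoint_comp, ContinuousLinearMap.adjoint_adjoint]
  rfl

theorem range_proj_comp (a : A.toStarSubalgebra) :
    (W.toContinuousLinearMap ∘L W.toContinuousLinearMap.adjoint) ∘L ψ a = ψ a := by
  rw [had a]
  refine ContinuousLinearMap.ext fun z => ?_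
  simp only [ContinuousLinearMap.comp_apply, LinearIsometry.coe_toContinuousLinearMap,
    adjoint_isometry_apply]

theorem comp_range_proj (a : A.toStarSubalgebra) :
    ψ a ∘L (W.toContinuousLinearMap ∘L W.toContinuousLinearMap.adjoint) = ψ a := by
  rw [had a]
  refine ContinuousLinearMap.ext fun z => ?_
  simp only [ContinuousLinearMap.comp_apply, LinearIsometry.coe_toContinuousLinearMap,
    adjoint_isometry_apply]

end Compression

/-! ### Embedding by a unit vector. -/

section VacuumKet
variable {K P X : Type*}
  [NormedAddCommGroup K] [InnerProductSpace ℂ K]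
  [NormedAddCommGroup P] [InnerProductSpace ℂ P]
  [NormedAddCommGroup X] [InnerProductSpace ℂ X]

/-- The isometry `w ↦ U (Ω ⊗ w)`, for a unit vector `Ω`. -/
def unitKet (U : K ⊗ₕ P ≃ₗᵢ[ℂ] X) (Ω : K) (h : ‖Ω‖ = 1) : P →ₗᵢ[ℂ] X where
  toLinearMap := U.toLinearIsometry.toLinearMap ∘ₗ (ketE Ω).toLinearMap
  norm_map' w := by
    change ‖U (htmul Ω w)‖ = _
    rw [LinearIsometryEquiv.norm_map, norm_htmul, h, one_mul]

variable [CompleteSpace P] [CompleteSpace X] (U : K ⊗ₕ P ≃ₗᵢ[ℂ] X) (Ω : K) (h : ‖Ω‖ = 1)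

theorem adjoint_unitKet : (unitKet U Ω h).toContinuousLinearMap.adjoint =
    braE Ω ∘L U.symm.toContinuousLinearEquiv.toContinuousLinearMap := by
  rw [← adjoint_isometryEquiv, braE, ← ContinuousLinearMap.adjoint_comp]
  rfl

theorem conjBy_hmap_rankOne (T : P →L[ℂ] P) :
    conjBy U (hmap (InnerProductSpace.rankOne ℂ Ω Ω) T) =
      (unitKet U Ω h).toContinuousLinearMap ∘L T ∘L
        (unitKet U Ω h).toContinuousLinearMap.adjoint := by
  rw [hmap_rankOne, adjoint_unitKet]
  rfl

end VacuumKet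

/-! ### Shifting and ampliating: the maps `φ ⊗̄ id` on shifted operators -/

section LiftedShift
variable {F H K P X : Type*}
  [NormedAddCommGroup F] [InnerProductSpace ℂ F] [CompleteSpace F]
  [NormedAddCommGroup H] [InnerProductSpace ℂ H] [CompleteSpace H]
  [NormedAddCommGroup K] [InnerProductSpace ℂ K] [CompleteSpace K]
  [NormedAddCommGroup P] [InnerProductSpace ℂ P] [CompleteSpace P]
  [NormedAddCommGroup X] [InnerProductSpace ℂ X] [CompleteSpace X]
  {A : VonNeumannAlgebra H}

/-- `T ↦ (S ⊗ I) T (S ⊗ I)*`. -/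
def shiftConj (S : F ≃ₗᵢ[ℂ] K) (T : F ⊗ₕ H →L[ℂ] F ⊗ₕ H) : K ⊗ₕ H →L[ℂ] K ⊗ₕ H :=
  hmap S.toContinuousLinearEquiv.toContinuousLinearMap (1 : H →L[ℂ] H) ∘L T ∘L
    hmap S.symm.toContinuousLinearEquiv.toContinuousLinearMap (1 : H →L[ℂ] H)

/-- Conjugation by `S ⊗ I` only relabels slices; membership and matrix elements after the shift
follow from this. -/
theorem slice_shiftConj (S : F ≃ₗᵢ[ℂ] K) (T : F ⊗ₕ H →L[ℂ] F ⊗ₕ H) (x y : F) :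
    braE (S x) ∘L shiftConj S T ∘L ketE (S y) = braE x ∘L T ∘L ketE y := by
  have e1 : hmap S.symm.toContinuousLinearEquiv.toContinuousLinearMap (1 : H →L[ℂ] H) ∘L
      ketE (S y) = ketE y := by
    rw [hmap_comp_ketE]
    change ketE (S.symm (S y)) ∘L _ = _
    rw [S.symm_apply_apply]
    rfl
  have e2 : braE (S x) ∘L hmap S.toContinuousLinearEquiv.toContinuousLinearMap (1 : H →L[ℂ] H) =
      braE x := by
    rw [braE_comp_hmap, adjoint_isometryEquiv]
    change _ ∘L braE (S.symm (S x)) = _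
    rw [S.symm_apply_apply]
    rfl
  calc braE (S x) ∘L shiftConj S T ∘L ketE (S y) = (braE (S x) ∘L
        hmap S.toContinuousLinearEquiv.toContinuousLinearMap (1 : H →L[ℂ] H)) ∘L T ∘L
        (hmap S.symm.toContinuousLinearEquiv.toContinuousLinearMap (1 : H →L[ℂ] H) ∘L
          ketE (S y)) := rfl
    _ = _ := by rw [e1, e2]

theorem shiftConj_mem (S : F ≃ₗᵢ[ℂ] K) {T : F ⊗ₕ H →L[ℂ] F ⊗ₕ H}
    (hT : T ∈ opTensor F (A : Set (H →L[ℂ] H))) :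
    shiftConj S T ∈ opTensor K (A : Set (H →L[ℂ] H)) := by
  rw [mem_opTensor_iff_slices] at *
  intro x y
  obtain ⟨x, rfl⟩ := S.surjective x
  obtain ⟨y, rfl⟩ := S.surjective y
  rw [slice_shiftConj]
  exact hT x y

theorem shiftConj_comp (S : F ≃ₗᵢ[ℂ] K) (T T' : F ⊗ₕ H →L[ℂ] F ⊗ₕ H) :
    shiftConj S (T ∘L T') = shiftConj S T ∘L shiftConj S T' := by
  have e : hmap S.symm.toContinuousLinearEquiv.toContinuousLinearMap (1 : H →L[ℂ] H) ∘L
      hmap S.toContinuousLinearEquiv.toContinuousLinearMap (1 : H →L[ℂ] H) = 1 := by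
    rw [hmap_comp]
    refine ext_htmul fun x u => ?_
    rw [hmap_htmul]
    simp
  refine ContinuousLinearMap.ext fun z => ?_
  have e2 := congrArg (fun R : _ →L[ℂ] _ => R (T'
    (hmap S.symm.toContinuousLinearEquiv.toContinuousLinearMap (1 : H →L[ℂ] H) z))) e
  simp only [ContinuousLinearMap.comp_apply, one_apply_eq_self] at e2
  simp only [shiftConj, ContinuousLinearMap.comp_apply, e2]

theorem adjoint_shiftConj (S : F ≃ₗᵢ[ℂ] K) (T : F ⊗ₕ H →L[ℂ] F ⊗ₕ H) :
    (shiftConj S T).adjoint = shiftConj S T.adjoint := by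
  have h1 : (1 : H →L[ℂ] H).adjoint = 1 := star_one (H →L[ℂ] H)
  rw [shiftConj, ContinuousLinearMap.adjoint_comp, ContinuousLinearMap.adjoint_comp, adjoint_hmap,
    adjoint_hmap, adjoint_isometryEquiv, adjoint_isometryEquiv, h1]
  rfl

theorem norm_shiftConj_le (S : F ≃ₗᵢ[ℂ] K) (T : F ⊗ₕ H →L[ℂ] F ⊗ₕ H) :
    ‖shiftConj S T‖ ≤ ‖T‖ := by
  have n1 : ‖(1 : H →L[ℂ] H)‖ ≤ 1 := ContinuousLinearMap.norm_id_le
  have n2 : ‖hmap S.toContinuousLinearEquiv.toContinuousLinearMap (1 : H →L[ℂ] H)‖ ≤ 1 :=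
    (norm_hmap_le _ _).trans (mul_le_one₀ (S.toLinearIsometry.norm_toContinuousLinearMap_le)
      (norm_nonneg _) n1)
  have n3 : ‖hmap S.symm.toContinuousLinearEquiv.toContinuousLinearMap (1 : H →L[ℂ] H)‖ ≤ 1 :=
    (norm_hmap_le _ _).trans (mul_le_one₀ (S.symm.toLinearIsometry.norm_toContinuousLinearMap_le)
      (norm_nonneg _) n1)
  calc ‖shiftConj S T‖ ≤ _ * (‖T‖ * _) := (ContinuousLinearMap.opNorm_comp_le _ _).trans
        (mul_le_mul_of_nonneg_left (ContinuousLinearMap.opNorm_comp_le _ _) (norm_nonneg _))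
    _ ≤ 1 * (‖T‖ * 1) := by gcongr
    _ = ‖T‖ := by ring

/-- The map `T ↦ U (φ ⊗̄ id)((S ⊗ I) T (S ⊗ I)*) U*`. -/
def liftedShift (U : K ⊗ₕ P ≃ₗᵢ[ℂ] X) (S : F ≃ₗᵢ[ℂ] K)
    (φ : A.toStarSubalgebra →ₗ[ℂ] (P →L[ℂ] P)) (T : F ⊗ₕ H →L[ℂ] F ⊗ₕ H) : X →L[ℂ] X :=
  conjBy U (ampliate A φ (shiftConj S T))

variable (U : K ⊗ₕ P ≃ₗᵢ[ℂ] X) (S : F ≃ₗᵢ[ℂ] K) {φ : A.toStarSubalgebra →ₗ[ℂ] (P →L[ℂ] P)}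
  (hcb : IsCompletelyBounded A φ)
include hcb

theorem isAmpliation_shiftConj {T : F ⊗ₕ H →L[ℂ] F ⊗ₕ H}
    (hT : T ∈ opTensor F (A : Set (H →L[ℂ] H))) :
    IsAmpliation A φ (shiftConj S T) (ampliate A φ (shiftConj S T)) :=
  hcb.isAmpliation_ampliate (shiftConj_mem S hT)

/-- Between vectors of the form `U (S x ⊗ u)` the lifted shift is `φ` applied to one slice. These
vectors are total, so this formula determines the operator. -/
theorem inner_liftedShift {T : F ⊗ₕ H →L[ℂ] F ⊗ₕ H}
    (hT : T ∈ opTensor F (A : Set (H →L[ℂ] H))) (x y : F) (u v : P) :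
    ⟪U (htmul (S x) u), liftedShift U S φ T (U (htmul (S y) v))⟫_ℂ =
      ⟪u, φ ⟨braE x ∘L T ∘L ketE y, (mem_opTensor_iff_slices A).1 hT x y⟩ v⟫_ℂ := by
  obtain ⟨h1, h2⟩ := isAmpliation_shiftConj S hcb hT (S x) (S y)
  rw [liftedShift, conjBy_apply, U.symm_apply_apply, U.inner_map_map, ← inner_braE]
  change ⟪u, (braE (S x) ∘L ampliate A φ (shiftConj S T) ∘L ketE (S y)) v⟫_ℂ = _
  rw [h2]
  simp only [slice_shiftConj]

/-- The ampliated operator is obtained by choice, so additivity is not built in; it follows because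
the difference of the two ampliations is an ampliation of the difference, and ampliations are
unique. -/
theorem liftedShift_sub {T T' : F ⊗ₕ H →L[ℂ] F ⊗ₕ H}
    (hT : T ∈ opTensor F (A : Set (H →L[ℂ] H))) (hT' : T' ∈ opTensor F (A : Set (H →L[ℂ] H))) :
    liftedShift U S φ (T - T') = liftedShift U S φ T - liftedShift U S φ T' := by
  have h : IsAmpliation A φ (shiftConj S (T - T'))
      (ampliate A φ (shiftConj S T) - ampliate A φ (shiftConj S T')) := by
    intro x y
    have h0 := isAmpliation_shiftConj S hcb (sub_mem_opTensor A hT hT') x y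
    refine ⟨h0.1, ?_⟩
    obtain ⟨h1, h2⟩ := isAmpliation_shiftConj S hcb hT x y
    obtain ⟨h3, h4⟩ := isAmpliation_shiftConj S hcb hT' x y
    rw [ContinuousLinearMap.sub_comp, ContinuousLinearMap.comp_sub, h2, h4, ← map_sub]
    congr 1
    refine Subtype.ext ?_
    change braE x ∘L _ ∘L ketE y - braE x ∘L _ ∘L ketE y = _
    simp only [shiftConj, ContinuousLinearMap.sub_comp, ContinuousLinearMap.comp_sub]
  rw [liftedShift, h.ampliate_eq]
  refine ContinuousLinearMap.ext fun z => ?_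
  simp only [liftedShift, conjBy_apply, sub_apply, map_sub]

theorem exists_norm_liftedShift_le : ∃ C : ℝ, 0 ≤ C ∧ ∀ T : F ⊗ₕ H →L[ℂ] F ⊗ₕ H,
    T ∈ opTensor F (A : Set (H →L[ℂ] H)) → ‖liftedShift U S φ T‖ ≤ C * ‖T‖ := by
  obtain ⟨C, hC0, hC⟩ := exists_isAmpliation A K hcb
  refine ⟨C, hC0, fun T hT => ?_⟩
  obtain ⟨R, hR1, hR2⟩ := hC _ (shiftConj_mem S hT)
  rw [liftedShift, hR1.ampliate_eq]
  refine ContinuousLinearMap.opNorm_le_bound _ (by positivity) fun x => ?_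
  rw [conjBy_apply, U.norm_map]
  refine (ContinuousLinearMap.le_of_opNorm_le _ (hR2.trans
    (mul_le_mul_of_nonneg_left (norm_shiftConj_le S T) hC0)) _).trans_eq ?_
  rw [U.symm.norm_map]

omit hcb in
theorem liftedShift_one (h1 : φ 1 = 1) : liftedShift U S φ (1 : F ⊗ₕ H →L[ℂ] F ⊗ₕ H) = 1 := by
  have e : shiftConj S (1 : F ⊗ₕ H →L[ℂ] F ⊗ₕ H) = 1 := by
    refine ext_htmul fun x u => ?_
    simp [shiftConj, hmap_htmul]
  have h : IsAmpliation A φ (1 : K ⊗ₕ H →L[ℂ] K ⊗ₕ H) 1 := by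
    have := isAmpliation_hmap A φ (1 : K →L[ℂ] K) 1
    rw [h1] at this
    rwa [hmap_one_one, show ((1 : A.toStarSubalgebra) : H →L[ℂ] H) = 1 from rfl,
      hmap_one_one] at this
  rw [liftedShift, e, h.ampliate_eq]
  refine ContinuousLinearMap.ext fun z => ?_
  rw [conjBy_apply, one_apply_eq_self, one_apply_eq_self, U.apply_symm_apply]

variable (hn : IsNormal A φ) (hm : ∀ a b, φ (a * b) = φ a * φ b)
include hn hm

theorem liftedShift_comp {T T' : F ⊗ₕ H →L[ℂ] F ⊗ₕ H}
    (hT : T ∈ opTensor F (A : Set (H →L[ℂ] H))) (hT' : T' ∈ opTensor F (A : Set (H →L[ℂ] H))) :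
    liftedShift U S φ (T ∘L T') = liftedShift U S φ T ∘L liftedShift U S φ T' := by
  have h := (isAmpliation_shiftConj S hcb hT).comp hn hm (isAmpliation_shiftConj S hcb hT')
  rw [← shiftConj_comp] at h
  rw [liftedShift, h.ampliate_eq]
  refine ContinuousLinearMap.ext fun z => ?_
  simp only [liftedShift, conjBy_apply, ContinuousLinearMap.comp_apply, U.symm_apply_apply]

variable (hs : ∀ a, φ (star a) = star (φ a))
include hs

omit hn hm in
theorem liftedShift_adjoint {T : F ⊗ₕ H →L[ℂ] F ⊗ₕ H}
    (hT : T ∈ opTensor F (A : Set (H →L[ℂ] H))) :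
    liftedShift U S φ T.adjoint = (liftedShift U S φ T).adjoint := by
  have h := (isAmpliation_shiftConj S hcb hT).adjoint hs
  rw [adjoint_shiftConj] at h
  rw [liftedShift, h.ampliate_eq]
  refine ContinuousLinearMap.ext fun z => ext_inner_left ℂ fun w => ?_
  rw [ContinuousLinearMap.adjoint_inner_right, liftedShift, conjBy_apply, conjBy_apply]
  rw [← U.symm.inner_map_map, U.symm_apply_apply, ContinuousLinearMap.adjoint_inner_right,
    ← U.inner_map_map, U.apply_symm_apply]

omit hcb hn hm hs in
theorem total_shifted_htmul :
    (Submodule.span ℂ (range fun p : F × P => U (htmul (S p.1) p.2))).topologicalClosure = ⊤ := by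
  have h1 : range (fun p : F × P => U (htmul (S p.1) p.2)) =
      U.toLinearEquiv.toLinearMap '' range (fun p : K × P => htmul p.1 p.2) := by
    rw [← range_comp]
    ext z
    constructor
    · rintro ⟨⟨x, u⟩, rfl⟩
      exact ⟨⟨S x, u⟩, rfl⟩
    · rintro ⟨⟨x, u⟩, rfl⟩
      obtain ⟨x, rfl⟩ := S.surjective x
      exact ⟨⟨x, u⟩, rfl⟩
  rw [h1, ← Submodule.map_span]
  refine Submodule.dense_iff_topologicalClosure_eq_top.1 ?_
  rw [Submodule.map_coe]
  exact U.surjective.denseRange.dense_image U.continuous dense_htmul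

/-- The lifted shift preserves strong convergence of bounded nets. -/
theorem tendsto_liftedShift {ι : Type*} {l : Filter ι} {T : ι → (F ⊗ₕ H →L[ℂ] F ⊗ₕ H)}
    {T₀ : F ⊗ₕ H →L[ℂ] F ⊗ₕ H} (hT : ∀ i, T i ∈ opTensor F (A : Set (H →L[ℂ] H)))
    (hT₀ : T₀ ∈ opTensor F (A : Set (H →L[ℂ] H))) {B : ℝ} (hB : ∀ᶠ i in l, ‖T i‖ ≤ B)
    (h : ∀ ξ, Tendsto (fun i => T i ξ) l (𝓝 (T₀ ξ))) (ξ : X) :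
    Tendsto (fun i => liftedShift U S φ (T i) ξ) l (𝓝 (liftedShift U S φ T₀ ξ)) := by
  obtain ⟨C, hC0, hC⟩ := exists_norm_liftedShift_le U S hcb
  refine tendsto_apply_of_total (total_shifted_htmul U S) (C * B) ?_ ?_ ξ
  · filter_upwards [hB] with i hi
    exact (hC _ (hT i)).trans (mul_le_mul_of_nonneg_left hi hC0)
  rintro ⟨y, v⟩
  have hD : ∀ i, T i - T₀ ∈ opTensor F (A : Set (H →L[ℂ] H)) := fun i =>
    sub_mem_opTensor A (hT i) hT₀
  have hE : ∀ i, (T i - T₀).adjoint ∘L (T i - T₀) ∈ opTensor F (A : Set (H →L[ℂ] H)) := fun i =>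
    comp_mem_opTensor A (adjoint_mem_opTensor A (hD i)) (hD i)
  -- Because the lifted shift is a `*`-homomorphism, the squared norm of the error on a test vector
  -- is `φ` of a slice of `D* D` with `D = T i - T₀`. Strong convergence sends that slice to `0`
  -- ultraweakly, and normality finishes.
  have hnorm : ∀ i, ⟪v, φ ⟨_, (mem_opTensor_iff_slices A).1 (hE i) y y⟩ v⟫_ℂ =
      ((‖liftedShift U S φ (T i) (U (htmul (S y) v)) -
        liftedShift U S φ T₀ (U (htmul (S y) v))‖ ^ 2 : ℝ) : ℂ) := by
    intro i
    rw [← inner_liftedShift U S hcb (hE i), liftedShift_comp U S hcb hn hm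
      (adjoint_mem_opTensor A (hD i)) (hD i), liftedShift_adjoint U S hcb hs (hD i),
      ContinuousLinearMap.comp_apply, ContinuousLinearMap.adjoint_inner_right,
      inner_self_eq_norm_sq_to_K, liftedShift_sub U S hcb (hT i) hT₀, sub_apply]
    norm_cast
  have hlim := hn.tendsto (l := l) (a := fun i => ⟨_, (mem_opTensor_iff_slices A).1 (hE i) y y⟩)
    (b := 0) ?_ v v
  · simp only [hnorm, map_zero, zero_apply, inner_zero_right] at hlim
    have h2 := (Complex.continuous_re.tendsto _).comp hlim
    simp only [Function.comp_def, Complex.ofReal_re, Complex.zero_re] at h2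
    rw [tendsto_iff_norm_sub_tendsto_zero]
    simpa using h2.sqrt
  · have hbd : ∀ᶠ i in l, ‖T i - T₀‖ ≤ B + ‖T₀‖ := by
      filter_upwards [hB] with i hi
      exact (norm_sub_le _ _).trans (by gcongr)
    refine tendsto_ultraweak_of_bounded (‖y‖ * (((B + ‖T₀‖) * (B + ‖T₀‖)) * ‖y‖)) ?_ ?_
    · filter_upwards [hbd] with i hi
      refine (ContinuousLinearMap.opNorm_comp_le _ _).trans ?_
      gcongr
      · exact norm_braE_le y
      refine (ContinuousLinearMap.opNorm_comp_le _ _).trans ?_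
      gcongr
      · exact mul_nonneg ((norm_nonneg _).trans hi) ((norm_nonneg _).trans hi)
      · refine (ContinuousLinearMap.opNorm_comp_le _ _).trans ?_
        rw [LinearIsometryEquiv.norm_map]
        exact mul_le_mul hi hi (norm_nonneg _) ((norm_nonneg _).trans hi)
      · exact norm_ketE_le y
    · intro ξ η
      have hz : ∀ ξ, Tendsto (fun i => (T i - T₀) ξ) l (𝓝 0) := fun ξ => by
        simpa only [sub_apply, sub_self] using (h ξ).sub_const (T₀ ξ)
      have h3 := (hz (htmul y ξ)).inner (𝕜 := ℂ) (hz (htmul y η))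
      rw [inner_zero_left] at h3
      change Tendsto _ l (𝓝 ⟪ξ, (0 : H →L[ℂ] H) η⟫_ℂ)
      rw [zero_apply, inner_zero_right]
      refine h3.congr fun i => ?_
      change _ = ⟪ξ, braE y ((T i - T₀).adjoint ((T i - T₀) (htmul y η)))⟫_ℂ
      rw [inner_braE, ContinuousLinearMap.adjoint_inner_right]

end LiftedShift

/-! ### The column `j̃(c E^ω) E_ω` -/

section Column
variable {H K X Y : Type*}
  [NormedAddCommGroup H] [InnerProductSpace ℂ H] [CompleteSpace H]
  [NormedAddCommGroup K] [InnerProductSpace ℂ K] [CompleteSpace K]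
  [NormedAddCommGroup X] [InnerProductSpace ℂ X] [CompleteSpace X]
  [NormedAddCommGroup Y] [NormedSpace ℂ Y]
  {A : VonNeumannAlgebra H}

theorem ext_braE_comp {S T : Y →L[ℂ] K ⊗ₕ X} (h : ∀ x : K, braE x ∘L S = braE x ∘L T) : S = T :=
  ContinuousLinearMap.ext fun y => ext_inner_htmul fun x u => by
    rw [← inner_braE, ← inner_braE]
    exact congrArg (fun R : Y →L[ℂ] X => ⟪u, R y⟫_ℂ) (h x)

theorem slice_comp_braE (c : H →L[ℂ] K ⊗ₕ H) (ω x y : K) :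
    braE x ∘L (c ∘L braE ω) ∘L ketE y = ⟪ω, y⟫_ℂ • (braE x ∘L c) := by
  calc braE x ∘L (c ∘L braE ω) ∘L ketE y = (braE x ∘L c) ∘L (braE ω ∘L ketE y) := rfl
    _ = _ := by
      rw [braE_comp_ketE, ContinuousLinearMap.comp_smul]
      rfl

theorem comp_braE_mem_opTensor {c : H →L[ℂ] K ⊗ₕ H} (hc : ∀ x, braE x ∘L c ∈ A.toStarSubalgebra)
    (ω : K) : c ∘L braE ω ∈ opTensor K (A : Set (H →L[ℂ] H)) :=
  (mem_opTensor_iff_slices A).2 fun x y => by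
    rw [slice_comp_braE]
    exact SMulMemClass.smul_mem _ (hc x)

/-- The column `(id ⊗̄ ψ)(c E^ω) E_ω`. -/
def column (ψ : A.toStarSubalgebra →ₗ[ℂ] (X →L[ℂ] X)) (c : H →L[ℂ] K ⊗ₕ H) (ω : K) :
    X →L[ℂ] K ⊗ₕ X :=
  ampliate A ψ (c ∘L braE ω) ∘L ketE ω

variable {ψ : A.toStarSubalgebra →ₗ[ℂ] (X →L[ℂ] X)} {c : H →L[ℂ] K ⊗ₕ H}
  {ω : K} (hω : ‖ω‖ = 1) (hc : ∀ x, braE x ∘L c ∈ A.toStarSubalgebra)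

theorem inner_self_of_norm_one {ω : K} (hω : ‖ω‖ = 1) : ⟪ω, ω⟫_ℂ = 1 := by
  rw [inner_self_eq_norm_sq_to_K, hω]
  norm_num

include hω

/-- As `ω` is a unit vector, `c* c` is the `(ω, ω)` slice of the square modulus of `c E^ω`, which
belongs to `B(K) ⊗̄ A`. -/
theorem adjoint_comp_mem {c : H →L[ℂ] K ⊗ₕ H} (hc : ∀ x, braE x ∘L c ∈ A.toStarSubalgebra) :
    c.adjoint ∘L c ∈ A.toStarSubalgebra ∧
    braE ω ∘L ((c ∘L braE ω).adjoint ∘L (c ∘L braE ω)) ∘L ketE ω = c.adjoint ∘L c := by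
  have h : braE ω ∘L ((c ∘L braE ω).adjoint ∘L (c ∘L braE ω)) ∘L ketE ω = c.adjoint ∘L c := by
    rw [ContinuousLinearMap.adjoint_comp, adjoint_braE]
    calc _ = (braE ω ∘L ketE ω) ∘L (c.adjoint ∘L c) ∘L (braE ω ∘L ketE ω) := rfl
      _ = _ := by
        rw [braE_comp_ketE, inner_self_of_norm_one hω, one_smul]
        rfl
  refine ⟨?_, h⟩
  have hT := comp_braE_mem_opTensor hc ω
  have := (mem_opTensor_iff_slices A).1 (comp_mem_opTensor A (adjoint_mem_opTensor A hT) hT) ω ω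
  rwa [h] at this

variable (hcb : IsCompletelyBounded A ψ)
include hcb

theorem braE_comp_column (x : K) : braE x ∘L column ψ c ω = ψ ⟨braE x ∘L c, hc x⟩ := by
  obtain ⟨h1, h2⟩ := hcb.isAmpliation_ampliate (comp_braE_mem_opTensor hc ω) x ω
  rw [column, h2]
  congr 1
  refine Subtype.ext ?_
  change braE x ∘L (c ∘L braE ω) ∘L ketE ω = _
  rw [slice_comp_braE, inner_self_of_norm_one hω, one_smul]

include hc in
-- The slices of `c E^ω` are `⟪ω, y⟫ E^x c`, so only the column along `ω` survives. This is what
-- makes the integrand independent of the right-hand function `g`.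
theorem ampliate_eq_column : ampliate A ψ (c ∘L braE ω) = column ψ c ω ∘L braE ω := by
  refine ext_slices fun x y => ?_
  obtain ⟨h1, h2⟩ := hcb.isAmpliation_ampliate (comp_braE_mem_opTensor hc ω) x y
  rw [h2]
  calc ψ ⟨_, h1⟩ = ψ (⟪ω, y⟫_ℂ • ⟨braE x ∘L c, hc x⟩) := by
        congr 1
        exact Subtype.ext (slice_comp_braE c ω x y)
    _ = (braE x ∘L column ψ c ω) ∘L (⟪ω, y⟫_ℂ • (1 : X →L[ℂ] X)) := by
        rw [map_smul, braE_comp_column hω hc hcb, ContinuousLinearMap.comp_smul]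
        rfl
    _ = _ := by
        rw [← braE_comp_ketE]
        rfl

include hc in
theorem proj_comp_column {P : X →L[ℂ] X} (hP : ∀ a, P ∘L ψ a = ψ a) :
    hmap (1 : K →L[ℂ] K) P ∘L column ψ c ω = column ψ c ω := by
  refine ext_braE_comp fun x => ?_
  rw [← ContinuousLinearMap.comp_assoc, braE_comp_hmap_one, ContinuousLinearMap.comp_assoc,
    braE_comp_column hω hc hcb, hP]

include hc in
theorem column_comp_proj {P : X →L[ℂ] X} (hP : ∀ a, ψ a ∘L P = ψ a) :
    column ψ c ω ∘L P = column ψ c ω := by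
  refine ext_braE_comp fun x => ?_
  rw [← ContinuousLinearMap.comp_assoc, braE_comp_column hω hc hcb, hP]

include hc in
theorem column_comp_of_commute {b : X →L[ℂ] X} (hb : ∀ a, ψ a ∘L b = b ∘L ψ a) :
    column ψ c ω ∘L b = hmap (1 : K →L[ℂ] K) b ∘L column ψ c ω := by
  refine ext_braE_comp fun x => ?_
  calc braE x ∘L column ψ c ω ∘L b = (braE x ∘L column ψ c ω) ∘L b := rfl
    _ = b ∘L (braE x ∘L column ψ c ω) := by rw [braE_comp_column hω hc hcb, hb]
    _ = (braE x ∘L hmap (1 : K →L[ℂ] K) b) ∘L column ψ c ω := by rw [braE_comp_hmap_one]; rfl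
    _ = _ := rfl

variable (hn : IsNormal A ψ) (hm : ∀ a b, ψ (a * b) = ψ a * ψ b)
  (hs : ∀ a, ψ (star a) = star (ψ a))
include hn hm hs

/-- Ampliation is multiplicative and `*`-preserving, so the column behaves like `ψ` applied to `c`.
Both its norm bound and its strong continuity come from this identity. -/
theorem adjoint_column_comp : (column ψ c ω).adjoint ∘L column ψ c ω =
    ψ ⟨c.adjoint ∘L c, (adjoint_comp_mem hω hc).1⟩ := by
  have h := hcb.isAmpliation_ampliate (comp_braE_mem_opTensor hc ω)
  obtain ⟨h1, h2⟩ := ((h.adjoint hs).comp hn hm h) ω ω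
  calc _ = braE ω ∘L ((ampliate A ψ (c ∘L braE ω)).adjoint ∘L ampliate A ψ (c ∘L braE ω)) ∘L
        ketE ω := by
        rw [column, ContinuousLinearMap.adjoint_comp]
        rfl
    _ = _ := by
      rw [h2]
      congr 1
      exact Subtype.ext (adjoint_comp_mem hω hc).2

theorem norm_column_apply_sq (ξ : X) : ((‖column ψ c ω ξ‖ ^ 2 : ℝ) : ℂ) =
    ⟪ξ, ψ ⟨c.adjoint ∘L c, (adjoint_comp_mem hω hc).1⟩ ξ⟫_ℂ := by
  rw [← adjoint_column_comp hω hc hcb hn hm hs, ContinuousLinearMap.comp_apply,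
    ContinuousLinearMap.adjoint_inner_right, inner_self_eq_norm_sq_to_K]
  norm_cast

include hc in
theorem norm_column_le : ‖column ψ c ω‖ ≤ ‖c‖ := by
  refine ContinuousLinearMap.opNorm_le_bound _ (norm_nonneg _) fun ξ => ?_
  have h1 := norm_column_apply_sq hω hc hcb hn hm hs ξ
  have h2 := congrArg norm h1
  rw [Complex.norm_real, Real.norm_of_nonneg (by positivity)] at h2
  have h3 : ‖column ψ c ω ξ‖ ^ 2 ≤ (‖c‖ * ‖ξ‖) ^ 2 := by
    rw [h2]
    refine (norm_inner_le_norm _ _).trans ?_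
    have h4 := (ψ ⟨c.adjoint ∘L c, (adjoint_comp_mem hω hc).1⟩).le_of_opNorm_le
      (norm_apply_le_of_starHom hm hs _) ξ
    have h5 : ‖c.adjoint ∘L c‖ ≤ ‖c‖ * ‖c‖ :=
      (ContinuousLinearMap.opNorm_comp_le _ _).trans (by rw [LinearIsometryEquiv.norm_map])
    calc ‖ξ‖ * _ ≤ ‖ξ‖ * (‖c‖ * ‖c‖ * ‖ξ‖) := by
          refine mul_le_mul_of_nonneg_left (h4.trans ?_) (norm_nonneg _)
          exact mul_le_mul_of_nonneg_right h5 (norm_nonneg _)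
      _ = _ := by ring
  exact (pow_le_pow_iff_left₀ (norm_nonneg _) (by positivity) two_ne_zero).1 h3

end Column

/-! ### Strong continuity of the column. -/

section ColumnContinuity
variable {H K X ι : Type*}
  [NormedAddCommGroup H] [InnerProductSpace ℂ H] [CompleteSpace H]
  [NormedAddCommGroup K] [InnerProductSpace ℂ K] [CompleteSpace K]
  [NormedAddCommGroup X] [InnerProductSpace ℂ X] [CompleteSpace X]
  {A : VonNeumannAlgebra H}
  {ψ : ι → A.toStarSubalgebra →ₗ[ℂ] (X →L[ℂ] X)} {c : H →L[ℂ] K ⊗ₕ H} {ω : K}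

/-- Weak convergence of `ψ i` on the elements `E^x c` gives weak convergence of the columns; on `c*
c` it gives convergence of their norms. Together these give norm convergence. -/
theorem tendsto_column (hω : ‖ω‖ = 1) (hc : ∀ x, braE x ∘L c ∈ A.toStarSubalgebra)
    (hcb : ∀ i, IsCompletelyBounded A (ψ i)) (hn : ∀ i, IsNormal A (ψ i))
    (hm : ∀ i a b, ψ i (a * b) = ψ i a * ψ i b) (hs : ∀ i a, ψ i (star a) = star (ψ i a))
    {l : Filter ι} {i₀ : ι}
    (hl : ∀ a z w, Tendsto (fun i => ⟪z, ψ i a w⟫_ℂ) l (𝓝 ⟪z, ψ i₀ a w⟫_ℂ)) (ξ : X) :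
    Tendsto (fun i => column (ψ i) c ω ξ) l (𝓝 (column (ψ i₀) c ω ξ)) := by
  refine tendsto_of_weak_of_norm ?_ ?_
  · refine tendsto_inner_of_total (v := fun p : K × X => htmul p.1 p.2)
      (Submodule.dense_iff_topologicalClosure_eq_top.1 dense_htmul) (‖c‖ * ‖ξ‖)
      (Eventually.of_forall fun i => ContinuousLinearMap.le_of_opNorm_le _
        (norm_column_le hω hc (hcb i) (hn i) (hm i) (hs i)) ξ) ?_
    rintro ⟨x, u⟩
    have h : ∀ i, ⟪htmul x u, column (ψ i) c ω ξ⟫_ℂ = ⟪u, ψ i ⟨braE x ∘L c, hc x⟩ ξ⟫_ℂ := by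
      intro i
      rw [← inner_braE, ← braE_comp_column hω hc (hcb i)]
      rfl
    simp only [h]
    exact hl _ _ _
  · have h := (Complex.continuous_re.tendsto _).comp
      (hl ⟨c.adjoint ∘L c, (adjoint_comp_mem hω hc).1⟩ ξ ξ)
    simpa only [Function.comp_def, ← norm_column_apply_sq hω hc (hcb _) (hn _) (hm _) (hs _),
      Complex.ofReal_re] using h

end ColumnContinuity

/-! ### Integral lemmas -/

section IntegralLemmas

/-- Sums of increments of `f` over disjoint intervals are dominated by `C` times those of `g`. -/
theorem absolutelyContinuousOnInterval_of_dist_le {X : Type*} [PseudoMetricSpace X] {f : ℝ → X}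
    {g : ℝ → ℝ} {a b C : ℝ} (hg : AbsolutelyContinuousOnInterval g a b)
    (h : ∀ x ∈ uIcc a b, ∀ y ∈ uIcc a b, dist (f x) (f y) ≤ C * dist (g x) (g y)) :
    AbsolutelyContinuousOnInterval f a b := by
  have h0 := Tendsto.const_mul C hg
  rw [mul_zero] at h0
  refine squeeze_zero' (Eventually.of_forall fun E => Finset.sum_nonneg fun _ _ => dist_nonneg) ?_ h0
  have : ∀ᶠ E : ℕ × (ℕ → ℝ × ℝ) in AbsolutelyContinuousOnInterval.totalLengthFilter ⊓
      𝓟 (AbsolutelyContinuousOnInterval.disjWithin a b),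
      E ∈ AbsolutelyContinuousOnInterval.disjWithin a b := eventually_inf_principal.mpr (by simp)
  filter_upwards [this] with E hE
  rw [Finset.mul_sum]
  exact Finset.sum_le_sum fun i hi => h _ (hE.1 i hi).1 _ (hE.1 i hi).2

theorem dist_integral_le {φ : ℝ → ℂ} (hφ : ∀ a b, IntervalIntegrable φ volume a b) (c x y : ℝ) :
    dist (∫ r in c..x, φ r) (∫ r in c..y, φ r) ≤
      dist (∫ r in c..x, ‖φ r‖) (∫ r in c..y, ‖φ r‖) := by
  rw [dist_eq_norm, dist_eq_norm, intervalIntegral.integral_interval_sub_left (hφ _ _) (hφ _ _),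
    intervalIntegral.integral_interval_sub_left (hφ _ _).norm (hφ _ _).norm]
  exact intervalIntegral.norm_integral_le_abs_integral_norm

theorem continuous_integral_of_intervalIntegrable {E : Type*} [NormedAddCommGroup E]
    [NormedSpace ℝ E] {φ : ℝ → E}
    (hφ : ∀ a b, IntervalIntegrable φ volume a b) (c : ℝ) :
    Continuous fun s => ∫ r in c..s, φ r :=
  intervalIntegral.continuous_primitive hφ c

theorem intervalIntegrable_mul_exp {φ : ℝ → ℂ} (hφ : ∀ a b, IntervalIntegrable φ volume a b)
    (a b : ℝ) :
    IntervalIntegrable (fun s => φ s * Complex.exp (∫ r in (0 : ℝ)..s, φ r)) volume a b :=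
  (hφ a b).mul_continuousOn
    (Complex.continuous_exp.comp (continuous_integral_of_intervalIntegrable hφ 0)).continuousOn

/-- Since `φ` is only locally integrable, the chain rule holds almost everywhere. Both sides, as
functions of the upper limit, are absolutely continuous, and their difference has derivative zero
almost everywhere, so it is constant. -/
theorem integral_mul_exp {φ : ℝ → ℂ} (hφ : ∀ a b, IntervalIntegrable φ volume a b)
    (b : ℝ) : ∫ s in (0 : ℝ)..b, φ s * Complex.exp (∫ r in (0 : ℝ)..s, φ r) =
      Complex.exp (∫ r in (0 : ℝ)..b, φ r) - 1 := by
  set Φ : ℝ → ℂ := fun s => ∫ r in (0 : ℝ)..s, φ r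
  have hψ := intervalIntegrable_mul_exp hφ
  set ψ : ℝ → ℂ := fun s => φ s * Complex.exp (Φ s)
  have hΦc : Continuous Φ := continuous_integral_of_intervalIntegrable hφ 0
  obtain ⟨R, hR⟩ := (isCompact_uIcc (a := (0 : ℝ)) (b := b)).exists_bound_of_continuousOn
    hΦc.continuousOn
  have hacφ := (hφ 0 b).norm.absolutelyContinuousOnInterval_intervalIntegral
    (c := 0) left_mem_uIcc
  have hacψ := (hψ 0 b).norm.absolutelyContinuousOnInterval_intervalIntegral
    (c := 0) left_mem_uIcc
  have hac1 : AbsolutelyContinuousOnInterval (fun s => Complex.exp (Φ s)) 0 b := by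
    -- On the ball of radius `R`, which contains the values of `Φ`, the exponential is Lipschitz
    -- with constant `exp R`.
    refine absolutelyContinuousOnInterval_of_dist_le (C := Real.exp R) hacφ fun x hx y hy => ?_
    refine le_trans ?_ (mul_le_mul_of_nonneg_left (dist_integral_le hφ 0 x y) (Real.exp_pos R).le)
    rw [dist_comm, dist_comm (∫ r in (0 : ℝ)..x, φ r), dist_eq_norm, dist_eq_norm]
    refine Convex.norm_image_sub_le_of_norm_deriv_le (s := Metric.closedBall (0 : ℂ) R)
      (fun z _ => Complex.differentiableAt_exp) (fun z hz => ?_) (convex_closedBall _ _) ?_ ?_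
    · rw [Complex.deriv_exp, Complex.norm_exp]
      exact Real.exp_le_exp.2 ((Complex.re_le_norm z).trans (by simpa using hz))
    · simpa using hR x hx
    · simpa using hR y hy
  have hac2 : AbsolutelyContinuousOnInterval (fun s => ∫ r in (0 : ℝ)..s, ψ r) 0 b :=
    absolutelyContinuousOnInterval_of_dist_le (C := 1) hacψ fun x _ y _ => by
      rw [one_mul]
      exact dist_integral_le hψ 0 x y
  obtain ⟨C, hC⟩ := (hac1.sub hac2).const_of_ae_hasDerivAt_zero (by
    filter_upwards [(hφ 0 b).ae_hasDerivAt_integral, (hψ 0 b).ae_hasDerivAt_integral]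
      with x h1 h2 hx
    have h3 := (h1 hx 0 left_mem_uIcc).cexp.sub (h2 hx 0 left_mem_uIcc)
    refine h3.congr_deriv ?_
    simp only [ψ, Φ]
    ring)
  have h0 := hC 0 left_mem_uIcc
  have h1 := hC b right_mem_uIcc
  simp only [Pi.sub_apply, Φ, intervalIntegral.integral_same, Complex.exp_zero, sub_zero] at h0 h1
  rw [← h0] at h1
  linear_combination -h1

theorem integral_mul_le_sqrt_mul_sqrt {α : Type*} [MeasurableSpace α] {μ : Measure α}
    {f g : α → ℝ} (hf0 : ∀ x, 0 ≤ f x) (hg0 : ∀ x, 0 ≤ g x) (hf : MemLp f 2 μ) (hg : MemLp g 2 μ) :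
    ∫ x, f x * g x ∂μ ≤ √(∫ x, f x ^ 2 ∂μ) * √(∫ x, g x ^ 2 ∂μ) := by
  have h := integral_mul_le_Lp_mul_Lq_of_nonneg (μ := μ) Real.HolderConjugate.two_two
    (Eventually.of_forall hf0) (Eventually.of_forall hg0) (by simpa using hf) (by simpa using hg)
  simpa [Real.sqrt_eq_rpow] using h

variable {α K X : Type*} [MeasurableSpace α] {μ : Measure α}
  [NormedAddCommGroup K] [InnerProductSpace ℂ K] [NormedAddCommGroup X] [InnerProductSpace ℂ X]

/-- Weak measurability is preserved by pairing with a strongly measurable left leg. -/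
theorem aestronglyMeasurable_inner_htmul {f : α → K} (hf : AEStronglyMeasurable f μ)
    {l : α → K ⊗ₕ X} (u : X) (hl : ∀ z, Measurable fun s => ⟪z, l s⟫_ℂ) :
    AEStronglyMeasurable (fun s => ⟪htmul (f s) u, l s⟫_ℂ) μ := by
  obtain ⟨g, hg, hfg⟩ := hf
  have h : StronglyMeasurable fun s => ⟪htmul (g s) u, l s⟫_ℂ := by
    refine Measurable.stronglyMeasurable ?_
    refine measurable_of_tendsto_metrizable (f := fun n s => ⟪htmul (hg.approx n s) u, l s⟫_ℂ)
      (fun n => SimpleFunc.measurable_bind (hg.approx n) (fun x s => ⟪htmul x u, l s⟫_ℂ)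
        fun x => hl _) ?_
    rw [tendsto_pi_nhds]
    intro s
    exact (((continuous_htmul_left u).tendsto _).comp (hg.tendsto_approx s)).inner
      tendsto_const_nhds
  refine h.aestronglyMeasurable.congr ?_
  filter_upwards [hfg] with s hs
  rw [hs]

end IntegralLemmas

/-! ### Frames of exponential type and the fundamental estimate -/

section Frame
variable {ι K X : Type*}
  [NormedAddCommGroup K] [InnerProductSpace ℂ K] [CompleteSpace K]
  [NormedAddCommGroup X] [InnerProductSpace ℂ X] [CompleteSpace X]

/-- A total family `v` whose truncations `P_s v` have Gram matrix `κ exp ∫₀ˢ ⟪f, f⟫`. -/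
structure IsExpFrame (P : ℝ → X →L[ℂ] X) (v : ι → X) (f : ι → ℝ → K) (κ : ι → ι → ℂ) : Prop where
  total : (Submodule.span ℂ (range v)).topologicalClosure = ⊤
  adjoint : ∀ s, (P s).adjoint = P s
  norm_le : ∀ s x, ‖P s x‖ ≤ ‖x‖
  memLp : ∀ p, MemLp (f p) 2 volume
  gram : ∀ s, 0 ≤ s → ∀ p q,
    ⟪P s (v p), P s (v q)⟫_ℂ = κ p q * Complex.exp (∫ r in (0 : ℝ)..s, ⟪f p r, f q r⟫_ℂ)

/-- The integrand `⟪v, k⟫ + ⟪f ⊗ v, l⟫`. -/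
def pairing (v : X) (f : ℝ → K) (k : ℝ → X) (l : ℝ → K ⊗ₕ X) (s : ℝ) : ℂ :=
  ⟪v, k s⟫_ℂ + ⟪htmul (f s) v, l s⟫_ℂ

variable {P : ℝ → X →L[ℂ] X} {v : ι → X} {f : ι → ℝ → K} {κ : ι → ι → ℂ}

/-- The gradient vector `∑ dᵢ fᵢ(s) ⊗ P_s vᵢ` of `∑ dᵢ vᵢ`. -/
def gradVec (P : ℝ → X →L[ℂ] X) (v : ι → X) (f : ι → ℝ → K) (d : ι →₀ ℂ) (s : ℝ) : K ⊗ₕ X :=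
  d.sum fun i a => a • htmul (f i s) (P s (v i))

namespace IsExpFrame

variable (h : IsExpFrame P v f κ)
include h

theorem intervalIntegrable_inner (p q : ι) (a b : ℝ) :
    IntervalIntegrable (fun r => ⟪f p r, f q r⟫_ℂ) volume a b :=
  (Integrable.mono' ((h.memLp p).norm.integrable_mul (h.memLp q).norm)
    ((h.memLp p).1.inner (h.memLp q).1)
    (Eventually.of_forall fun _ => norm_inner_le_norm _ _)).intervalIntegrable

/-- Term by term this is the derivative in `s` of the expression in `norm_sq_proj`: each exponential
contributes the factor `⟪f i s, f j s⟫`. -/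
theorem norm_sq_gradVec (d : ι →₀ ℂ) {s : ℝ} (hs : 0 ≤ s) :
    ((‖gradVec P v f d s‖ ^ 2 : ℝ) : ℂ) = d.sum fun i a => d.sum fun j b => star a * b * κ i j *
      (⟪f i s, f j s⟫_ℂ * Complex.exp (∫ r in (0 : ℝ)..s, ⟪f i r, f j r⟫_ℂ)) := by
  have h1 : ((‖gradVec P v f d s‖ ^ 2 : ℝ) : ℂ) = ⟪gradVec P v f d s, gradVec P v f d s⟫_ℂ := by
    rw [inner_self_eq_norm_sq_to_K]
    norm_cast
  rw [h1]
  rw [gradVec, Finsupp.sum_inner]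
  refine Finsupp.sum_congr fun i _ => ?_
  rw [Finsupp.inner_sum]
  refine Finsupp.sum_congr fun j _ => ?_
  simp only [inner_smul_left, inner_smul_right, inner_htmul, h.gram s hs, RCLike.star_def]
  ring

theorem norm_sq_proj (d : ι →₀ ℂ) {s : ℝ} (hs : 0 ≤ s) :
    ((‖P s (d.sum fun i a => a • v i)‖ ^ 2 : ℝ) : ℂ) = d.sum fun i a => d.sum fun j b =>
      star a * b * κ i j * Complex.exp (∫ r in (0 : ℝ)..s, ⟪f i r, f j r⟫_ℂ) := by
  have h1 (x : X) : ((‖x‖ ^ 2 : ℝ) : ℂ) = ⟪x, x⟫_ℂ := by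
    rw [inner_self_eq_norm_sq_to_K]
    norm_cast
  rw [h1]
  rw [map_finsuppSum]
  simp only [map_smul]
  rw [Finsupp.sum_inner]
  refine Finsupp.sum_congr fun i _ => ?_
  rw [Finsupp.inner_sum]
  refine Finsupp.sum_congr fun j _ => ?_
  simp only [inner_smul_left, inner_smul_right, h.gram s hs, RCLike.star_def]
  ring

/-- The energy of the gradient is exactly `‖P_b z‖² - ‖P_0 z‖²` with `z = ∑ dᵢ vᵢ`, by integrating
the exponentials in the Gram matrix. The bound does not involve the functions `fᵢ`. -/
theorem intervalIntegrable_norm_sq_gradVec (d : ι →₀ ℂ) {b : ℝ} (hb : 0 ≤ b) :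
    IntervalIntegrable (fun s => ‖gradVec P v f d s‖ ^ 2) volume 0 b ∧
      ∫ s in (0 : ℝ)..b, ‖gradVec P v f d s‖ ^ 2 ≤ ‖d.sum fun i a => a • v i‖ ^ 2 := by
  set F : ℝ → ℂ := fun s => d.sum fun i a => d.sum fun j b => star a * b * κ i j *
      (⟪f i s, f j s⟫_ℂ * Complex.exp (∫ r in (0 : ℝ)..s, ⟪f i r, f j r⟫_ℂ)) with hF
  have hint : ∀ i j, IntervalIntegrable (fun s => ⟪f i s, f j s⟫_ℂ *
      Complex.exp (∫ r in (0 : ℝ)..s, ⟪f i r, f j r⟫_ℂ)) volume 0 b := fun i j =>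
    intervalIntegrable_mul_exp (h.intervalIntegrable_inner i j) 0 b
  have hsum : ∀ (t : Finset ι) (g : ι → ℝ → ℂ), (∀ i, IntervalIntegrable (g i) volume 0 b) →
      IntervalIntegrable (fun s => ∑ i ∈ t, g i s) volume 0 b := fun t g hg => by
    simpa only [Finset.sum_fn] using IntervalIntegrable.sum t fun i _ => hg i
  have hFi : IntervalIntegrable F volume 0 b :=
    hsum _ _ fun i => hsum _ _ fun j => (hint i j).const_mul _
  have hEq : ∀ s ∈ uIcc 0 b, ((‖gradVec P v f d s‖ ^ 2 : ℝ) : ℂ) = F s := fun s hs => by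
    rw [uIcc_of_le hb] at hs
    exact h.norm_sq_gradVec d hs.1
  have hI1 : IntervalIntegrable (fun s => ((‖gradVec P v f d s‖ ^ 2 : ℝ) : ℂ)) volume 0 b :=
    hFi.congr fun s hs => (hEq s (uIoc_subset_uIcc hs)).symm
  have hI : IntervalIntegrable (fun s => ‖gradVec P v f d s‖ ^ 2) volume 0 b := by
    rw [intervalIntegrable_iff] at hI1 ⊢
    exact hI1.re.congr (Eventually.of_forall fun s => Complex.ofReal_re _)
  refine ⟨hI, ?_⟩
  have hval : ((∫ s in (0 : ℝ)..b, ‖gradVec P v f d s‖ ^ 2 : ℝ) : ℂ) =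
      ((‖P b (d.sum fun i a => a • v i)‖ ^ 2 : ℝ) : ℂ) -
        ((‖P 0 (d.sum fun i a => a • v i)‖ ^ 2 : ℝ) : ℂ) := by
    rw [← intervalIntegral.integral_ofReal, intervalIntegral.integral_congr hEq,
      h.norm_sq_proj d hb, h.norm_sq_proj d le_rfl]
    simp only [hF, Finsupp.sum]
    rw [intervalIntegral.integral_finsetSum, ← Finset.sum_sub_distrib]
    · refine Finset.sum_congr rfl fun i _ => ?_
      rw [intervalIntegral.integral_finsetSum, ← Finset.sum_sub_distrib]
      · refine Finset.sum_congr rfl fun j _ => ?_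
        rw [intervalIntegral.integral_const_mul,
          integral_mul_exp (h.intervalIntegrable_inner i j)]
        simp only [intervalIntegral.integral_same, Complex.exp_zero]
        ring
      · exact fun j _ => (hint i j).const_mul _
    · exact fun i _ => hsum _ _ fun j => (hint i j).const_mul _
  have hval' : ∫ s in (0 : ℝ)..b, ‖gradVec P v f d s‖ ^ 2 =
      ‖P b (d.sum fun i a => a • v i)‖ ^ 2 - ‖P 0 (d.sum fun i a => a • v i)‖ ^ 2 := by
    exact_mod_cast hval
  rw [hval']
  nlinarith [h.norm_le b (d.sum fun i a => a • v i), norm_nonneg (P b (d.sum fun i a => a • v i)),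
    sq_nonneg ‖P 0 (d.sum fun i a => a • v i)‖]

variable {k : ℝ → X} {l : ℝ → K ⊗ₕ X}

/-- Self-adjointness of `P s` moves the projection from the adapted vector `y` onto `w`; this is
where vacuum adaptedness enters the estimate. -/
theorem inner_htmul_of_adapted {s : ℝ} {y : K ⊗ₕ X} (hy : hmap (1 : K →L[ℂ] K) (P s) y = y)
    (x : K) (w : X) : ⟪htmul x w, y⟫_ℂ = ⟪htmul x (P s w), y⟫_ℂ := by
  conv_lhs => rw [← hy]
  rw [inner_hmap_one_left, h.adjoint, hmap_htmul, one_apply_eq_self]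

theorem intervalIntegrable_pairing (hk : ∀ x, Measurable fun s => ⟪x, k s⟫_ℂ)
    (hl : ∀ z, Measurable fun s => ⟪z, l s⟫_ℂ) {a b : ℝ} (hab : a ≤ b) {α β : ℝ → ℝ}
    (hα : MemLp α 1 (volume.restrict (Ioc a b))) (hβ : MemLp β 2 (volume.restrict (Ioc a b)))
    (hkα : ∀ s, ‖k s‖ ≤ α s) (hlβ : ∀ s, ‖l s‖ ≤ β s) (p : ι) :
    IntervalIntegrable (pairing (v p) (f p) k l) volume a b := by
  rw [intervalIntegrable_iff_integrableOn_Ioc_of_le hab]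
  refine Integrable.add ?_ ?_
  · refine Integrable.mono' ((memLp_one_iff_integrable.1 hα).const_mul ‖v p‖)
      (hk (v p)).aestronglyMeasurable (Eventually.of_forall fun s => ?_)
    exact (norm_inner_le_norm _ _).trans (mul_le_mul_of_nonneg_left (hkα s) (norm_nonneg _))
  · refine Integrable.mono' ((((h.memLp p).restrict _).norm.integrable_mul hβ).const_mul ‖v p‖)
      (aestronglyMeasurable_inner_htmul (h.memLp p).1.restrict (v p) hl)
      (Eventually.of_forall fun s => ?_)
    refine (norm_inner_le_norm _ _).trans ?_
    rw [norm_htmul, Pi.mul_apply, ← mul_assoc, mul_comm ‖v p‖]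
    exact mul_le_mul_of_nonneg_left (hlβ s) (by positivity)

/-- The fundamental estimate for integrals of column type. -/
theorem norm_sum_integral_le {a b : ℝ} (ha : 0 ≤ a) (hab : a ≤ b)
    (hI : ∀ p, IntervalIntegrable (pairing (v p) (f p) k l) volume a b)
    (had : ∀ s, hmap (1 : K →L[ℂ] K) (P s) (l s) = l s) {α β : ℝ → ℝ}
    (hα : MemLp α 1 (volume.restrict (Ioc a b))) (hβ : MemLp β 2 (volume.restrict (Ioc a b)))
    (hkα : ∀ s, ‖k s‖ ≤ α s) (hlβ : ∀ s, ‖l s‖ ≤ β s) (d : ι →₀ ℂ) :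
    ‖d.sum fun i c => star c * ∫ s in a..b, pairing (v i) (f i) k l s‖ ≤
      ((∫ s in a..b, α s) + √(∫ s in a..b, β s ^ 2)) * ‖d.sum fun i c => c • v i‖ := by
  set z := d.sum fun i c => c • v i with hz
  -- Adaptedness lets each `v i` paired with `l` be replaced by `P s (v i)`, so the finite sum
  -- collapses to one integral against the gradient vector.
  have e1 : (d.sum fun i c => star c * ∫ s in a..b, pairing (v i) (f i) k l s) =
      ∫ s in a..b, ⟪z, k s⟫_ℂ + ⟪gradVec P v f d s, l s⟫_ℂ := by
    simp only [Finsupp.sum, ← intervalIntegral.integral_const_mul]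
    rw [← intervalIntegral.integral_finsetSum fun i _ => (hI i).const_mul _]
    refine intervalIntegral.integral_congr fun s _ => ?_
    have h1 : ∀ i, pairing (v i) (f i) k l s =
        ⟪v i, k s⟫_ℂ + ⟪htmul (f i s) (P s (v i)), l s⟫_ℂ := fun i => by
      rw [pairing, h.inner_htmul_of_adapted (had s)]
    simp only [h1, hz, gradVec, Finsupp.sum, sum_inner, inner_smul_left, mul_add,
      Finset.sum_add_distrib, RCLike.star_def]
  have hgi := h.intervalIntegrable_norm_sq_gradVec d (ha.trans hab)
  have hg2 : IntegrableOn (fun s => ‖gradVec P v f d s‖ ^ 2) (Ioc a b) := by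
    have := hgi.1
    rw [intervalIntegrable_iff_integrableOn_Ioc_of_le (ha.trans hab)] at this
    exact this.mono_set (Ioc_subset_Ioc_left ha)
  -- Measurability of the norm is recovered by taking the square root of its integrable square.
  have hgm : AEStronglyMeasurable (fun s => ‖gradVec P v f d s‖) (volume.restrict (Ioc a b)) := by
    have := hg2.1.aemeasurable.sqrt.aestronglyMeasurable
    simpa only [Real.sqrt_sq (norm_nonneg _)] using this
  have hgL : MemLp (fun s => ‖gradVec P v f d s‖) 2 (volume.restrict (Ioc a b)) :=
    (memLp_two_iff_integrable_sq hgm).2 hg2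
  have hα1 := memLp_one_iff_integrable.1 hα
  have hgβ : IntegrableOn (fun s => ‖gradVec P v f d s‖ * β s) (Ioc a b) := hgL.integrable_mul hβ
  have i1 : IntervalIntegrable (fun s => ‖z‖ * α s) volume a b :=
    (intervalIntegrable_iff_integrableOn_Ioc_of_le hab).2 (hα1.const_mul _)
  have i2 : IntervalIntegrable (fun s => ‖gradVec P v f d s‖ * β s) volume a b :=
    (intervalIntegrable_iff_integrableOn_Ioc_of_le hab).2 hgβ
  rw [e1]
  refine (intervalIntegral.norm_integral_le_of_norm_le hab (Eventually.of_forall fun s _ =>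
    (norm_add_le _ _).trans (add_le_add ((norm_inner_le_norm _ _).trans
      (mul_le_mul_of_nonneg_left (hkα s) (norm_nonneg _))) ((norm_inner_le_norm _ _).trans
      (mul_le_mul_of_nonneg_left (hlβ s) (norm_nonneg _))))) (i1.add i2)).trans ?_
  rw [intervalIntegral.integral_add i1 i2, intervalIntegral.integral_const_mul, add_mul,
    mul_comm ‖z‖]
  refine add_le_add le_rfl ?_
  have h3 := integral_mul_le_sqrt_mul_sqrt (fun s => norm_nonneg (gradVec P v f d s))
    (fun s => (norm_nonneg _).trans (hlβ s)) hgL hβ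
  rw [intervalIntegral.integral_of_le hab, intervalIntegral.integral_of_le hab]
  refine h3.trans ?_
  rw [mul_comm]
  refine mul_le_mul_of_nonneg_left (Real.sqrt_le_iff.2 ⟨norm_nonneg _, ?_⟩) (Real.sqrt_nonneg _)
  -- The energy on `(a, b]` is enlarged to that on `(0, b]`, where it is bounded by `‖z‖²`.
  refine le_trans ?_ hgi.2
  rw [intervalIntegral.integral_of_le (ha.trans hab)]
  refine setIntegral_mono_set ?_ (Eventually.of_forall fun s => sq_nonneg _)
    (Ioc_subset_Ioc_left ha).eventuallyLE
  have := hgi.1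
  rwa [intervalIntegrable_iff_integrableOn_Ioc_of_le (ha.trans hab)] at this

theorem exists_integral {a b : ℝ} (ha : 0 ≤ a) (hab : a ≤ b)
    (hI : ∀ p, IntervalIntegrable (pairing (v p) (f p) k l) volume a b)
    (had : ∀ s, hmap (1 : K →L[ℂ] K) (P s) (l s) = l s) {α β : ℝ → ℝ}
    (hα : MemLp α 1 (volume.restrict (Ioc a b))) (hβ : MemLp β 2 (volume.restrict (Ioc a b)))
    (hkα : ∀ s, ‖k s‖ ≤ α s) (hlβ : ∀ s, ‖l s‖ ≤ β s) :
    ∃ x : X, ‖x‖ ≤ (∫ s in a..b, α s) + √(∫ s in a..b, β s ^ 2) ∧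
      ∀ p, ⟪v p, x⟫_ℂ = ∫ s in a..b, pairing (v p) (f p) k l s :=
  exists_vector_of_moments h.total _
    (add_nonneg (intervalIntegral.integral_nonneg hab fun s _ => (norm_nonneg _).trans (hkα s))
      (Real.sqrt_nonneg _))
    (h.norm_sum_integral_le ha hab hI had hα hβ hkα hlβ)

theorem norm_le_of_integral {a b : ℝ} (ha : 0 ≤ a) (hab : a ≤ b)
    (hI : ∀ p, IntervalIntegrable (pairing (v p) (f p) k l) volume a b)
    (had : ∀ s, hmap (1 : K →L[ℂ] K) (P s) (l s) = l s) {α β : ℝ → ℝ}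
    (hα : MemLp α 1 (volume.restrict (Ioc a b))) (hβ : MemLp β 2 (volume.restrict (Ioc a b)))
    (hkα : ∀ s, ‖k s‖ ≤ α s) (hlβ : ∀ s, ‖l s‖ ≤ β s) {x : X}
    (hx : ∀ p, ⟪v p, x⟫_ℂ = ∫ s in a..b, pairing (v p) (f p) k l s) :
    ‖x‖ ≤ (∫ s in a..b, α s) + √(∫ s in a..b, β s ^ 2) := by
  obtain ⟨y, hy1, hy2⟩ := h.exists_integral ha hab hI had hα hβ hkα hlβ
  rwa [ext_inner_of_total h.total fun p => (hx p).trans (hy2 p).symm]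

end IsExpFrame

end Frame

/-! ### Linear equations driven by bounded strongly continuous coefficients -/

section Driver
variable {ι K X : Type*}
  [NormedAddCommGroup K] [InnerProductSpace ℂ K] [CompleteSpace K]
  [NormedAddCommGroup X] [InnerProductSpace ℂ X] [CompleteSpace X]
  {P : ℝ → X →L[ℂ] X} {v : ι → X} {f : ι → ℝ → K} {κ : ι → ι → ℂ}

/-- A path with locally integrable increments is continuous. -/
theorem IsExpFrame.continuous_of_moments (h : IsExpFrame P v f κ) {k : ℝ → X} {l : ℝ → K ⊗ₕ X}
    {x : ℝ≥0 → X} {m : ι → ℂ}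
    (hI : ∀ (T : ℝ≥0) p, IntervalIntegrable (pairing (v p) (f p) k l) volume 0 T)
    (had : ∀ s, hmap (1 : K →L[ℂ] K) (P s) (l s) = l s) {α β : ℝ → ℝ}
    (hα : ∀ T : ℝ≥0, MemLp α 1 (volume.restrict (Ioc (0 : ℝ) T)))
    (hβ : ∀ T : ℝ≥0, MemLp β 2 (volume.restrict (Ioc (0 : ℝ) T)))
    (hkα : ∀ s, ‖k s‖ ≤ α s) (hlβ : ∀ s, ‖l s‖ ≤ β s)
    (hx : ∀ (t : ℝ≥0) p, ⟪v p, x t⟫_ℂ = m p + ∫ s in (0 : ℝ)..t, pairing (v p) (f p) k l s) :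
    Continuous x := by
  have iα : ∀ T : ℝ≥0, IntervalIntegrable α volume 0 T := fun T =>
    (intervalIntegrable_iff_integrableOn_Ioc_of_le T.2).2 (memLp_one_iff_integrable.1 (hα T))
  have iβ : ∀ T : ℝ≥0, IntervalIntegrable (fun s => β s ^ 2) volume 0 T := fun T =>
    (intervalIntegrable_iff_integrableOn_Ioc_of_le T.2).2 (hβ T).integrable_sq
  have key : ∀ s t : ℝ≥0, s ≤ t → ‖x t - x s‖ ≤
      ((∫ r in (0 : ℝ)..t, α r) - ∫ r in (0 : ℝ)..s, α r) +
        √((∫ r in (0 : ℝ)..t, β r ^ 2) - ∫ r in (0 : ℝ)..s, β r ^ 2) := by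
    intro s t hst
    have hst' : (s : ℝ) ≤ t := hst
    rw [intervalIntegral.integral_interval_sub_left (iα t) (iα s),
      intervalIntegral.integral_interval_sub_left (iβ t) (iβ s)]
    refine h.norm_le_of_integral s.2 hst' (fun p => (hI s p).symm.trans (hI t p)) had
      ((hα t).mono_measure (Measure.restrict_mono (Ioc_subset_Ioc_left s.2) le_rfl))
      ((hβ t).mono_measure (Measure.restrict_mono (Ioc_subset_Ioc_left s.2) le_rfl)) hkα hlβ
      fun p => ?_
    rw [inner_sub_right, hx, hx, add_sub_add_left_eq_sub,
      intervalIntegral.integral_interval_sub_left (hI t p) (hI s p)]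
    rfl
  have key' : ∀ s t : ℝ≥0, ‖x t - x s‖ ≤
      |(∫ r in (0 : ℝ)..t, α r) - ∫ r in (0 : ℝ)..s, α r| +
        √|(∫ r in (0 : ℝ)..t, β r ^ 2) - ∫ r in (0 : ℝ)..s, β r ^ 2| := by
    intro s t
    rcases le_total s t with hst | hst
    · exact (key s t hst).trans (add_le_add (le_abs_self _) (Real.sqrt_le_sqrt (le_abs_self _)))
    · rw [norm_sub_rev, abs_sub_comm, abs_sub_comm (∫ r in (0 : ℝ)..t, β r ^ 2)]
      exact (key t s hst).trans (add_le_add (le_abs_self _) (Real.sqrt_le_sqrt (le_abs_self _)))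
  have hprim : ∀ g : ℝ → ℝ, (∀ T : ℝ≥0, IntervalIntegrable g volume 0 T) →
      Continuous fun t : ℝ≥0 => ∫ r in (0 : ℝ)..t, g r := by
    intro g hg
    refine continuous_iff_continuousAt.2 fun t => ?_
    have hc := intervalIntegral.continuousOn_primitive_interval
      ((intervalIntegrable_iff' (by simp)).1 (hg (t + 1)))
    -- Integrability is available only on bounded intervals starting at `0`; the interval up to `t +
    -- 1` is a neighbourhood of `t` within the half-line.
    have hn : uIcc (0 : ℝ) ((t + 1 : ℝ≥0) : ℝ) ∈ 𝓝[Ici 0] (t : ℝ) := by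
      rw [uIcc_of_le (by positivity)]
      exact mem_nhdsWithin.2 ⟨Iio ((t + 1 : ℝ≥0) : ℝ), isOpen_Iio,
        NNReal.coe_lt_coe.2 (lt_add_one t), fun x hx => ⟨hx.2, hx.1.le⟩⟩
    refine ((hc _ (mem_of_mem_nhdsWithin (mem_Ici.2 t.2) hn)).mono_of_mem_nhdsWithin hn).tendsto.comp
      (tendsto_nhdsWithin_of_tendsto_nhds_of_eventually_within _
        (NNReal.continuous_coe.tendsto t) (Eventually.of_forall fun s => s.2))
  refine continuous_iff_continuousAt.2 fun t => ?_
  rw [ContinuousAt, tendsto_iff_norm_sub_tendsto_zero]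
  refine squeeze_zero (fun _ => norm_nonneg _) (key' t) ?_
  have h1 := ((hprim α iα).sub (continuous_const (y := ∫ r in (0 : ℝ)..t, α r))).abs.add
    ((hprim _ iβ).sub (continuous_const (y := ∫ r in (0 : ℝ)..t, β r ^ 2))).abs.sqrt
  simpa using! h1.tendsto t

/-- Bounded strongly continuous coefficients of a linear equation. -/
structure IsDriver (P : ℝ → X →L[ℂ] X) (C₀ : ℝ → X →L[ℂ] X) (C₁ : ℝ → X →L[ℂ] K ⊗ₕ X) (c : ℝ) :
    Prop where
  nonneg : 0 ≤ c
  cont₀ : ∀ ξ, Continuous fun s => C₀ s ξ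
  cont₁ : ∀ ξ, Continuous fun s => C₁ s ξ
  norm₀ : ∀ s, ‖C₀ s‖ ≤ c
  norm₁ : ∀ s, ‖C₁ s‖ ≤ c
  adapted : ∀ s ξ, hmap (1 : K →L[ℂ] K) (P s) (C₁ s ξ) = C₁ s ξ

/-- The integrand of the linear equation along the path `w`. -/
def drive (v : X) (f : ℝ → K) (C₀ : ℝ → X →L[ℂ] X) (C₁ : ℝ → X →L[ℂ] K ⊗ₕ X) (w : ℝ → X) :
    ℝ → ℂ :=
  pairing v f (fun s => C₀ s (w s)) fun s => C₁ s (w s)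

/-- Split `C s (w s)` into `C s (w s - w s₀)`, controlled by the uniform bound, and `C s (w s₀)`,
controlled by strong continuity. -/
theorem continuous_apply_of_bounded {α Y : Type*} [TopologicalSpace α] [NormedAddCommGroup Y]
    [NormedSpace ℂ Y] {C : α → X →L[ℂ] Y} {c : ℝ} (hc : ∀ s, ‖C s‖ ≤ c)
    (hC : ∀ ξ, Continuous fun s => C s ξ) {w : α → X} (hw : Continuous w) :
    Continuous fun s => C s (w s) := by
  refine continuous_iff_continuousAt.2 fun s₀ => ?_
  have h1 : Tendsto (fun s => C s (w s - w s₀)) (𝓝 s₀) (𝓝 0) := by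
    refine squeeze_zero_norm (fun s => (C s).le_of_opNorm_le (hc s) _) ?_
    have := ((hw.sub (continuous_const (y := w s₀))).norm.tendsto s₀).const_mul c
    simpa using! this
  have h2 := h1.add ((hC (w s₀)).tendsto s₀)
  simpa [ContinuousAt] using h2

theorem drive_add (v : X) (f : ℝ → K) (C₀ : ℝ → X →L[ℂ] X) (C₁ : ℝ → X →L[ℂ] K ⊗ₕ X)
    (w w' : ℝ → X) (s : ℝ) : drive v f C₀ C₁ (fun s => w s + w' s) s =
      drive v f C₀ C₁ w s + drive v f C₀ C₁ w' s := by
  simp only [drive, pairing, map_add, inner_add_right]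
  ring

theorem drive_smul (v : X) (f : ℝ → K) (C₀ : ℝ → X →L[ℂ] X) (C₁ : ℝ → X →L[ℂ] K ⊗ₕ X)
    (a : ℂ) (w : ℝ → X) (s : ℝ) : drive v f C₀ C₁ (fun s => a • w s) s =
      a * drive v f C₀ C₁ w s := by
  simp only [drive, pairing, map_smul, inner_smul_right]
  ring

theorem drive_sub (v : X) (f : ℝ → K) (C₀ : ℝ → X →L[ℂ] X) (C₁ : ℝ → X →L[ℂ] K ⊗ₕ X)
    (w w' : ℝ → X) (s : ℝ) : drive v f C₀ C₁ (fun s => w s - w' s) s =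
      drive v f C₀ C₁ w s - drive v f C₀ C₁ w' s := by
  simp only [drive, pairing, map_sub, inner_sub_right]
  ring

/-- The exponential weight for which the integral operator is a contraction. -/
def weight (c : ℝ) : ℝ := 2 * (2 * c + 1) ^ 2

/-- With `μ = 2c + 1` the weight is `2μ²`. The square-root term is then at most `c N exp(2μ² t) /
(2μ)`, and the linear term obeys the same bound because `μ ≥ 1`. Their sum carries the factor `c / μ
≤ 1/2`. -/
theorem integral_weight_le {c N t : ℝ} (hc : 0 ≤ c) (hN : 0 ≤ N) (ht : 0 ≤ t) {g : ℝ → ℝ}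
    (hg : Continuous g) (hg0 : ∀ s, 0 ≤ g s)
    (h : ∀ s ∈ Icc 0 t, g s ≤ N * Real.exp (weight c * s)) :
    (∫ s in (0 : ℝ)..t, c * g s) + √(∫ s in (0 : ℝ)..t, (c * g s) ^ 2) ≤
      1 / 2 * (N * Real.exp (weight c * t)) := by
  set μ := 2 * c + 1 with hμ
  have hμ1 : 1 ≤ μ := by linarith
  have hw : weight c = 2 * μ ^ 2 := rfl
  have hw0 : 0 < weight c := by rw [hw]; positivity
  have hexp : ∀ a : ℝ, 0 < a → ∫ s in (0 : ℝ)..t, Real.exp (a * s) ≤ Real.exp (a * t) / a := by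
    intro a ha
    rw [intervalIntegral.integral_comp_mul_left _ ha.ne', integral_exp, smul_eq_mul, mul_zero,
      Real.exp_zero, div_eq_inv_mul]
    have : 0 < a⁻¹ := by positivity
    nlinarith
  have h1 : ∫ s in (0 : ℝ)..t, c * g s ≤ c * N * Real.exp (weight c * t) / (2 * μ) := by
    calc ∫ s in (0 : ℝ)..t, c * g s ≤ ∫ s in (0 : ℝ)..t, c * N * Real.exp (weight c * s) := by
          refine intervalIntegral.integral_mono_on ht
            (Continuous.intervalIntegrable (by fun_prop) _ _)
            (Continuous.intervalIntegrable (by fun_prop) _ _) fun s hs => ?_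
          rw [mul_assoc]
          exact mul_le_mul_of_nonneg_left (h s hs) hc
      _ ≤ c * N * (Real.exp (weight c * t) / weight c) := by
          rw [intervalIntegral.integral_const_mul]
          exact mul_le_mul_of_nonneg_left (hexp _ hw0) (by positivity)
      _ ≤ c * N * (Real.exp (weight c * t) / (2 * μ)) := by
          gcongr
          rw [hw]
          nlinarith
      _ = _ := by ring
  have h2 : √(∫ s in (0 : ℝ)..t, (c * g s) ^ 2) ≤ c * N * Real.exp (weight c * t) / (2 * μ) := by
    refine Real.sqrt_le_iff.2 ⟨by positivity, ?_⟩
    calc ∫ s in (0 : ℝ)..t, (c * g s) ^ 2 ≤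
          ∫ s in (0 : ℝ)..t, (c * N) ^ 2 * Real.exp (2 * weight c * s) := by
          refine intervalIntegral.integral_mono_on ht
            (Continuous.intervalIntegrable (by fun_prop) _ _)
            (Continuous.intervalIntegrable (by fun_prop) _ _) fun s hs => ?_
          have e : (c * N) ^ 2 * Real.exp (2 * weight c * s) =
              (c * (N * Real.exp (weight c * s))) ^ 2 := by
            rw [mul_pow, mul_pow, mul_pow, ← Real.exp_nat_mul]
            push_cast
            rw [mul_assoc 2]
            ring
          rw [e]
          exact pow_le_pow_left₀ (mul_nonneg hc (hg0 s)) (mul_le_mul_of_nonneg_left (h s hs) hc) 2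
      _ ≤ (c * N) ^ 2 * (Real.exp (2 * weight c * t) / (2 * weight c)) := by
          rw [intervalIntegral.integral_const_mul]
          exact mul_le_mul_of_nonneg_left (hexp _ (by positivity)) (by positivity)
      _ = _ := by
          rw [hw, div_pow, mul_pow, mul_pow, mul_pow, ← Real.exp_nat_mul]
          push_cast
          rw [show 2 * (2 * μ ^ 2) * t = 2 * (2 * μ ^ 2 * t) by ring]
          field_simp
  have h3 : c / μ ≤ 1 / 2 := by
    rw [div_le_div_iff₀ (by positivity) (by norm_num)]
    linarith
  calc _ ≤ c * N * Real.exp (weight c * t) / (2 * μ) + c * N * Real.exp (weight c * t) / (2 * μ) :=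
        add_le_add h1 h2
    _ = c / μ * (N * Real.exp (weight c * t)) := by field_simp; ring
    _ ≤ _ := mul_le_mul_of_nonneg_right h3 (by positivity)

namespace IsDriver

variable {C₀ : ℝ → X →L[ℂ] X} {C₁ : ℝ → X →L[ℂ] K ⊗ₕ X} {c : ℝ}
  (hC : IsDriver P C₀ C₁ c) (h : IsExpFrame P v f κ)
include hC

theorem measurable₀ {w : ℝ → X} (hw : Continuous w) (x : X) :
    Measurable fun s => ⟪x, C₀ s (w s)⟫_ℂ :=
  (continuous_const.inner (continuous_apply_of_bounded hC.norm₀ hC.cont₀ hw)).measurable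

theorem measurable₁ {w : ℝ → X} (hw : Continuous w) (z : K ⊗ₕ X) :
    Measurable fun s => ⟪z, C₁ s (w s)⟫_ℂ :=
  (continuous_const.inner (continuous_apply_of_bounded hC.norm₁ hC.cont₁ hw)).measurable

omit hC in
theorem memLp_path {w : ℝ → X} (hw : Continuous w) (c : ℝ) (p : ENNReal) (a b : ℝ) :
    MemLp (fun s => c * ‖w s‖) p (volume.restrict (Ioc a b)) := by
  have hcont : Continuous fun s => c * ‖w s‖ := by fun_prop
  obtain ⟨B, hB⟩ := isCompact_Icc.exists_bound_of_continuousOn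
    (s := Icc a b) hcont.continuousOn
  refine MemLp.of_bound hcont.aestronglyMeasurable B ?_
  exact (ae_restrict_iff' measurableSet_Ioc).2
    (Eventually.of_forall fun s hs => hB s (Ioc_subset_Icc_self hs))

include h

theorem intervalIntegrable_drive {w : ℝ → X} (hw : Continuous w) {a b : ℝ} (hab : a ≤ b) (p : ι) :
    IntervalIntegrable (drive (v p) (f p) C₀ C₁ w) volume a b :=
  h.intervalIntegrable_pairing (hC.measurable₀ hw) (hC.measurable₁ hw) hab
    (memLp_path hw c 1 a b) (memLp_path hw c 2 a b)
    (fun s => (C₀ s).le_of_opNorm_le (hC.norm₀ s) _)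
    (fun s => (C₁ s).le_of_opNorm_le (hC.norm₁ s) _) p

theorem norm_le_of_drive {w : ℝ → X} (hw : Continuous w) {t : ℝ} (ht : 0 ≤ t) {x : X}
    (hx : ∀ p, ⟪v p, x⟫_ℂ = ∫ s in (0 : ℝ)..t, drive (v p) (f p) C₀ C₁ w s) :
    ‖x‖ ≤ (∫ s in (0 : ℝ)..t, c * ‖w s‖) + √(∫ s in (0 : ℝ)..t, (c * ‖w s‖) ^ 2) :=
  h.norm_le_of_integral le_rfl ht (hC.intervalIntegrable_drive h hw ht)
    (fun s => hC.adapted s (w s)) (memLp_path hw c 1 0 t) (memLp_path hw c 2 0 t)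
    (fun s => (C₀ s).le_of_opNorm_le (hC.norm₀ s) _)
    (fun s => (C₁ s).le_of_opNorm_le (hC.norm₁ s) _) hx

theorem norm_le_of_weight {w : ℝ → X} (hw : Continuous w) {t : ℝ} (ht : 0 ≤ t) {x : X} {N : ℝ}
    (hN : 0 ≤ N) (hwN : ∀ s ∈ Icc 0 t, ‖w s‖ ≤ N * Real.exp (weight c * s))
    (hx : ∀ p, ⟪v p, x⟫_ℂ = ∫ s in (0 : ℝ)..t, drive (v p) (f p) C₀ C₁ w s) :
    ‖x‖ ≤ 1 / 2 * (N * Real.exp (weight c * t)) :=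
  (hC.norm_le_of_drive h hw ht hx).trans
    (integral_weight_le hC.nonneg hN ht hw.norm (fun _ => norm_nonneg _) hwN)

/-- Uniqueness of solutions. -/
theorem eq_zero_of_drive {d : ℝ → X} (hd : Continuous d) {T : ℝ} (hT : 0 ≤ T)
    (hm : ∀ t ∈ Icc 0 T, ∀ p,
      ⟪v p, d t⟫_ℂ = ∫ s in (0 : ℝ)..t, drive (v p) (f p) C₀ C₁ d s) : d T = 0 := by
  -- At a maximum `t₀` of the weighted norm, the contraction estimate reads `‖d t₀‖ ≤ ‖d t₀‖ / 2`,
  -- so the maximum is zero.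
  obtain ⟨t₀, ht₀, hmax⟩ := isCompact_Icc.exists_isMaxOn (s := Icc (0 : ℝ) T)
    (nonempty_Icc.2 hT) (f := fun s => ‖d s‖ * Real.exp (-(weight c * s)))
    (by fun_prop : Continuous _).continuousOn
  set N := ‖d t₀‖ * Real.exp (-(weight c * t₀)) with hNdef
  have hN0 : 0 ≤ N := by positivity
  have hb : ∀ s ∈ Icc 0 T, ‖d s‖ ≤ N * Real.exp (weight c * s) := by
    intro s hs
    have h1 : ‖d s‖ * Real.exp (-(weight c * s)) ≤ N := hmax hs
    have h2 := mul_le_mul_of_nonneg_right h1 (Real.exp_pos (weight c * s)).le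
    rwa [mul_assoc, ← Real.exp_add, neg_add_cancel, Real.exp_zero, mul_one] at h2
  have h1 := hC.norm_le_of_weight h hd ht₀.1 hN0
    (fun s hs => hb s ⟨hs.1, hs.2.trans ht₀.2⟩) (hm t₀ ht₀)
  have h2 : N * Real.exp (weight c * t₀) = ‖d t₀‖ := by
    rw [hNdef, mul_assoc, ← Real.exp_add, neg_add_cancel, Real.exp_zero, mul_one]
  rw [h2] at h1
  have h3 : N = 0 := by
    rw [hNdef, show ‖d t₀‖ = 0 by linarith [norm_nonneg (d t₀)], zero_mul]
  have h4 := hb T ⟨hT, le_rfl⟩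
  rw [h3, zero_mul] at h4
  exact norm_le_zero_iff.1 h4

theorem exists_drive_integral {w : ℝ → X} (hw : Continuous w) (t : ℝ≥0) :
    ∃ x : X, ∀ p, ⟪v p, x⟫_ℂ = ∫ s in (0 : ℝ)..t, drive (v p) (f p) C₀ C₁ w s := by
  obtain ⟨x, -, hx⟩ := h.exists_integral le_rfl t.2 (hC.intervalIntegrable_drive h hw t.2)
    (fun s => hC.adapted s (w s)) (memLp_path hw c 1 0 t) (memLp_path hw c 2 0 t)
    (fun s => (C₀ s).le_of_opNorm_le (hC.norm₀ s) _)
    (fun s => (C₁ s).le_of_opNorm_le (hC.norm₁ s) _)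
  exact ⟨x, hx⟩

theorem continuous_of_drive {w : ℝ → X} (hw : Continuous w) {x : ℝ≥0 → X} {m : ι → ℂ}
    (hx : ∀ (t : ℝ≥0) p,
      ⟪v p, x t⟫_ℂ = m p + ∫ s in (0 : ℝ)..t, drive (v p) (f p) C₀ C₁ w s) : Continuous x :=
  h.continuous_of_moments (fun T => hC.intervalIntegrable_drive h hw T.2)
    (fun s => hC.adapted s (w s)) (fun T => memLp_path hw c 1 0 T) (fun T => memLp_path hw c 2 0 T)
    (fun s => (C₀ s).le_of_opNorm_le (hC.norm₀ s) _)
    (fun s => (C₁ s).le_of_opNorm_le (hC.norm₁ s) _) hx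

open scoped BoundedContinuousFunction

omit hC h in
/-- The unweighted path. -/
def unweight (c : ℝ) (z : ℝ≥0 →ᵇ X) (s : ℝ) : X :=
  (Real.exp (weight c * s.toNNReal) : ℂ) • z s.toNNReal

omit hC h in
theorem continuous_unweight (c : ℝ) (z : ℝ≥0 →ᵇ X) : Continuous (unweight c z) := by
  unfold unweight
  have := continuous_real_toNNReal
  fun_prop

/-- The integral operator on weighted paths. -/
def pathIntegral (z : ℝ≥0 →ᵇ X) (t : ℝ≥0) : X :=
  (hC.exists_drive_integral h (continuous_unweight c z) t).choose

theorem inner_pathIntegral (z : ℝ≥0 →ᵇ X) (t : ℝ≥0) (p : ι) :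
    ⟪v p, hC.pathIntegral h z t⟫_ℂ =
      ∫ s in (0 : ℝ)..t, drive (v p) (f p) C₀ C₁ (unweight c z) s :=
  (hC.exists_drive_integral h (continuous_unweight c z) t).choose_spec p

theorem continuous_pathIntegral (z : ℝ≥0 →ᵇ X) : Continuous (hC.pathIntegral h z) :=
  hC.continuous_of_drive h (continuous_unweight c z) (m := fun _ => 0) fun t p => by
    rw [zero_add, hC.inner_pathIntegral h]

theorem norm_pathIntegral_le (z : ℝ≥0 →ᵇ X) (t : ℝ≥0) :
    ‖hC.pathIntegral h z t‖ ≤ 1 / 2 * (‖z‖ * Real.exp (weight c * t)) := by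
  refine hC.norm_le_of_weight h (continuous_unweight c z) t.2 (norm_nonneg _) (fun s hs => ?_)
    (hC.inner_pathIntegral h z t)
  rw [unweight, norm_smul, Complex.norm_real, Real.norm_of_nonneg (Real.exp_pos _).le, mul_comm,
    Real.coe_toNNReal _ hs.1]
  exact mul_le_mul_of_nonneg_right (z.norm_coe_le_norm _) (Real.exp_pos _).le

/-- The path integral is a chosen vector, but its moments against the total family determine it, so
linearity is inherited from the integrals. -/
theorem pathIntegral_add (z z' : ℝ≥0 →ᵇ X) (t : ℝ≥0) :
    hC.pathIntegral h (z + z') t = hC.pathIntegral h z t + hC.pathIntegral h z' t := by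
  refine ext_inner_of_total h.total fun p => ?_
  rw [inner_add_right, hC.inner_pathIntegral h, hC.inner_pathIntegral h,
    hC.inner_pathIntegral h]
  refine Eq.trans ?_ (intervalIntegral.integral_add
    (hC.intervalIntegrable_drive h (continuous_unweight c z) t.2 p)
    (hC.intervalIntegrable_drive h (continuous_unweight c z') t.2 p))
  refine intervalIntegral.integral_congr fun s _ => ?_
  rw [← drive_add]
  congr 1
  ext r
  exact smul_add _ _ _

theorem pathIntegral_smul (a : ℂ) (z : ℝ≥0 →ᵇ X) (t : ℝ≥0) :
    hC.pathIntegral h (a • z) t = a • hC.pathIntegral h z t := by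
  refine ext_inner_of_total h.total fun p => ?_
  rw [inner_smul_right, hC.inner_pathIntegral h, hC.inner_pathIntegral h,
    ← intervalIntegral.integral_const_mul]
  refine intervalIntegral.integral_congr fun s _ => ?_
  rw [← drive_smul]
  congr 1
  ext r
  exact smul_comm _ _ _

theorem norm_weighted_pathIntegral_le (z : ℝ≥0 →ᵇ X) (t : ℝ≥0) :
    ‖(Real.exp (-(weight c * t)) : ℂ) • hC.pathIntegral h z t‖ ≤ 1 / 2 * ‖z‖ := by
  rw [norm_smul, Complex.norm_real, Real.norm_of_nonneg (Real.exp_pos _).le]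
  refine (mul_le_mul_of_nonneg_left (hC.norm_pathIntegral_le h z t)
    (Real.exp_pos _).le).trans_eq ?_
  rw [mul_left_comm, mul_left_comm (Real.exp _), ← Real.exp_add, neg_add_cancel,
    Real.exp_zero, mul_one]

theorem continuous_weighted_pathIntegral (z : ℝ≥0 →ᵇ X) :
    Continuous fun t : ℝ≥0 => (Real.exp (-(weight c * t)) : ℂ) • hC.pathIntegral h z t := by
  have := hC.continuous_pathIntegral h z
  fun_prop

/-- The weighted integral operator, a contraction. -/
def volterra : (ℝ≥0 →ᵇ X) →L[ℂ] (ℝ≥0 →ᵇ X) :=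
  LinearMap.mkContinuous
    { toFun := fun z => BoundedContinuousFunction.ofNormedAddCommGroup
        (fun t : ℝ≥0 => (Real.exp (-(weight c * t)) : ℂ) • hC.pathIntegral h z t)
        (hC.continuous_weighted_pathIntegral h z) (1 / 2 * ‖z‖)
        (hC.norm_weighted_pathIntegral_le h z)
      map_add' := fun z z' => by
        ext t
        simp only [BoundedContinuousFunction.coe_ofNormedAddCommGroup,
          BoundedContinuousFunction.add_apply, hC.pathIntegral_add h, smul_add]
      map_smul' := fun a z => by
        ext t
        simp only [BoundedContinuousFunction.coe_ofNormedAddCommGroup,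
          BoundedContinuousFunction.smul_apply, hC.pathIntegral_smul h, RingHom.id_apply,
          smul_comm a] }
    (1 / 2) fun z => BoundedContinuousFunction.norm_ofNormedAddCommGroup_le _ (by positivity)
      (hC.norm_weighted_pathIntegral_le h z)

theorem norm_volterra_lt : ‖hC.volterra h‖ < 1 :=
  (LinearMap.mkContinuous_norm_le _ (by norm_num : (0 : ℝ) ≤ 1 / 2) _).trans_lt (by norm_num)

omit hC h in
theorem norm_weighted_const_le (c : ℝ) (ξ : X) (t : ℝ≥0) :
    ‖(Real.exp (-(weight c * t)) : ℂ) • ξ‖ ≤ ‖ξ‖ := by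
  rw [norm_smul, Complex.norm_real, Real.norm_of_nonneg (Real.exp_pos _).le]
  refine mul_le_of_le_one_left (norm_nonneg _) (Real.exp_le_one_iff.2 ?_)
  have h1 := t.2
  have h2 : 0 ≤ weight c := by unfold weight; positivity
  exact neg_nonpos.2 (mul_nonneg h2 h1)

omit hC h in
/-- The weighted constant paths. -/
def constPath (c : ℝ) : X →L[ℂ] (ℝ≥0 →ᵇ X) :=
  LinearMap.mkContinuous
    { toFun := fun ξ => BoundedContinuousFunction.ofNormedAddCommGroup
        (fun t : ℝ≥0 => (Real.exp (-(weight c * t)) : ℂ) • ξ) (by fun_prop) ‖ξ‖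
          (norm_weighted_const_le c ξ)
      map_add' := fun ξ ξ' => by
        ext t
        exact smul_add _ _ _
      map_smul' := fun a ξ => by
        ext t
        exact smul_comm _ _ _ }
    1 fun ξ => by
      rw [one_mul]
      exact BoundedContinuousFunction.norm_ofNormedAddCommGroup_le _ (norm_nonneg _)
        (norm_weighted_const_le c ξ)

/-- Existence of solutions. -/
theorem exists_solution : ∃ (M : ℝ≥0 → X →L[ℂ] X) (B : ℝ), (∀ ξ, Continuous fun t => M t ξ) ∧
    (∀ t, ‖M t‖ ≤ B * Real.exp (weight c * t)) ∧
    ∀ (t : ℝ≥0) ξ p, ⟪v p, M t ξ⟫_ℂ = ⟪v p, ξ⟫_ℂ +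
      ∫ s in (0 : ℝ)..t, drive (v p) (f p) C₀ C₁ (fun s => M s.toNNReal ξ) s := by
  -- The weighted solution path is `(1 - V)⁻¹` applied to the weighted constant path, where `V` is
  -- the contraction `volterra`. It depends linearly and boundedly on `ξ`, so evaluation at `t`
  -- gives a bounded operator.
  set u := Units.oneSub (hC.volterra h) (hC.norm_volterra_lt h) with hu
  let S : X →L[ℂ] (ℝ≥0 →ᵇ X) := ((u⁻¹ : ((ℝ≥0 →ᵇ X) →L[ℂ] (ℝ≥0 →ᵇ X))ˣ) :
    (ℝ≥0 →ᵇ X) →L[ℂ] (ℝ≥0 →ᵇ X)) ∘L constPath c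
  have hS : ∀ ξ, S ξ - hC.volterra h (S ξ) = constPath c ξ := fun ξ => by
    have h1 := congrArg (fun R : (ℝ≥0 →ᵇ X) →L[ℂ] (ℝ≥0 →ᵇ X) => R (constPath c ξ)) u.mul_inv
    exact h1
  let ev (t : ℝ≥0) : (ℝ≥0 →ᵇ X) →L[ℂ] X := BoundedContinuousFunction.evalCLM ℂ t
  refine ⟨fun t => (Real.exp (weight c * t) : ℂ) • (ev t ∘L S), ‖S‖, fun ξ => ?_, fun t => ?_,
    fun t ξ p => ?_⟩
  · change Continuous fun t : ℝ≥0 => (Real.exp (weight c * t) : ℂ) • S ξ t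
    fun_prop
  · rw [norm_smul, Complex.norm_real, Real.norm_of_nonneg (Real.exp_pos _).le, mul_comm]
    refine mul_le_mul_of_nonneg_right ?_ (Real.exp_pos _).le
    refine ContinuousLinearMap.opNorm_le_bound _ S.opNorm_nonneg fun ξ => ?_
    exact ((S ξ).norm_coe_le_norm t).trans (S.le_opNorm ξ)
  · have h1 := congrArg (fun z : ℝ≥0 →ᵇ X => z t) (hS ξ)
    change S ξ t - (Real.exp (-(weight c * t)) : ℂ) • hC.pathIntegral h (S ξ) t =
      (Real.exp (-(weight c * t)) : ℂ) • ξ at h1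
    have h2 : (Real.exp (weight c * t) : ℂ) • S ξ t = ξ + hC.pathIntegral h (S ξ) t := by
      rw [sub_eq_iff_eq_add.1 h1, ← smul_add, smul_smul, ← Complex.ofReal_mul, ← Real.exp_add,
        add_neg_cancel, Real.exp_zero, Complex.ofReal_one, one_smul]
    change ⟪v p, (Real.exp (weight c * t) : ℂ) • S ξ t⟫_ℂ = _
    rw [h2, inner_add_right, hC.inner_pathIntegral h]
    rfl

end IsDriver

end Driver

/-! ### Properties of the solution -/

section Solution
variable {ι K X : Type*}
  [NormedAddCommGroup K] [InnerProductSpace ℂ K] [CompleteSpace K]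
  [NormedAddCommGroup X] [InnerProductSpace ℂ X] [CompleteSpace X]
  {P : ℝ → X →L[ℂ] X} {v : ι → X} {f : ι → ℝ → K} {κ : ι → ι → ℂ}
  {C₀ : ℝ → X →L[ℂ] X} {C₁ : ℝ → X →L[ℂ] K ⊗ₕ X} {c : ℝ}

/-- The family `M` solves `M_t = 1 + ∫₀ᵗ C M dΛ` at the vector `ξ`. -/
def SolvesAt (v : ι → X) (f : ι → ℝ → K) (C₀ : ℝ → X →L[ℂ] X) (C₁ : ℝ → X →L[ℂ] K ⊗ₕ X)
    (M : ℝ≥0 → X →L[ℂ] X) (ξ : X) : Prop :=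
  ∀ (t : ℝ≥0) p, ⟪v p, M t ξ⟫_ℂ = ⟪v p, ξ⟫_ℂ +
    ∫ s in (0 : ℝ)..t, drive (v p) (f p) C₀ C₁ (fun s => M s.toNNReal ξ) s

theorem continuous_comp_toNNReal {Y : Type*} [TopologicalSpace Y] {w : ℝ≥0 → Y}
    (hw : Continuous w) : Continuous fun s : ℝ => w s.toNNReal :=
  hw.comp continuous_real_toNNReal

namespace IsDriver
variable (hC : IsDriver P C₀ C₁ c) (h : IsExpFrame P v f κ)
include hC h

/-- Uniqueness of continuous solutions of the homogeneous equation, on `ℝ≥0`. -/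
theorem eq_zero_of_drive_nnreal {d : ℝ≥0 → X} (hd : Continuous d)
    (hm : ∀ (t : ℝ≥0) p, ⟪v p, d t⟫_ℂ =
      ∫ s in (0 : ℝ)..t, drive (v p) (f p) C₀ C₁ (fun s => d s.toNNReal) s) (t : ℝ≥0) :
    d t = 0 := by
  have := hC.eq_zero_of_drive h (continuous_comp_toNNReal hd) t.2 fun s hs p => by
    have h1 := hm s.toNNReal p
    rwa [Real.coe_toNNReal _ hs.1] at h1
  simpa using this

/-- The difference of two continuous paths solving the same equation vanishes. -/
theorem eq_of_drive {x y : ℝ≥0 → X} (hx : Continuous x) (hy : Continuous y) {m : ι → ℂ}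
    (hxm : ∀ (t : ℝ≥0) p, ⟪v p, x t⟫_ℂ = m p +
      ∫ s in (0 : ℝ)..t, drive (v p) (f p) C₀ C₁ (fun s => x s.toNNReal) s)
    (hym : ∀ (t : ℝ≥0) p, ⟪v p, y t⟫_ℂ = m p +
      ∫ s in (0 : ℝ)..t, drive (v p) (f p) C₀ C₁ (fun s => y s.toNNReal) s) (t : ℝ≥0) :
    x t = y t := by
  refine sub_eq_zero.1 (hC.eq_zero_of_drive_nnreal h (d := fun t => x t - y t) (hx.sub hy)
    (fun t p => ?_) t)
  rw [inner_sub_right, hxm, hym, add_sub_add_left_eq_sub]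
  refine (intervalIntegral.integral_sub
    (hC.intervalIntegrable_drive h (continuous_comp_toNNReal hx) t.2 p)
    (hC.intervalIntegrable_drive h (continuous_comp_toNNReal hy) t.2 p)).symm.trans ?_
  exact intervalIntegral.integral_congr fun s _ => (drive_sub _ _ _ _ _ _ _).symm

variable {M : ℝ≥0 → X →L[ℂ] X} (hcont : ∀ ξ, Continuous fun t => M t ξ)
  (hM : ∀ ξ, SolvesAt v f C₀ C₁ M ξ)
include hcont hM

/-- The solution commutes with the operators which commute with the coefficients. -/
theorem solution_commute {b : X →L[ℂ] X} (hb₀ : ∀ s ξ, C₀ s (b ξ) = b (C₀ s ξ))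
    (hb₁ : ∀ s ξ, C₁ s (b ξ) = hmap (1 : K →L[ℂ] K) b (C₁ s ξ))
    (hbv : ∀ p, ∃ p', b.adjoint (v p) = v p' ∧ f p' = f p) (t : ℝ≥0) :
    M t ∘L b = b ∘L M t := by
  refine ContinuousLinearMap.ext fun ξ => ?_
  -- Both `M_t (b ξ)` and `b (M_t ξ)` solve the equation with initial value `b ξ`; for the second,
  -- `b` is moved onto the frame vectors as its adjoint.
  refine hC.eq_of_drive h (hcont (b ξ)) (b.continuous.comp (hcont ξ)) (m := fun p => ⟪v p, b ξ⟫_ℂ)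
    (hM (b ξ)) (fun t p => ?_) t
  obtain ⟨p', h1, h2⟩ := hbv p
  have e : ∀ x y, ⟪x, b y⟫_ℂ = ⟪b.adjoint x, y⟫_ℂ := fun x y =>
    (ContinuousLinearMap.adjoint_inner_left b y x).symm
  simp only [Function.comp_apply]
  rw [e, e, h1, hM ξ t p']
  congr 1
  refine intervalIntegral.integral_congr fun s _ => ?_
  simp only [drive, pairing, hb₀, hb₁, h2, inner_hmap_one_left, hmap_htmul, one_apply_eq_self]
  rw [← h1, ContinuousLinearMap.adjoint_inner_left]

end IsDriver

/-- Frames for which the projections form an increasing family which acts by truncation. -/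
structure IsTruncFrame (P : ℝ → X →L[ℂ] X) (v : ι → X) (f : ι → ℝ → K) (κ : ι → ι → ℂ) : Prop
    extends IsExpFrame P v f κ where
  mono : ∀ s t x, s ≤ t → P t (P s x) = P s x
  trunc : ∀ (t : ℝ≥0) p, ∃ p', P t (v p) = v p' ∧
    ∀ᵐ s ∂volume, s ∈ Ioc (0 : ℝ) t → f p' s = f p s

/-- Coefficients which are invariant under the projections. -/
structure IsAdaptedDriver (P : ℝ → X →L[ℂ] X) (C₀ : ℝ → X →L[ℂ] X) (C₁ : ℝ → X →L[ℂ] K ⊗ₕ X)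
    (c : ℝ) : Prop extends IsDriver P C₀ C₁ c where
  proj₀ : ∀ s ξ, P s (C₀ s ξ) = C₀ s ξ
  comp₀ : ∀ s ξ, C₀ s (P s ξ) = C₀ s ξ
  comp₁ : ∀ s ξ, C₁ s (P s ξ) = C₁ s ξ

/-- This is the adjoint of `mono`, the projections being self-adjoint. -/
theorem IsTruncFrame.mono' (h : IsTruncFrame P v f κ) {s t : ℝ} (x : X) (hst : s ≤ t) :
    P s (P t x) = P s x := by
  refine ext_inner_left ℂ fun y => ?_
  have e : ∀ r a b, ⟪a, P r b⟫_ℂ = ⟪P r a, b⟫_ℂ := fun r a b => by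
    rw [← ContinuousLinearMap.adjoint_inner_left, h.adjoint]
  rw [e, e, h.mono s t y hst, ← e]

namespace IsAdaptedDriver
variable (hC : IsAdaptedDriver P C₀ C₁ c) (h : IsTruncFrame P v f κ)
include hC h
variable {M : ℝ≥0 → X →L[ℂ] X} (hcont : ∀ ξ, Continuous fun t => M t ξ)
  (hM : ∀ ξ, SolvesAt v f C₀ C₁ M ξ)
include hM

/-- Truncating `v p` at `t` gives a frame vector with the same function on `(0, t]` and the same
image under `P s` for `s ≤ t`. The integrands up to time `t` see no more than that, so the moments
of `(M t - 1) ξ` do not change. -/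
theorem proj_comp_solution (t : ℝ≥0) : P t ∘L (M t - 1) = M t - 1 := by
  refine ContinuousLinearMap.ext fun ξ => ext_inner_of_total h.total fun p => ?_
  obtain ⟨p', h1, h2⟩ := h.trunc t p
  have e : ∀ p, ⟪v p, (M t - 1) ξ⟫_ℂ =
      ∫ s in (0 : ℝ)..t, drive (v p) (f p) C₀ C₁ (fun s => M s.toNNReal ξ) s := fun p => by
    rw [sub_apply, one_apply_eq_self, inner_sub_right, hM ξ t p, add_sub_cancel_left]
  rw [ContinuousLinearMap.comp_apply, ← ContinuousLinearMap.adjoint_inner_left, h.adjoint, h1, e, e]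
  refine intervalIntegral.integral_congr_ae ?_
  filter_upwards [h2] with s hs hst
  rw [uIoc_of_le (show (0 : ℝ) ≤ t from t.2)] at hst
  have e1 : ∀ y, ⟪v p', C₀ s y⟫_ℂ = ⟪v p, C₀ s y⟫_ℂ := fun y => by
    rw [← h1, ← h.adjoint, ContinuousLinearMap.adjoint_inner_left, ← hC.proj₀,
      h.mono s t _ hst.2]
  have e2 : ∀ x y, ⟪htmul x (v p'), C₁ s y⟫_ℂ = ⟪htmul x (v p), C₁ s y⟫_ℂ := fun x y => by
    rw [h.inner_htmul_of_adapted (hC.adapted s y), ← h1, h.mono' (v p) hst.2,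
      ← h.inner_htmul_of_adapted (hC.adapted s y)]
  simp only [drive, pairing, hs hst, e1, e2]

include hcont

/-- The vector `η = ξ - P_t ξ` is killed by `P_s`, hence by both coefficients, for all `s ≤ t`. Then
`M_s η - η` solves the homogeneous equation on `[0, t]` and vanishes there. -/
theorem solution_comp_proj (t : ℝ≥0) : (M t - 1) ∘L P t = M t - 1 := by
  refine ContinuousLinearMap.ext fun ξ => ?_
  set η := ξ - P t ξ with hη
  have hz : ∀ s, s ≤ (t : ℝ) → P s η = 0 := fun s hs => by
    rw [hη, map_sub, h.mono' ξ hs, sub_self]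
  have h0 : ∀ s, s ≤ (t : ℝ) → C₀ s η = 0 := fun s hs => by
    rw [← hC.comp₀, hz s hs, map_zero]
  have h1 : ∀ s, s ≤ (t : ℝ) → C₁ s η = 0 := fun s hs => by
    rw [← hC.comp₁, hz s hs, map_zero]
  have key : M (t : ℝ).toNNReal η - η = 0 := by
    refine hC.eq_zero_of_drive h.toIsExpFrame (d := fun s => M s.toNNReal η - η)
      ((continuous_comp_toNNReal (hcont η)).sub continuous_const) t.2 fun s hs p => ?_
    have h2 := hM η s.toNNReal p
    rw [Real.coe_toNNReal _ hs.1] at h2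
    rw [inner_sub_right, h2, add_sub_cancel_left]
    refine intervalIntegral.integral_congr fun r hr => ?_
    rw [uIcc_of_le hs.1] at hr
    have hrt := hr.2.trans hs.2
    simp only [drive, pairing, map_sub, h0 r hrt, h1 r hrt, sub_zero]
  rw [Real.toNNReal_coe, hη, map_sub] at key
  simp only [ContinuousLinearMap.comp_apply, sub_apply, one_apply_eq_self]
  exact (sub_eq_sub_iff_sub_eq_sub.1 (sub_eq_zero.1 key)).symm

end IsAdaptedDriver

namespace IsDriver
variable (hC : IsDriver P C₀ C₁ c) (h : IsExpFrame P v f κ)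
include hC h
variable {M : ℝ≥0 → X →L[ℂ] X} (hcont : ∀ ξ, Continuous fun t => M t ξ)
  (hM : ∀ ξ, SolvesAt v f C₀ C₁ M ξ)
include hcont hM

/-- Weakly measurable solutions coincide with the strongly continuous one. -/
theorem solution_unique {M' : ℝ≥0 → X →L[ℂ] X} (hM' : ∀ q, SolvesAt v f C₀ C₁ M' (v q))
    (hk : ∀ q x, Measurable fun s : ℝ => ⟪x, C₀ s (M' s.toNNReal (v q))⟫_ℂ)
    (hl : ∀ q z, Measurable fun s : ℝ => ⟪z, C₁ s (M' s.toNNReal (v q))⟫_ℂ) {α β : ℝ → ℝ}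
    (hα : ∀ T : ℝ≥0, MemLp α 1 (volume.restrict (Ioc (0 : ℝ) T)))
    (hβ : ∀ T : ℝ≥0, MemLp β 2 (volume.restrict (Ioc (0 : ℝ) T)))
    (hkα : ∀ s : ℝ, ‖C₀ s ∘L M' s.toNNReal‖ ≤ α s) (hlβ : ∀ s : ℝ, ‖C₁ s ∘L M' s.toNNReal‖ ≤ β s) :
    M' = M := by
  funext t
  refine ContinuousLinearMap.ext_on (Submodule.dense_iff_topologicalClosure_eq_top.2 h.total) ?_
  rintro _ ⟨q, rfl⟩
  have hα' : ∀ T : ℝ≥0, MemLp (fun s => ‖v q‖ * α s) 1 (volume.restrict (Ioc (0 : ℝ) T)) :=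
    fun T => (hα T).const_mul _
  have hβ' : ∀ T : ℝ≥0, MemLp (fun s => ‖v q‖ * β s) 2 (volume.restrict (Ioc (0 : ℝ) T)) :=
    fun T => (hβ T).const_mul _
  have hkα' : ∀ s : ℝ, ‖C₀ s (M' s.toNNReal (v q))‖ ≤ ‖v q‖ * α s := fun s => by
    rw [mul_comm]
    exact (C₀ s ∘L M' s.toNNReal).le_of_opNorm_le (hkα s) _
  have hlβ' : ∀ s : ℝ, ‖C₁ s (M' s.toNNReal (v q))‖ ≤ ‖v q‖ * β s := fun s => by
    rw [mul_comm]
    exact (C₁ s ∘L M' s.toNNReal).le_of_opNorm_le (hlβ s) _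
  -- The integrable bounds on the two coefficients applied to `M'` force continuity of the path,
  -- after which uniqueness for continuous paths applies.
  have hc' : Continuous fun t => M' t (v q) :=
    h.continuous_of_moments
      (fun T => h.intervalIntegrable_pairing (hk q) (hl q) T.2 (hα' T) (hβ' T) hkα' hlβ')
      (fun s => hC.adapted s _) hα' hβ' hkα' hlβ' (m := fun p => ⟪v p, v q⟫_ℂ) (hM' q)
  exact hC.eq_of_drive h hc' (hcont _) (hM' q) (hM (v q)) t

omit hcont hM in
/-- An equation on `[s, ∞)` which holds for a total family of initial values holds for all. -/
theorem solves_of_total {N : ℝ≥0 → X →L[ℂ] X} (s : ℝ≥0)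
    (hpath : ∀ η, Continuous fun r : ℝ => N (r.toNNReal - s) η) {κ : Type*} {w : κ → X}
    (hw : (Submodule.span ℂ (range w)).topologicalClosure = ⊤) {B : ℝ≥0 → ℝ}
    (hB : ∀ t r, r ≤ t → ‖N r‖ ≤ B t)
    (hN : ∀ q (t : ℝ≥0) p, ⟪v p, N t (w q)⟫_ℂ = ⟪v p, w q⟫_ℂ +
      ∫ r in (s : ℝ)..(s + t : ℝ), drive (v p) (f p) C₀ C₁ (fun r => N (r.toNNReal - s) (w q)) r)
    (η : X) (t : ℝ≥0) (p : ι) : ⟪v p, N t η⟫_ℂ = ⟪v p, η⟫_ℂ +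
      ∫ r in (s : ℝ)..(s + t : ℝ), drive (v p) (f p) C₀ C₁ (fun r => N (r.toNNReal - s) η) r := by
  have hst : (s : ℝ) ≤ s + t := le_add_of_nonneg_right t.2
  have hI : ∀ η, IntervalIntegrable (drive (v p) (f p) C₀ C₁ (fun r => N (r.toNNReal - s) η))
      volume s (s + t : ℝ) := fun η => hC.intervalIntegrable_drive h (hpath η) hst p
  let b : ℝ → ℝ := fun r => (‖v p‖ + ‖f p r‖ * ‖v p‖) * (c * B t)
  have hb : IntervalIntegrable b volume s (s + t : ℝ) := by
    refine IntervalIntegrable.mul_const (intervalIntegrable_const.add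
      (IntervalIntegrable.mul_const ?_ _)) _
    rw [intervalIntegrable_iff_integrableOn_Ioc_of_le hst]
    exact ((h.memLp p).restrict _).norm.integrable (by norm_num)
  -- The integral term is a bounded functional of the initial value, dominated through `b`, so an
  -- identity on a total family extends to every `η`.
  let R : X →L[ℂ] ℂ := LinearMap.mkContinuous
    { toFun := fun η => ∫ r in (s : ℝ)..(s + t : ℝ),
        drive (v p) (f p) C₀ C₁ (fun r => N (r.toNNReal - s) η) r
      map_add' := fun η η' => by
        refine Eq.trans ?_ (intervalIntegral.integral_add (hI η) (hI η'))
        refine intervalIntegral.integral_congr fun r _ => ?_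
        rw [← drive_add]
        simp only [map_add]
      map_smul' := fun a η => by
        refine Eq.trans ?_ (intervalIntegral.integral_const_mul a _)
        refine intervalIntegral.integral_congr fun r _ => ?_
        rw [← drive_smul]
        simp only [map_smul] }
    (∫ r in (s : ℝ)..(s + t : ℝ), b r) fun η => by
      rw [← intervalIntegral.integral_mul_const]
      refine intervalIntegral.norm_integral_le_of_norm_le hst
        (Eventually.of_forall fun r hr => ?_) (hb.mul_const _)
      have hNr : ‖N (r.toNNReal - s) η‖ ≤ B t * ‖η‖ := by
        refine ContinuousLinearMap.le_of_opNorm_le _ (hB t _ ?_) η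
        rw [tsub_le_iff_left]
        exact Real.toNNReal_le_iff_le_coe.2 (by exact_mod_cast hr.2)
      have n0 : ‖C₀ r (N (r.toNNReal - s) η)‖ ≤ c * (B t * ‖η‖) :=
        ((C₀ r).le_of_opNorm_le (hC.norm₀ r) _).trans (mul_le_mul_of_nonneg_left hNr hC.nonneg)
      have n1 : ‖C₁ r (N (r.toNNReal - s) η)‖ ≤ c * (B t * ‖η‖) :=
        ((C₁ r).le_of_opNorm_le (hC.norm₁ r) _).trans (mul_le_mul_of_nonneg_left hNr hC.nonneg)
      refine (norm_add_le _ _).trans ((add_le_add ((norm_inner_le_norm _ _).trans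
        (mul_le_mul_of_nonneg_left n0 (norm_nonneg _))) ((norm_inner_le_norm _ _).trans
        (mul_le_mul_of_nonneg_left n1 (norm_nonneg _)))).trans_eq ?_)
      rw [norm_htmul]
      ring
  have hext : innerSL ℂ (v p) ∘L N t = innerSL ℂ (v p) + R := by
    refine ContinuousLinearMap.ext_on (Submodule.dense_iff_topologicalClosure_eq_top.2 hw) ?_
    rintro _ ⟨q, rfl⟩
    exact hN q t p
  exact congrArg (fun T : X →L[ℂ] ℂ => T η) hext

/-- The evolution property: a family solving the equation started at time `s` is the
transition operator from `s`. -/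
theorem solution_evolution {N : ℝ≥0 → X →L[ℂ] X} (s : ℝ≥0) (hN0 : N 0 = 1)
    (hNc : ∀ η, Continuous fun t => N t η) {κ : Type*} {w : κ → X}
    (hw : (Submodule.span ℂ (range w)).topologicalClosure = ⊤) {B : ℝ≥0 → ℝ}
    (hB : ∀ t r, r ≤ t → ‖N r‖ ≤ B t)
    (hN : ∀ q (t : ℝ≥0) p, ⟪v p, N t (w q)⟫_ℂ = ⟪v p, w q⟫_ℂ +
      ∫ r in (s : ℝ)..(s + t : ℝ), drive (v p) (f p) C₀ C₁ (fun r => N (r.toNNReal - s) (w q)) r)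
    (t : ℝ≥0) : M (s + t) = N t ∘L M s := by
  have hpath : ∀ η, Continuous fun r : ℝ => N (r.toNNReal - s) η := fun η =>
    (hNc η).comp (continuous_real_toNNReal.sub continuous_const)
  have hst : ∀ t : ℝ≥0, (s : ℝ) ≤ s + t := fun t => le_add_of_nonneg_right t.2
  have hall := hC.solves_of_total h s hpath hw hB hN
  refine ContinuousLinearMap.ext fun ξ => ?_
  -- Subtraction is truncated, so `d` vanishes on `[0, s]` because `N 0 = 1`. An equation started at
  -- `s` thus becomes a homogeneous equation started at `0`, to which the uniqueness result applies.
  let d : ℝ≥0 → X := fun q => M (s + (q - s)) ξ - N (q - s) (M s ξ)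
  have hd : Continuous d :=
    ((hcont ξ).comp (continuous_const.add (continuous_id.sub continuous_const))).sub
      ((hNc _).comp (continuous_id.sub continuous_const))
  have hd0 : ∀ q, q ≤ s → d q = 0 := fun q hq => by
    simp only [d, tsub_eq_zero_of_le hq, add_zero, hN0, one_apply_eq_self, sub_self]
  have hz := hC.eq_zero_of_drive_nnreal h hd (fun q p => ?_) (s + t)
  · simp only [d, add_tsub_cancel_left] at hz
    exact sub_eq_zero.1 hz
  have hI := fun {a b : ℝ} (hab : a ≤ b) =>
    hC.intervalIntegrable_drive h (continuous_comp_toNNReal hd) hab p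
  have hzero : ∀ q : ℝ≥0, q ≤ s →
      ∫ r in (0 : ℝ)..q, drive (v p) (f p) C₀ C₁ (fun r => d r.toNNReal) r = 0 := fun q hq => by
    refine (intervalIntegral.integral_congr (g := fun _ => (0 : ℂ)) fun r hr => ?_).trans
      intervalIntegral.integral_zero
    rw [uIcc_of_le q.coe_nonneg] at hr
    simp only [drive, pairing, hd0 _ (Real.toNNReal_le_iff_le_coe.2
      (hr.2.trans (NNReal.coe_le_coe.2 hq))), map_zero, inner_zero_right, add_zero]
  rcases le_total q s with hq | hq
  · rw [hd0 q hq, inner_zero_right, hzero q hq]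
  obtain ⟨r, rfl⟩ := exists_add_of_le hq
  have h1 : ∫ x in (0 : ℝ)..(s + r : ℝ≥0), drive (v p) (f p) C₀ C₁ (fun x => d x.toNNReal) x =
      ∫ x in (s : ℝ)..(s + r : ℝ), drive (v p) (f p) C₀ C₁ (fun x => d x.toNNReal) x := by
    rw [NNReal.coe_add, ← intervalIntegral.integral_add_adjacent_intervals (hI s.coe_nonneg)
      (hI (hst r))]
    exact (congrArg (· + _) (hzero s le_rfl)).trans (zero_add _)
  have hIM := fun {a b : ℝ} (hab : a ≤ b) =>
    hC.intervalIntegrable_drive h (continuous_comp_toNNReal (hcont ξ)) hab p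
  have h2 : ⟪v p, M (s + r) ξ⟫_ℂ = ⟪v p, M s ξ⟫_ℂ +
      ∫ x in (s : ℝ)..(s + r : ℝ), drive (v p) (f p) C₀ C₁ (fun x => M x.toNNReal ξ) x := by
    rw [hM ξ (s + r) p, hM ξ s p, NNReal.coe_add,
      ← intervalIntegral.integral_add_adjacent_intervals (hIM s.coe_nonneg) (hIM (hst r)), add_assoc]
  rw [h1]
  simp only [d, add_tsub_cancel_left]
  rw [inner_sub_right, h2, hall (M s ξ) r p, add_sub_add_left_eq_sub]
  refine (intervalIntegral.integral_sub (hIM (hst r))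
    (hC.intervalIntegrable_drive h (hpath _) (hst r) p)).symm.trans ?_
  refine intervalIntegral.integral_congr fun x hx => ?_
  rw [uIcc_of_le (hst r)] at hx
  have hsx : s ≤ x.toNNReal := NNReal.le_toNNReal_of_coe_le hx.1
  simp only [drive, pairing, add_tsub_cancel_of_le hsx, map_sub, inner_sub_right]
  ring

end IsDriver

end Solution

/-! ### The equation driven by a family of homomorphisms -/

section HomFamily
variable {H K K' X : Type*}
  [NormedAddCommGroup H] [InnerProductSpace ℂ H] [CompleteSpace H]
  [NormedAddCommGroup K] [InnerProductSpace ℂ K] [CompleteSpace K]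
  [NormedAddCommGroup K'] [InnerProductSpace ℂ K'] [CompleteSpace K']
  [NormedAddCommGroup X] [InnerProductSpace ℂ X] [CompleteSpace X]
  {A : VonNeumannAlgebra H} {ψ : ℝ≥0 → A.toStarSubalgebra →ₗ[ℂ] (X →L[ℂ] X)}
  {P : ℝ≥0 → X →L[ℂ] X}

/-- Adapted families of normal `*`-homomorphisms. -/
structure IsHomFamily (ψ : ℝ≥0 → A.toStarSubalgebra →ₗ[ℂ] (X →L[ℂ] X)) (P : ℝ≥0 → X →L[ℂ] X) :
    Prop where
  cb : ∀ s, IsCompletelyBounded A (ψ s)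
  normal : ∀ s, IsNormal A (ψ s)
  mul : ∀ s a b, ψ s (a * b) = ψ s a * ψ s b
  star : ∀ s a, ψ s (star a) = star (ψ s a)
  cont : ∀ a z w, Continuous fun s => ⟪z, ψ s a w⟫_ℂ
  left : ∀ s a, P s ∘L ψ s a = ψ s a
  right : ∀ s a, ψ s a ∘L P s = ψ s a

/-- The upper coefficient `j_s(E^ω c)`. -/
def coeff₀ (ψ : ℝ≥0 → A.toStarSubalgebra →ₗ[ℂ] (X →L[ℂ] X)) (c : H →L[ℂ] K' ⊗ₕ H) (ω : K')
    (s : ℝ) : X →L[ℂ] X := braE ω ∘L column (ψ s.toNNReal) c ω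

/-- The lower coefficient. -/
def coeff₁ (ψ : ℝ≥0 → A.toStarSubalgebra →ₗ[ℂ] (X →L[ℂ] X)) (c : H →L[ℂ] K' ⊗ₕ H) (ω : K')
    (inc : K →L[ℂ] K') (s : ℝ) : X →L[ℂ] K ⊗ₕ X :=
  (hmap inc (1 : X →L[ℂ] X)).adjoint ∘L column (ψ s.toNNReal) c ω

theorem adjoint_hmap_one (inc : K →L[ℂ] K') :
    (hmap inc (1 : X →L[ℂ] X)).adjoint = hmap inc.adjoint (1 : X →L[ℂ] X) := by
  have h1 : (1 : X →L[ℂ] X).adjoint = 1 := star_one (X →L[ℂ] X)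
  rw [adjoint_hmap, h1]

theorem hmap_comm_one (inc : K →L[ℂ] K') (b : X →L[ℂ] X) :
    hmap (1 : K' →L[ℂ] K') b ∘L hmap inc 1 = hmap inc 1 ∘L hmap (1 : K →L[ℂ] K) b := by
  rw [hmap_comp, hmap_comp]
  rfl

variable {c : H →L[ℂ] K' ⊗ₕ H} {ω : K'} {inc : K →L[ℂ] K'} (hψ : IsHomFamily ψ P) (hω : ‖ω‖ = 1)
  (hc : ∀ x, braE x ∘L c ∈ A.toStarSubalgebra)
include hψ hω

include hc in
theorem IsHomFamily.isAdaptedDriver (hinc : ‖inc‖ ≤ 1) :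
    IsAdaptedDriver (fun s => P s.toNNReal) (coeff₀ ψ c ω) (coeff₁ ψ c ω inc) ‖c‖ where
  nonneg := norm_nonneg _
  cont₀ ξ := (braE ω).continuous.comp (continuous_comp_toNNReal
    (continuous_iff_continuousAt.2 fun s => tendsto_column hω hc hψ.cb hψ.normal hψ.mul hψ.star
      (fun a z w => (hψ.cont a z w).tendsto s) ξ))
  cont₁ ξ := (hmap inc (1 : X →L[ℂ] X)).adjoint.continuous.comp (continuous_comp_toNNReal
    (continuous_iff_continuousAt.2 fun s => tendsto_column hω hc hψ.cb hψ.normal hψ.mul hψ.star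
      (fun a z w => (hψ.cont a z w).tendsto s) ξ))
  norm₀ s := by
    refine (ContinuousLinearMap.opNorm_comp_le _ _).trans ?_
    refine (mul_le_mul ((norm_braE_le ω).trans_eq hω) (norm_column_le hω hc (hψ.cb _)
      (hψ.normal _) (hψ.mul _) (hψ.star _)) (norm_nonneg _) zero_le_one).trans_eq (one_mul _)
  norm₁ s := by
    refine (ContinuousLinearMap.opNorm_comp_le _ _).trans ?_
    refine (mul_le_mul (b := 1) ?_ (norm_column_le hω hc (hψ.cb _)
      (hψ.normal _) (hψ.mul _) (hψ.star _)) (norm_nonneg _) zero_le_one).trans_eq (one_mul _)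
    rw [LinearIsometryEquiv.norm_map]
    exact (norm_hmap_le _ _).trans
      (mul_le_one₀ hinc (norm_nonneg _) ContinuousLinearMap.norm_id_le)
  adapted s ξ := by
    have h1 := congrArg (fun T : _ →L[ℂ] _ => T (column (ψ s.toNNReal) c ω ξ))
      (hmap_comm_one inc.adjoint (P s.toNNReal))
    have h2 := congrArg (fun T : _ →L[ℂ] _ => T ξ)
      (proj_comp_column hω hc (hψ.cb s.toNNReal) (hψ.left s.toNNReal))
    simp only [ContinuousLinearMap.comp_apply] at h1 h2
    simp only [coeff₁, adjoint_hmap_one, ContinuousLinearMap.comp_apply]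
    rw [h1, h2]
  proj₀ s ξ := by
    have h1 := congrArg (fun T : _ →L[ℂ] _ => T (column (ψ s.toNNReal) c ω ξ))
      (braE_comp_hmap_one (P s.toNNReal) ω)
    have h2 := congrArg (fun T : _ →L[ℂ] _ => T ξ)
      (proj_comp_column hω hc (hψ.cb s.toNNReal) (hψ.left s.toNNReal))
    simp only [ContinuousLinearMap.comp_apply] at h1 h2
    simp only [coeff₀, ContinuousLinearMap.comp_apply]
    rw [← h1, h2]
  comp₀ s ξ := by
    have h2 := congrArg (fun T : _ →L[ℂ] _ => T ξ)
      (column_comp_proj hω hc (hψ.cb s.toNNReal) (hψ.right s.toNNReal))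
    simp only [ContinuousLinearMap.comp_apply] at h2
    simp only [coeff₀, ContinuousLinearMap.comp_apply, h2]
  comp₁ s ξ := by
    have h2 := congrArg (fun T : _ →L[ℂ] _ => T ξ)
      (column_comp_proj hω hc (hψ.cb s.toNNReal) (hψ.right s.toNNReal))
    simp only [ContinuousLinearMap.comp_apply] at h2
    simp only [coeff₁, ContinuousLinearMap.comp_apply, h2]

/-- The two coefficients recombine into `ψ_s` evaluated at the single element `E^{ω + g(s)} c` of
the algebra. In this form multiplicative maps and the cocycle relation can act on the integrand. -/
theorem IsHomFamily.drive_eq (v : X) (g : ℝ → K) (w : ℝ → X) (s : ℝ) :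
    drive v g (coeff₀ ψ c ω) (coeff₁ ψ c ω inc) w s =
      ⟪v, ψ s.toNNReal ⟨braE (ω + inc (g s)) ∘L c, hc _⟩ (w s)⟫_ℂ := by
  rw [← braE_comp_column hω hc (hψ.cb _), ContinuousLinearMap.comp_apply, inner_braE,
    htmul_add_left, inner_add_left, ← inner_braE]
  simp only [drive, pairing, coeff₀, coeff₁, ContinuousLinearMap.comp_apply]
  rw [ContinuousLinearMap.adjoint_inner_right, hmap_htmul, one_apply_eq_self]

include hc in
theorem IsHomFamily.coeff_commute {b : X →L[ℂ] X} (hb : ∀ s a, ψ s a ∘L b = b ∘L ψ s a) (s : ℝ)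
    (ξ : X) : coeff₀ ψ c ω s (b ξ) = b (coeff₀ ψ c ω s ξ) ∧
      coeff₁ ψ c ω inc s (b ξ) = hmap (1 : K →L[ℂ] K) b (coeff₁ ψ c ω inc s ξ) := by
  have h0 := congrArg (fun T : _ →L[ℂ] _ => T ξ)
    (column_comp_of_commute hω hc (hψ.cb s.toNNReal) (hb s.toNNReal))
  have h1 := congrArg (fun T : _ →L[ℂ] _ => T (column (ψ s.toNNReal) c ω ξ))
    (braE_comp_hmap_one b ω)
  have h2 := congrArg (fun T : _ →L[ℂ] _ => T (column (ψ s.toNNReal) c ω ξ))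
    (hmap_comm_one inc.adjoint b)
  simp only [ContinuousLinearMap.comp_apply] at h0 h1 h2
  simp only [coeff₀, coeff₁, adjoint_hmap_one, ContinuousLinearMap.comp_apply]
  exact ⟨by rw [h0, h1], by rw [h0, h2]⟩

end HomFamily

/-! ### Normal maps and integrals -/

section NormalIntegral
variable {F H Y : Type*}
  [NormedAddCommGroup F] [InnerProductSpace ℂ F] [CompleteSpace F]
  [NormedAddCommGroup H] [InnerProductSpace ℂ H] [CompleteSpace H]
  [NormedAddCommGroup Y] [InnerProductSpace ℂ Y] [CompleteSpace Y]
  {A : VonNeumannAlgebra H} {φ : A.toStarSubalgebra →ₗ[ℂ] (Y →L[ℂ] Y)}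

/-- Normal maps commute with weak integrals. -/
theorem IsNormal.inner_apply_eq_integral (hφ : IsNormal A φ) {a : A.toStarSubalgebra}
    {R : ℝ → A.toStarSubalgebra} {t : ℝ} (ht : 0 ≤ t) {ρ : ℝ → ℝ}
    (hρ : IntervalIntegrable ρ volume 0 t)
    (hm : ∀ ξ η, AEStronglyMeasurable (fun r => ⟪ξ, (R r : H →L[ℂ] H) η⟫_ℂ)
      (volume.restrict (Ioc 0 t)))
    (hb : ∀ r ∈ Ioc 0 t, ‖(R r : H →L[ℂ] H)‖ ≤ ρ r)
    (ha : ∀ ξ η, ⟪ξ, (a : H →L[ℂ] H) η⟫_ℂ = ∫ r in (0 : ℝ)..t, ⟪ξ, (R r : H →L[ℂ] H) η⟫_ℂ)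
    (u w : Y) : ⟪u, φ a w⟫_ℂ = ∫ r in (0 : ℝ)..t, ⟪u, φ (R r) w⟫_ℂ := by
  -- Normality writes the functional as a series of vector functionals. Each term commutes with the
  -- weak integral by hypothesis, and dominated convergence allows summation.
  obtain ⟨ξ, η, h1, h2, h3⟩ := hφ.exists_hasSum A u w
  have hs := summable_norm_mul_norm h1 h2
  have hsum := intervalIntegral.hasSum_integral_of_dominated_convergence (a := 0) (b := t)
    (μ := volume) (F := fun n r => ⟪ξ n, (R r : H →L[ℂ] H) (η n)⟫_ℂ)
    (f := fun r => ⟪u, φ (R r) w⟫_ℂ) (fun n r => ρ r * (‖ξ n‖ * ‖η n‖))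
    (fun n => by rw [uIoc_of_le ht]; exact hm _ _)
    (fun n => Eventually.of_forall fun r hr => by
      rw [uIoc_of_le ht] at hr
      refine (norm_inner_le_norm _ _).trans ?_
      rw [mul_left_comm]
      exact mul_le_mul_of_nonneg_left (ContinuousLinearMap.le_of_opNorm_le _ (hb r hr) _)
        (norm_nonneg _))
    (Eventually.of_forall fun r _ => hs.mul_left _)
    (by simp only [tsum_mul_left]; exact hρ.mul_const _)
    (Eventually.of_forall fun r _ => h3 (R r))
  simp only [← ha] at hsum
  exact (h3 a).unique hsum

end NormalIntegral

/-! ### The multiplier property -/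

section Multiplier
variable {F H K K' Y Z ι : Type*}
  [NormedAddCommGroup F] [InnerProductSpace ℂ F] [CompleteSpace F]
  [NormedAddCommGroup H] [InnerProductSpace ℂ H] [CompleteSpace H]
  [NormedAddCommGroup K] [InnerProductSpace ℂ K] [CompleteSpace K]
  [NormedAddCommGroup K'] [InnerProductSpace ℂ K'] [CompleteSpace K']
  [NormedAddCommGroup Y] [InnerProductSpace ℂ Y] [CompleteSpace Y]
  [NormedAddCommGroup Z] [InnerProductSpace ℂ Z] [CompleteSpace Z]
  {A : VonNeumannAlgebra H} {ψ : ℝ≥0 → A.toStarSubalgebra →ₗ[ℂ] (F ⊗ₕ H →L[ℂ] F ⊗ₕ H)}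
  {P : ℝ≥0 → F ⊗ₕ H →L[ℂ] F ⊗ₕ H} {v : ι → F ⊗ₕ H} {f : ι → ℝ → K} {κ : ι → ι → ℂ}
  {c : H →L[ℂ] K' ⊗ₕ H} {ω : K'} {inc : K →L[ℂ] K'}
  {φ : A.toStarSubalgebra →ₗ[ℂ] (Y →L[ℂ] Y)}

/-- This supplies the integrable majorant needed to take a normal map through the integral of the
equation. -/
theorem norm_braE_comp_le (hω : ‖ω‖ = 1) (hinc : ‖inc‖ ≤ 1) (x : K) :
    ‖braE (ω + inc x) ∘L c‖ ≤ (1 + ‖x‖) * ‖c‖ := by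
  refine (ContinuousLinearMap.opNorm_comp_le _ _).trans
    (mul_le_mul_of_nonneg_right ((norm_braE_le _).trans ?_) (norm_nonneg _))
  refine (norm_add_le _ _).trans (add_le_add hω.le ?_)
  simpa using inc.le_of_opNorm_le hinc x

/-- Time shifts of solutions. If `J` is the lifted shift for time `s` then `J(M_t)` solves the
equation started at time `s`. -/
theorem liftedShift_solves (hψ : IsHomFamily ψ P)
    (hmem : ∀ s a, ψ s a ∈ opTensor F (A : Set (H →L[ℂ] H)))
    (h : IsExpFrame (fun s => P s.toNNReal) v f κ) (hω : ‖ω‖ = 1)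
    (hc : ∀ x, braE x ∘L c ∈ A.toStarSubalgebra) (hinc : ‖inc‖ ≤ 1)
    (U : Z ⊗ₕ Y ≃ₗᵢ[ℂ] F ⊗ₕ H) (S : F ≃ₗᵢ[ℂ] Z)
    (hcb : IsCompletelyBounded A φ) (hn : IsNormal A φ) (hm : ∀ a b, φ (a * b) = φ a * φ b)
    (h1 : φ 1 = 1) (s : ℝ≥0) (hcoc : ∀ r a, ψ (s + r) a = liftedShift U S φ (ψ r a))
    {M : ℝ≥0 → F ⊗ₕ H →L[ℂ] F ⊗ₕ H} (hMmem : ∀ t, M t ∈ opTensor F (A : Set (H →L[ℂ] H)))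
    (hcont : ∀ ξ, Continuous fun t => M t ξ) {B : ℝ≥0 → ℝ} (hB : ∀ t r, r ≤ t → ‖M r‖ ≤ B t)
    (hM : ∀ ξ, SolvesAt v f (coeff₀ ψ c ω) (coeff₁ ψ c ω inc) M ξ)
    (x y : F) (u w : Y) (p : ι) (hp : v p = U (htmul (S x) u)) (g : ℝ → K)
    (hg : ∀ᵐ r ∂volume, 0 < r → g r = f p (s + r))
    (hx : ∀ ξ : H, ∃ p', v p' = htmul x ξ ∧ f p' = g) (t : ℝ≥0) :
    ⟪v p, liftedShift U S φ (M t) (U (htmul (S y) w))⟫_ℂ = ⟪v p, U (htmul (S y) w)⟫_ℂ +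
      ∫ r in (s : ℝ)..(s + t : ℝ), drive (v p) (f p) (coeff₀ ψ c ω) (coeff₁ ψ c ω inc)
        (fun r => liftedShift U S φ (M (r.toNNReal - s)) (U (htmul (S y) w))) r := by
  set η := U (htmul (S y) w) with hη
  have ht : (0 : ℝ) ≤ t := t.2
  have hC := hψ.isAdaptedDriver hω hc hinc
  let a : ℝ → A.toStarSubalgebra := fun r => ⟨braE (ω + inc (g r)) ∘L c, hc _⟩
  -- The equation, tested against `x ⊗ ξ` for all `ξ`, says that the slice of `M t - 1` is the weak
  -- integral of the slices of `R`. The function `g` belongs to `x` alone, so it is the same for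
  -- every `ξ`.
  let R : ℝ → F ⊗ₕ H →L[ℂ] F ⊗ₕ H := fun r => ψ r.toNNReal (a r) ∘L M r.toNNReal
  have hR : ∀ r, R r ∈ opTensor F (A : Set (H →L[ℂ] H)) := fun r =>
    comp_mem_opTensor A (hmem _ _) (hMmem _)
  have hT : M t - 1 ∈ opTensor F (A : Set (H →L[ℂ] H)) :=
    sub_mem_opTensor A (hMmem t) (one_mem_opTensor A)
  have hslice : ∀ ξ ζ r, ⟪ξ, (braE x ∘L R r ∘L ketE y) ζ⟫_ℂ =
      drive (htmul x ξ) g (coeff₀ ψ c ω) (coeff₁ ψ c ω inc)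
        (fun r => M r.toNNReal (htmul y ζ)) r := fun ξ ζ r => by
    rw [hψ.drive_eq hω hc, ContinuousLinearMap.comp_apply, inner_braE]
    rfl
  -- Any choice of `ξ` in `hx`, here `0`, exhibits `g` as one of the frame functions.
  have hgmem : MemLp g 2 volume := by
    obtain ⟨p', -, h2⟩ := hx 0
    exact h2 ▸ h.memLp p'
  -- Normality of `φ` takes it inside the weak integral of slices; no continuity of `r ↦ R r` is
  -- required.
  have key : ⟪u, φ ⟨braE x ∘L (M t - 1) ∘L ketE y, (mem_opTensor_iff_slices A).1 hT x y⟩ w⟫_ℂ =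
      ∫ r in (0 : ℝ)..t,
        ⟪u, φ ⟨braE x ∘L R r ∘L ketE y, (mem_opTensor_iff_slices A).1 (hR r) x y⟩ w⟫_ℂ := by
    refine hn.inner_apply_eq_integral ht (R := fun r => ⟨braE x ∘L R r ∘L ketE y, _⟩)
      (ρ := fun r => ‖x‖ * ((1 + ‖g r‖) * ‖c‖ * B t * ‖y‖)) ?_ (fun ξ ζ => ?_)
      (fun r hr => ?_) (fun ξ ζ => ?_) u w
    · refine IntervalIntegrable.const_mul (IntervalIntegrable.mul_const
        (IntervalIntegrable.mul_const (IntervalIntegrable.mul_const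
        (intervalIntegrable_const.add ?_) _) _) _) _
      rw [intervalIntegrable_iff_integrableOn_Ioc_of_le ht]
      exact (hgmem.restrict _).norm.integrable (by norm_num)
    · obtain ⟨p', h2, h3⟩ := hx ξ
      simp only [hslice, ← h2, ← h3]
      exact (hC.intervalIntegrable_drive h (continuous_comp_toNNReal (hcont _)) ht p').1.1
    · have hrt : r.toNNReal ≤ t := Real.toNNReal_le_iff_le_coe.2 hr.2
      have hB0 : 0 ≤ B t := (norm_nonneg _).trans (hB t _ hrt)
      refine (ContinuousLinearMap.opNorm_comp_le _ _).trans (mul_le_mul (norm_braE_le x) ?_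
        (norm_nonneg _) (norm_nonneg _))
      refine (ContinuousLinearMap.opNorm_comp_le _ _).trans (mul_le_mul ?_ (norm_ketE_le y)
        (norm_nonneg _) (by positivity))
      refine (ContinuousLinearMap.opNorm_comp_le _ _).trans (mul_le_mul ?_ (hB t _ hrt)
        (norm_nonneg _) (by positivity))
      exact (norm_apply_le_of_starHom (hψ.mul _) (hψ.star _) _).trans
        (norm_braE_comp_le hω hinc _)
    · obtain ⟨p', h2, h3⟩ := hx ξ
      change ⟪ξ, braE x ((M t - 1) (htmul y ζ))⟫_ℂ = ∫ r in (0 : ℝ)..t,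
        ⟪ξ, (braE x ∘L R r ∘L ketE y) ζ⟫_ℂ
      simp only [hslice, ← h3]
      rw [inner_braE, ← h2, sub_apply, one_apply_eq_self, inner_sub_right, hM _ t p',
        add_sub_cancel_left]
  have e1 : ⟪v p, liftedShift U S φ (M t) η⟫_ℂ = ⟪v p, η⟫_ℂ +
      ∫ r in (0 : ℝ)..t, ⟪v p, liftedShift U S φ (R r) η⟫_ℂ := by
    have e2 := inner_liftedShift U S hcb hT x y u w
    rw [key, liftedShift_sub U S hcb (hMmem t) (one_mem_opTensor A), liftedShift_one U S h1,
      sub_apply, one_apply_eq_self, inner_sub_right, ← hp, ← hη] at e2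
    rw [sub_eq_iff_eq_add'.1 e2]
    congr 1
    refine intervalIntegral.integral_congr fun r _ => ?_
    have e4 := inner_liftedShift U S hcb (hR r) x y u w
    rw [← hp, ← hη] at e4
    exact e4.symm
  rw [e1]
  congr 1
  have e3 : ∫ r in (s : ℝ)..(s + t : ℝ), drive (v p) (f p) (coeff₀ ψ c ω) (coeff₁ ψ c ω inc)
        (fun r => liftedShift U S φ (M (r.toNNReal - s)) η) r =
      ∫ r in (0 : ℝ)..t, drive (v p) (f p) (coeff₀ ψ c ω) (coeff₁ ψ c ω inc)
        (fun r => liftedShift U S φ (M (r.toNNReal - s)) η) (s + r) := by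
    rw [intervalIntegral.integral_comp_add_left, add_zero]
  rw [e3]
  refine intervalIntegral.integral_congr_ae ?_
  filter_upwards [hg] with r hgr hr
  rw [uIoc_of_le ht] at hr
  have hsr : ((s : ℝ) + r).toNNReal = s + r.toNNReal := by
    rw [Real.toNNReal_add s.coe_nonneg hr.1.le, Real.toNNReal_coe]
  -- With `J` the lifted shift, `J(ψ_r(a) M_r) = ψ_{s+r}(a) J(M_r)` by multiplicativity and the
  -- cocycle relation. This is the integrand of the equation at time `s + r`.
  rw [hψ.drive_eq hω hc, hsr, hcoc, add_tsub_cancel_left,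
    liftedShift_comp U S hcb hn hm (hmem _ _) (hMmem _)]
  simp only [a, hgr hr.1]
  rfl

/-- The family `t ↦ J(M_t)`, with `J` the lifted shift, is strongly continuous and solves the
equation from time `s` on a total set of vectors, so it must be the transition operator of `M`. -/
theorem solution_cocycle (hψ : IsHomFamily ψ P)
    (hmem : ∀ s a, ψ s a ∈ opTensor F (A : Set (H →L[ℂ] H)))
    (h : IsExpFrame (fun s => P s.toNNReal) v f κ) (hω : ‖ω‖ = 1)
    (hc : ∀ x, braE x ∘L c ∈ A.toStarSubalgebra) (hinc : ‖inc‖ ≤ 1)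
    (U : Z ⊗ₕ Y ≃ₗᵢ[ℂ] F ⊗ₕ H) (S : F ≃ₗᵢ[ℂ] Z)
    (hcb : IsCompletelyBounded A φ) (hn : IsNormal A φ) (hm : ∀ a b, φ (a * b) = φ a * φ b)
    (hs : ∀ a, φ (star a) = star (φ a))
    (h1 : φ 1 = 1) (s : ℝ≥0) (hcoc : ∀ r a, ψ (s + r) a = liftedShift U S φ (ψ r a))
    {M : ℝ≥0 → F ⊗ₕ H →L[ℂ] F ⊗ₕ H} (hM0 : M 0 = 1)
    (hMmem : ∀ t, M t ∈ opTensor F (A : Set (H →L[ℂ] H)))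
    (hcont : ∀ ξ, Continuous fun t => M t ξ) {B : ℝ≥0 → ℝ} (hB : ∀ t r, r ≤ t → ‖M r‖ ≤ B t)
    (hM : ∀ ξ, SolvesAt v f (coeff₀ ψ c ω) (coeff₁ ψ c ω inc) M ξ)
    (hv : ∀ p, ∃ (x : F) (u : Y) (g : ℝ → K), v p = U (htmul (S x) u) ∧
      (∀ᵐ r ∂volume, 0 < r → g r = f p (s + r)) ∧
      ∀ ξ : H, ∃ p', v p' = htmul x ξ ∧ f p' = g) (t : ℝ≥0) :
    M (s + t) = liftedShift U S φ (M t) ∘L M s := by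
  obtain ⟨C, hC0, hC⟩ := exists_norm_liftedShift_le U S hcb
  refine (hψ.isAdaptedDriver hω hc hinc).solution_evolution h hcont hM s
    (N := fun t => liftedShift U S φ (M t)) ?_ (fun η => ?_) (total_shifted_htmul U S)
    (B := fun t => C * B t) (fun t r hr => (hC _ (hMmem r)).trans
      (mul_le_mul_of_nonneg_left (hB t r hr) hC0)) (fun q t p => ?_) t
  · simp only [hM0, liftedShift_one U S h1]
  · refine continuous_iff_continuousAt.2 fun t => ?_
    -- The lifted shift is strongly continuous only along bounded nets; near `t` the norms are
    -- bounded by `B (t + 1)`.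
    refine tendsto_liftedShift U S hcb hn hm hs hMmem (hMmem t) (B := B (t + 1)) ?_
      (fun ξ => (hcont ξ).tendsto t) η
    filter_upwards [Iic_mem_nhds (lt_add_one t)] with r hr
    exact hB _ _ hr
  · obtain ⟨x, u, g, hp, hg, hx⟩ := hv p
    exact liftedShift_solves hψ hmem h hω hc hinc U S hcb hn hm h1 s hcoc hMmem hcont hB hM
      x q.1 u q.2 p hp g hg hx t

end Multiplier

/-! ### The integrand of the equation -/

section Integrand
variable {H K K' X Y : Type*}
  [NormedAddCommGroup H] [InnerProductSpace ℂ H] [CompleteSpace H]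
  [NormedAddCommGroup K] [InnerProductSpace ℂ K] [CompleteSpace K]
  [NormedAddCommGroup K'] [InnerProductSpace ℂ K'] [CompleteSpace K']
  [NormedAddCommGroup X] [InnerProductSpace ℂ X] [CompleteSpace X]
  [NormedAddCommGroup Y] [NormedSpace ℂ Y]
  {A : VonNeumannAlgebra H}

/-- The operator norm is a supremum of continuous functions. This gives measurability of the norm
functions without any separability. -/
theorem lowerSemicontinuous_opNorm {T : ℝ → X →L[ℂ] Y} (hT : ∀ x, Continuous fun s => T s x) :
    LowerSemicontinuous fun s => ‖T s‖ := by
  intro s a ha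
  rcases lt_or_ge a 0 with h0 | h0
  · exact Eventually.of_forall fun r => h0.trans_le (norm_nonneg _)
  · obtain ⟨x, hx⟩ : ∃ x, a * ‖x‖ < ‖T s x‖ := by
      by_contra! hcon
      exact absurd ((T s).opNorm_le_bound h0 hcon) (not_le.2 ha)
    filter_upwards [((hT x).norm.tendsto s).eventually (lt_mem_nhds hx)] with r hr
    exact lt_of_mul_lt_mul_right (hr.trans_le ((T r).le_opNorm x)) (norm_nonneg _)

theorem memLp_opNorm {T : ℝ → X →L[ℂ] Y} (hT : ∀ x, Continuous fun s => T s x) {a b B : ℝ}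
    (hB : ∀ s ∈ Ico a b, ‖T s‖ ≤ B) (p : ENNReal) :
    MemLp (fun s => ‖T s‖) p (volume.restrict (Ico a b)) := by
  refine MemLp.of_bound (lowerSemicontinuous_opNorm hT).measurable.aestronglyMeasurable B ?_
  refine (ae_restrict_iff' measurableSet_Ico).2 (Eventually.of_forall fun s hs => ?_)
  rw [norm_norm]
  exact hB s hs

theorem smul_mem_opTensor {T : K ⊗ₕ H →L[ℂ] K ⊗ₕ H} (a : ℂ)
    (hT : T ∈ opTensor K (A : Set (H →L[ℂ] H))) : a • T ∈ opTensor K (A : Set (H →L[ℂ] H)) := by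
  rw [mem_opTensor_iff_commute] at *
  intro a' ha'
  rw [ContinuousLinearMap.smul_comp, hT a' ha', ContinuousLinearMap.comp_smul]

variable {ψ : A.toStarSubalgebra →ₗ[ℂ] (X →L[ℂ] X)} {c : H →L[ℂ] K' ⊗ₕ H} {ω : K'}
  {inc : K →L[ℂ] K'}

section
variable (hω : ‖ω‖ = 1) (hc : ∀ x, braE x ∘L c ∈ A.toStarSubalgebra)
  (hcb : IsCompletelyBounded A ψ) (M : X →L[ℂ] X)
include hω hc hcb

theorem ampliate_comp_hmap : ampliate A ψ (c ∘L braE ω) ∘L hmap (1 : K' →L[ℂ] K') M =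
    column ψ c ω ∘L M ∘L braE ω := by
  rw [ampliate_eq_column hω hc hcb, ContinuousLinearMap.comp_assoc, braE_comp_hmap_one]

theorem slice_integrand (x y : K') :
    braE x ∘L (ampliate A ψ (c ∘L braE ω) ∘L hmap (1 : K' →L[ℂ] K') M) ∘L ketE y =
      ⟪ω, y⟫_ℂ • (ψ ⟨braE x ∘L c, hc x⟩ ∘L M) := by
  rw [ampliate_comp_hmap hω hc hcb, ← braE_comp_column hω hc hcb]
  calc _ = (braE x ∘L column ψ c ω) ∘L M ∘L (braE ω ∘L ketE y) := rfl
    _ = _ := by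
      rw [braE_comp_ketE, ContinuousLinearMap.comp_smul, ContinuousLinearMap.comp_smul]
      rfl

theorem integrand_comp_ketE :
    (ampliate A ψ (c ∘L braE ω) ∘L hmap (1 : K' →L[ℂ] K') M) ∘L ketE ω = column ψ c ω ∘L M := by
  rw [ampliate_comp_hmap hω hc hcb]
  calc _ = column ψ c ω ∘L M ∘L (braE ω ∘L ketE ω) := rfl
    _ = _ := by
      rw [braE_comp_ketE, inner_self_of_norm_one hω, one_smul]
      rfl

/-- The range of `inc` is orthogonal to `ω`, so the right-hand blocks `m` and `n` of the integrand
vanish. -/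
theorem integrand_comp_incl (hinc : inc.adjoint ω = 0) :
    (ampliate A ψ (c ∘L braE ω) ∘L hmap (1 : K' →L[ℂ] K') M) ∘L hmap inc (1 : X →L[ℂ] X) = 0 := by
  rw [ampliate_comp_hmap hω hc hcb]
  have h0 : (braE (0 : K) : K ⊗ₕ X →L[ℂ] X) = 0 := by
    have := braE_smul (H := X) (0 : ℂ) (0 : K)
    rwa [zero_smul, star_zero, zero_smul] at this
  calc _ = column ψ c ω ∘L M ∘L (braE ω ∘L hmap inc (1 : X →L[ℂ] X)) := rfl
    _ = 0 := by
      rw [braE_comp_hmap, hinc, h0, ContinuousLinearMap.comp_zero, ContinuousLinearMap.comp_zero,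
        ContinuousLinearMap.comp_zero]

/-- Writing `M = 1 + (M - 1)`, the column absorbs `P` on the identity part and `M - 1` absorbs it on
the other, although `M` itself is not vacuum adapted. -/
theorem integrand_adapted {P : X →L[ℂ] X} (hl : ∀ a, P ∘L ψ a = ψ a) (hr : ∀ a, ψ a ∘L P = ψ a)
    (hM : (M - 1) ∘L P = M - 1) :
    ampliate A ψ (c ∘L braE ω) ∘L hmap (1 : K' →L[ℂ] K') M = hmap (1 : K' →L[ℂ] K') P ∘L
      (ampliate A ψ (c ∘L braE ω) ∘L hmap (1 : K' →L[ℂ] K') M) ∘L hmap (1 : K' →L[ℂ] K') P := by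
  rw [ampliate_comp_hmap hω hc hcb]
  have h1 : column ψ c ω ∘L M ∘L P = column ψ c ω ∘L M := by
    have h2 : M ∘L P = P + (M - 1) := by
      rw [← hM]
      refine ContinuousLinearMap.ext fun x => ?_
      simp
    rw [h2, ContinuousLinearMap.comp_add, column_comp_proj hω hc hcb hr,
      ContinuousLinearMap.comp_sub]
    refine ContinuousLinearMap.ext fun x => ?_
    simp
  calc column ψ c ω ∘L M ∘L braE ω = (column ψ c ω ∘L M ∘L P) ∘L braE ω := by rw [h1]; rfl
    _ = (hmap (1 : K' →L[ℂ] K') P ∘L column ψ c ω) ∘L M ∘L P ∘L braE ω := by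
      rw [proj_comp_column hω hc hcb hl]
      rfl
    _ = hmap (1 : K' →L[ℂ] K') P ∘L column ψ c ω ∘L M ∘L
        (braE ω ∘L hmap (1 : K' →L[ℂ] K') P) := by rw [braE_comp_hmap_one]; rfl
    _ = _ := rfl

end

theorem inner_integrand {ψ : ℝ≥0 → A.toStarSubalgebra →ₗ[ℂ] (X →L[ℂ] X)} {P : ℝ≥0 → X →L[ℂ] X}
    (hψ : IsHomFamily ψ P) (hω : ‖ω‖ = 1) (hc : ∀ x, braE x ∘L c ∈ A.toStarSubalgebra)
    (M : ℝ≥0 → X →L[ℂ] X) (v w : X) (g : ℝ → K) (s : ℝ) {y : K'} (hy : ⟪ω, y⟫_ℂ = 1) :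
    ⟪v, (braE (ω + inc (g s)) ∘L (ampliate A (ψ s.toNNReal) (c ∘L braE ω) ∘L
      hmap (1 : K' →L[ℂ] K') (M s.toNNReal)) ∘L ketE y) w⟫_ℂ =
      drive v g (coeff₀ ψ c ω) (coeff₁ ψ c ω inc) (fun s => M s.toNNReal w) s := by
  rw [slice_integrand hω hc (hψ.cb _), hy, one_smul, hψ.drive_eq hω hc]
  rfl

end Integrand

/-! ### Families of homomorphisms from adapted families -/

section Adapted
variable {H K Y X : Type*}
  [NormedAddCommGroup H] [InnerProductSpace ℂ H] [CompleteSpace H]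
  [NormedAddCommGroup K] [InnerProductSpace ℂ K]
  [NormedAddCommGroup Y] [InnerProductSpace ℂ Y] [CompleteSpace Y]
  [NormedAddCommGroup X] [InnerProductSpace ℂ X] [CompleteSpace X]
  {A : VonNeumannAlgebra H} (U : K ⊗ₕ Y ≃ₗᵢ[ℂ] X) {Ω : K} (hΩ : ‖Ω‖ = 1)

theorem compression_unitKet (ψ : A.toStarSubalgebra →ₗ[ℂ] (X →L[ℂ] X)) (a : A.toStarSubalgebra) :
    compression (unitKet U Ω hΩ) ψ a = braE Ω ∘L conjBy U.symm (ψ a) ∘L ketE Ω := by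
  rw [compression_apply, adjoint_unitKet]
  rfl

theorem conjBy_vacuum : conjBy U (hmap (InnerProductSpace.rankOne ℂ Ω Ω) (1 : Y →L[ℂ] Y)) =
    (unitKet U Ω hΩ).toContinuousLinearMap ∘L (unitKet U Ω hΩ).toContinuousLinearMap.adjoint := by
  rw [conjBy_hmap_rankOne U Ω hΩ]
  rfl

include hΩ in
theorem adjoint_conjBy_vacuum :
    (conjBy U (hmap (InnerProductSpace.rankOne ℂ Ω Ω) (1 : Y →L[ℂ] Y))).adjoint =
      conjBy U (hmap (InnerProductSpace.rankOne ℂ Ω Ω) (1 : Y →L[ℂ] Y)) := by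
  rw [conjBy_vacuum U hΩ, ContinuousLinearMap.adjoint_comp, ContinuousLinearMap.adjoint_adjoint]

include hΩ in
theorem norm_conjBy_vacuum_le (x : X) :
    ‖conjBy U (hmap (InnerProductSpace.rankOne ℂ Ω Ω) (1 : Y →L[ℂ] Y)) x‖ ≤ ‖x‖ := by
  rw [conjBy_vacuum U hΩ, ContinuousLinearMap.comp_apply]
  change ‖unitKet U Ω hΩ _‖ ≤ _
  rw [LinearIsometry.norm_map]
  refine (ContinuousLinearMap.le_of_opNorm_le (c := 1) _ ?_ x).trans_eq (one_mul _)
  rw [LinearIsometryEquiv.norm_map]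
  exact LinearIsometry.norm_toContinuousLinearMap_le _

variable {ψ : A.toStarSubalgebra →ₗ[ℂ] (X →L[ℂ] X)} {L : A.toStarSubalgebra → (Y →L[ℂ] Y)}
  (hL : ∀ a, L a = braE Ω ∘L conjBy U.symm (ψ a) ∘L ketE Ω)
  (had : ∀ a, ψ a = conjBy U (hmap (InnerProductSpace.rankOne ℂ Ω Ω) (L a)))
include hΩ hL had

/-- Vacuum adaptedness says that `ψ` is its compression along `w ↦ U (Ω ⊗ w)`, extended by zero; the
algebraic laws of the local part then transfer to `ψ`. -/
theorem apply_eq_of_adapted (a : A.toStarSubalgebra) : ψ a =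
    (unitKet U Ω hΩ).toContinuousLinearMap ∘L compression (unitKet U Ω hΩ) ψ a ∘L
      (unitKet U Ω hΩ).toContinuousLinearMap.adjoint := by
  rw [compression_unitKet, ← hL, ← conjBy_hmap_rankOne, ← had]

theorem map_mul_of_adapted (hm : ∀ a b, L (a * b) = L a * L b) (a b : A.toStarSubalgebra) :
    ψ (a * b) = ψ a * ψ b :=
  apply_mul_of_compression (unitKet U Ω hΩ) (apply_eq_of_adapted U hΩ hL had)
    (fun a b => by simp only [compression_unitKet, ← hL, hm]) a b

theorem map_star_of_adapted (hs : ∀ a, L (star a) = star (L a)) (a : A.toStarSubalgebra) :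
    ψ (star a) = star (ψ a) :=
  apply_star_of_compression (unitKet U Ω hΩ) (apply_eq_of_adapted U hΩ hL had)
    (fun a => by simp only [compression_unitKet, ← hL, hs]) a

theorem vacuum_comp_of_adapted (a : A.toStarSubalgebra) :
    conjBy U (hmap (InnerProductSpace.rankOne ℂ Ω Ω) (1 : Y →L[ℂ] Y)) ∘L ψ a = ψ a := by
  rw [conjBy_vacuum U hΩ]
  exact range_proj_comp (unitKet U Ω hΩ) (apply_eq_of_adapted U hΩ hL had) a

theorem comp_vacuum_of_adapted (a : A.toStarSubalgebra) :
    ψ a ∘L conjBy U (hmap (InnerProductSpace.rankOne ℂ Ω Ω) (1 : Y →L[ℂ] Y)) = ψ a := by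
  rw [conjBy_vacuum U hΩ]
  exact comp_range_proj (unitKet U Ω hΩ) (apply_eq_of_adapted U hΩ hL had) a

end Adapted

/-! ### The frame of exponential vectors -/

section Frame

theorem conjBy_vacuum_apply {K Y X : Type*}
    [NormedAddCommGroup K] [InnerProductSpace ℂ K] [NormedAddCommGroup Y] [InnerProductSpace ℂ Y]
    [NormedAddCommGroup X] [InnerProductSpace ℂ X] (U : K ⊗ₕ Y ≃ₗᵢ[ℂ] X) {Ω x : K}
    (hx : ⟪Ω, x⟫_ℂ = 1) {y : Y} {z z' : X} (hz : U (htmul x y) = z) (hz' : U (htmul Ω y) = z') :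
    conjBy U (hmap (InnerProductSpace.rankOne ℂ Ω Ω) (1 : Y →L[ℂ] Y)) z = z' := by
  rw [conjBy_apply, ← hz, LinearIsometryEquiv.symm_apply_apply, hmap_htmul,
    InnerProductSpace.rankOne_apply, hx, one_smul, one_apply_eq_self, hz']

theorem total_range_id (H : Type*) [NormedAddCommGroup H] [InnerProductSpace ℂ H] :
    (Submodule.span ℂ (range (id : H → H))).topologicalClosure = ⊤ := by
  rw [range_id, Submodule.span_univ]
  exact top_le_iff.1 (Submodule.le_topologicalClosure _)

theorem norm_vacuum {X : Type*} [NormedAddCommGroup X] [InnerProductSpace ℂ X] :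
    ‖(expVec (0 : X) : Fock X)‖ = 1 := by
  have h := inner_self_eq_norm_sq_to_K (𝕜 := ℂ) (expVec (0 : X))
  rw [inner_expVec, inner_zero_left, Complex.exp_zero] at h
  have h1 : ‖(expVec (0 : X) : Fock X)‖ ^ 2 = 1 := by
    have h2 := congrArg Complex.re h
    rw [← RCLike.ofReal_pow] at h2
    exact h2.symm
  exact (pow_eq_one_iff_of_nonneg (norm_nonneg _) two_ne_zero).1 h1

theorem inner_vacuum_expVec {X : Type*} [NormedAddCommGroup X] [InnerProductSpace ℂ X] (x : X) :
    ⟪(expVec (0 : X) : Fock X), expVec x⟫_ℂ = 1 := by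
  rw [inner_expVec, inner_zero_left, Complex.exp_zero]

/-- Frames from exponential vectors which are truncated by projections. -/
theorem isTruncFrame_of_exp {ι K X : Type*}
    [NormedAddCommGroup K] [InnerProductSpace ℂ K] [CompleteSpace K]
    [NormedAddCommGroup X] [InnerProductSpace ℂ X] [CompleteSpace X]
    {P : ℝ≥0 → X →L[ℂ] X} {v : ι → X} {f : ι → ℝ → K} {κ : ι → ι → ℂ}
    (total : (Submodule.span ℂ (range v)).topologicalClosure = ⊤)
    (adjoint : ∀ t, (P t).adjoint = P t) (norm_le : ∀ t x, ‖P t x‖ ≤ ‖x‖)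
    (memLp : ∀ p, MemLp (f p) 2 volume)
    (gram : ∀ p q, ⟪v p, v q⟫_ℂ = κ p q * Complex.exp (∫ r, ⟪f p r, f q r⟫_ℂ))
    (hneg : ∀ p, ∀ᵐ r : ℝ, r < 0 → f p r = 0)
    (htr : ∀ (t : ℝ≥0) p, ∃ p', P t (v p) = v p' ∧ (∀ q, κ p' q = κ p q ∧ κ q p' = κ q p) ∧
      (∀ᵐ r : ℝ, r < t → f p' r = f p r) ∧ ∀ᵐ r : ℝ, (t : ℝ) ≤ r → f p' r = 0)
    (hfix : ∀ (t : ℝ≥0) p, (∀ᵐ r : ℝ, (t : ℝ) ≤ r → f p r = 0) → P t (v p) = v p) :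
    IsTruncFrame (fun s : ℝ => P s.toNNReal) v f κ where
  total := total
  adjoint s := adjoint _
  norm_le s x := norm_le _ x
  memLp := memLp
  gram s hs p q := by
    obtain ⟨p', hp1, hp2, hp3, hp4⟩ := htr s.toNNReal p
    obtain ⟨q', hq1, hq2, hq3, hq4⟩ := htr s.toNNReal q
    rw [hp1, hq1, gram, (hp2 _).1, (hq2 _).2]
    congr 2
    rw [Real.coe_toNNReal _ hs] at *
    rw [intervalIntegral.integral_of_le hs, ← integral_indicator measurableSet_Ioc]
    refine integral_congr_ae ?_
    -- The truncated functions are controlled for `r < s`, `s ≤ r` and `r < 0`, whereas the interval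
    -- integral runs over `(0, s]`; the endpoints `0` and `s` are discarded as null sets.
    have hne : ∀ᵐ r : ℝ, r ≠ s := by simp [ae_iff]
    have hne0 : ∀ᵐ r : ℝ, r ≠ 0 := by simp [ae_iff]
    filter_upwards [hp3, hp4, hq3, hneg p, hne, hne0] with r h1 h2 h3 h4 h5 h6
    by_cases hr : r < s
    · rw [h1 hr, h3 hr]
      by_cases h0 : 0 < r
      · rw [indicator_of_mem (show r ∈ Ioc 0 s from ⟨h0, hr.le⟩)]
      · rw [h4 (lt_of_le_of_ne (not_lt.1 h0) h6), inner_zero_left,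
          indicator_of_notMem (fun h => h0 h.1)]
    · rw [h2 (not_lt.1 hr), inner_zero_left,
        indicator_of_notMem (fun h => h5 (le_antisymm h.2 (not_lt.1 hr)))]
  mono s t x hst := by
    suffices h : P t.toNNReal ∘L P s.toNNReal = P s.toNNReal from
      congrArg (fun T : X →L[ℂ] X => T x) h
    refine ContinuousLinearMap.ext_on (Submodule.dense_iff_topologicalClosure_eq_top.2 total) ?_
    rintro _ ⟨p, rfl⟩
    obtain ⟨p', h1, -, -, h4⟩ := htr s.toNNReal p
    rw [ContinuousLinearMap.comp_apply, h1]
    refine hfix _ _ ?_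
    filter_upwards [h4] with r h5 hr
    exact h5 (le_trans (NNReal.coe_le_coe.2 (Real.toNNReal_le_toNNReal hst)) hr)
  trunc t p := by
    obtain ⟨p', h1, h2, h3, h4⟩ := htr t p
    refine ⟨p', by rw [Real.toNNReal_coe]; exact h1, ?_⟩
    have hne : ∀ᵐ r : ℝ, r ≠ t := by simp [ae_iff]
    filter_upwards [h3, hne] with r h5 h6 hr
    exact h5 (lt_of_le_of_ne hr.2 h6)

variable {𝔨 𝔥 : Type*} [NormedAddCommGroup 𝔨] [InnerProductSpace ℂ 𝔨]
  [NormedAddCommGroup 𝔥] [InnerProductSpace ℂ 𝔥]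

/-- The vectors `ε(f) ⊗ u`. -/
def expFrame (p : L2 𝔨 (Ici (0 : ℝ)) × 𝔥) : FH 𝔨 𝔥 := htmul (expVec p.1) p.2

/-- The function `f` of `ε(f) ⊗ u`. -/
def frameFun (p : L2 𝔨 (Ici (0 : ℝ)) × 𝔥) : ℝ → 𝔨 := (p.1 : Lp 𝔨 2 (volume : Measure ℝ))

theorem vacP_expFrame (t : ℝ≥0) (f : L2 𝔨 (Ici (t : ℝ))) (g : L2 𝔨 (Ico 0 (t : ℝ))) (u : 𝔥) :
    vacP 𝔨 𝔥 t (expFrame (join t f g, u)) = expFrame (join t 0 g, u) :=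
  conjBy_vacuum_apply (splitting 𝔨 𝔥 t) (inner_vacuum_expVec f) (splitting_htmul t f g u)
    (splitting_htmul t 0 g u)

theorem join_ae (t : ℝ≥0) (f : L2 𝔨 (Ici (t : ℝ))) (g : L2 𝔨 (Ico 0 (t : ℝ))) :
    ((join t f g : L2 𝔨 (Ici (0 : ℝ))) : Lp 𝔨 2 (volume : Measure ℝ)) =ᵐ[volume]
      fun r => (f : Lp 𝔨 2 (volume : Measure ℝ)) r + (g : Lp 𝔨 2 (volume : Measure ℝ)) r :=
  Lp.coeFn_add _ _

/-- The future component of `f` is zero, so the vacuum projection replaces it by itself. -/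
theorem vacP_expFrame_of_vanish (t : ℝ≥0) (f : L2 𝔨 (Ici (0 : ℝ))) (u : 𝔥)
    (hf : ∀ᵐ r, (t : ℝ) ≤ r → (f : Lp 𝔨 2 (volume : Measure ℝ)) r = 0) :
    vacP 𝔨 𝔥 t (expFrame (f, u)) = expFrame (f, u) := by
  obtain ⟨f₁, g₁, rfl⟩ := exists_join_eq t f
  have h0 : f₁ = 0 := by
    refine Subtype.ext (Lp.ext ?_)
    filter_upwards [hf, join_ae t f₁ g₁, f₁.2, g₁.2, Lp.coeFn_zero 𝔨 2 (volume : Measure ℝ)]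
      with r h1 h2 h3 h4 h5
    refine Eq.trans ?_ h5.symm
    by_cases hr : (t : ℝ) ≤ r
    · have h6 := h1 hr
      rw [h2, h4 (fun h => absurd h.2 (not_lt.2 hr)), add_zero] at h6
      exact h6
    · exact h3 hr
  subst h0
  exact vacP_expFrame t 0 g₁ u

theorem exists_vacP_expFrame (t : ℝ≥0) (p : L2 𝔨 (Ici (0 : ℝ)) × 𝔥) :
    ∃ p' : L2 𝔨 (Ici (0 : ℝ)) × 𝔥, vacP 𝔨 𝔥 t (expFrame p) = expFrame p' ∧ p'.2 = p.2 ∧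
      (∀ᵐ r, r < (t : ℝ) → frameFun p' r = frameFun p r) ∧
      ∀ᵐ r, (t : ℝ) ≤ r → frameFun p' r = 0 := by
  obtain ⟨f, u⟩ := p
  obtain ⟨f₁, g₁, rfl⟩ := exists_join_eq t f
  refine ⟨(join t 0 g₁, u), vacP_expFrame t f₁ g₁ u, rfl, ?_, ?_⟩
  · filter_upwards [join_ae t f₁ g₁, join_ae t 0 g₁, f₁.2,
      Lp.coeFn_zero 𝔨 2 (volume : Measure ℝ)] with r h1 h2 h3 h4 hr
    refine h2.trans (Eq.trans ?_ h1.symm)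
    rw [h3 (not_le.2 hr)]
    exact congrArg (· + _) h4
  · filter_upwards [join_ae t 0 g₁, g₁.2, Lp.coeFn_zero 𝔨 2 (volume : Measure ℝ)]
      with r h2 h3 h4 hr
    refine h2.trans ?_
    rw [h3 (fun h => absurd h.2 (not_lt.2 hr)), add_zero]
    exact h4

theorem inner_expFrame (p q : L2 𝔨 (Ici (0 : ℝ)) × 𝔥) :
    ⟪expFrame p, expFrame q⟫_ℂ = Complex.exp (∫ r, ⟪frameFun p r, frameFun q r⟫_ℂ) * ⟪p.2, q.2⟫_ℂ := by
  rw [expFrame, expFrame, inner_htmul, inner_expVec]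
  rfl

theorem total_expFrame : (Submodule.span ℂ
    (range (expFrame : L2 𝔨 (Ici (0 : ℝ)) × 𝔥 → FH 𝔨 𝔥))).topologicalClosure = ⊤ := by
  have h := dense_span_htmul (dense_span_expVec (X := L2 𝔨 (Ici (0 : ℝ)))) (total_range_id 𝔥)
  exact h

theorem adjoint_vacP [CompleteSpace 𝔥] (t : ℝ≥0) : (vacP 𝔨 𝔥 t).adjoint = vacP 𝔨 𝔥 t :=
  adjoint_conjBy_vacuum (splitting 𝔨 𝔥 t) norm_vacuum

theorem norm_vacP_le [CompleteSpace 𝔥] (t : ℝ≥0) (x : FH 𝔨 𝔥) : ‖vacP 𝔨 𝔥 t x‖ ≤ ‖x‖ :=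
  norm_conjBy_vacuum_le (splitting 𝔨 𝔥 t) norm_vacuum x

omit [NormedAddCommGroup 𝔥] [InnerProductSpace ℂ 𝔥] in
theorem frameFun_eq_zero (p : L2 𝔨 (Ici (0 : ℝ)) × 𝔥) : ∀ᵐ r : ℝ, r < 0 → frameFun p r = 0 := by
  filter_upwards [p.1.2] with r h1 hr
  exact h1 (not_le.2 hr)

omit [NormedAddCommGroup 𝔥] [InnerProductSpace ℂ 𝔥] in
theorem memLp_frameFun (p : L2 𝔨 (Ici (0 : ℝ)) × 𝔥) : MemLp (frameFun p) 2 volume :=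
  Lp.memLp _

theorem isTruncFrame_expFrame [CompleteSpace 𝔨] [CompleteSpace 𝔥] :
    IsTruncFrame (X := FH 𝔨 𝔥) (fun s : ℝ => vacP 𝔨 𝔥 s.toNNReal) expFrame frameFun
      (fun p q => ⟪p.2, q.2⟫_ℂ) := by
  refine isTruncFrame_of_exp total_expFrame adjoint_vacP norm_vacP_le memLp_frameFun ?_
    frameFun_eq_zero ?_ ?_
  · exact fun p q => (inner_expFrame p q).trans (mul_comm _ _)
  · intro t p
    obtain ⟨p', h1, h2, h3, h4⟩ := exists_vacP_expFrame t p
    exact ⟨p', h1, fun q => by rw [h2]; exact ⟨rfl, rfl⟩, h3, h4⟩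
  · exact fun t p hp => vacP_expFrame_of_vanish t p.1 p.2 hp

/-- Vectors of the frame in terms of shifted vectors. -/
theorem exists_shift_expFrame (s : ℝ≥0) (p : L2 𝔨 (Ici (0 : ℝ)) × 𝔥) :
    ∃ (x : NoiseFock 𝔨 (Ici 0)) (u : NoiseFock 𝔨 (Ico 0 (s : ℝ)) ⊗ₕ 𝔥) (g : ℝ → 𝔨),
      expFrame p = splitting 𝔨 𝔥 s (htmul (shiftFock 𝔨 s x) u) ∧
      (∀ᵐ r : ℝ, 0 < r → g r = frameFun p (s + r)) ∧
      ∀ ξ : 𝔥, ∃ p' : L2 𝔨 (Ici (0 : ℝ)) × 𝔥, expFrame p' = htmul x ξ ∧ frameFun p' = g := by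
  obtain ⟨f, u⟩ := p
  obtain ⟨f₁, g₁, rfl⟩ := exists_join_eq s f
  -- The future part of `f` is a shifted function `f'`, and `ε(f')` is the required `x`; the past
  -- part is absorbed in the vector `u`.
  obtain ⟨f', rfl⟩ := (rightShift s).surjective f₁
  refine ⟨expVec f', htmul (expVec g₁) u, frameFun (f', (0 : 𝔥)), ?_, ?_, fun ξ => ⟨(f', ξ), rfl, rfl⟩⟩
  · rw [shiftFock_expVec]
    exact (splitting_htmul s _ _ u).symm
  · have hq := (measurePreserving_add_left (volume : Measure ℝ) (s : ℝ)).quasiMeasurePreserving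
    filter_upwards [hq.ae (join_ae s (rightShift s f') g₁), hq.ae g₁.2,
      hq.ae (translate_ae (s : ℝ) (f' : Lp 𝔨 2 (volume : Measure ℝ)))] with r h1 h2 h3 hr
    refine Eq.symm (h1.trans ?_)
    rw [h2 (fun h => absurd h.2 (not_lt.2 (le_add_of_nonneg_right hr.le))), add_zero]
    refine h3.trans ?_
    rw [add_sub_cancel_left]
    rfl

end Frame

/-! ### The extended multiplicity space -/

section Hat
variable {𝔨 : Type*} [NormedAddCommGroup 𝔨] [InnerProductSpace ℂ 𝔨]

theorem inner_omega_hatVec (x : 𝔨) : ⟪omega 𝔨, hatVec x⟫_ℂ = 1 := by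
  simp [omega, hatVec, WithLp.prod_inner_apply]

theorem norm_omega : ‖omega 𝔨‖ = 1 := by
  have h := inner_self_eq_norm_sq_to_K (𝕜 := ℂ) (omega 𝔨)
  have h1 : ‖omega 𝔨‖ ^ 2 = 1 := by
    have h2 := congrArg Complex.re h
    rw [← RCLike.ofReal_pow] at h2
    exact h2.symm.trans (congrArg Complex.re (inner_omega_hatVec (0 : 𝔨)))
  exact (pow_eq_one_iff_of_nonneg (norm_nonneg _) two_ne_zero).1 h1

theorem inclK_apply (x : 𝔨) : inclK 𝔨 x = WithLp.toLp 2 (0, x) := rfl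

theorem hatVec_eq (x : 𝔨) : hatVec x = omega 𝔨 + inclK 𝔨 x := by
  rw [omega, hatVec, hatVec, inclK_apply, ← WithLp.toLp_add]
  simp

theorem norm_inclK_le : ‖inclK 𝔨‖ ≤ 1 :=
  ContinuousLinearMap.opNorm_le_bound _ zero_le_one fun x => by
    rw [inclK_apply, WithLp.prod_norm_eq_of_L2]
    simp

theorem adjoint_inclK_omega [CompleteSpace 𝔨] : (inclK 𝔨).adjoint (omega 𝔨) = 0 := by
  refine ext_inner_right ℂ fun x => ?_
  rw [ContinuousLinearMap.adjoint_inner_left, inner_zero_left, inclK_apply]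
  simp [omega, hatVec, WithLp.prod_inner_apply]

end Hat

/-! ### Solutions of the equation as processes -/

section Equation

theorem memLp_opNorm_comp {X Y : Type*}
    [NormedAddCommGroup X] [InnerProductSpace ℂ X] [CompleteSpace X]
    [NormedAddCommGroup Y] [InnerProductSpace ℂ Y]
    {C : ℝ → X →L[ℂ] Y} {N : ℝ → X →L[ℂ] X} {a b B c : ℝ} (hC : ∀ s, ‖C s‖ ≤ c)
    (hCc : ∀ x, Continuous fun s => C s x) (hNc : ∀ x, Continuous fun s => N s x)
    (hN : ∀ s ∈ Ico a b, ‖N s‖ ≤ B) (p : ENNReal) :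
    MemLp (fun s => ‖C s ∘L N s‖) p (volume.restrict (Ico a b)) :=
  memLp_opNorm (T := fun s => C s ∘L N s) (B := c * B)
    (fun x => continuous_apply_of_bounded hC hCc (hNc x))
    (fun s hs => (ContinuousLinearMap.opNorm_comp_le _ _).trans
      (mul_le_mul (hC s) (hN s hs) (norm_nonneg _) ((norm_nonneg _).trans (hC s)))) p

variable {F H K K' ι : Type*}
  [NormedAddCommGroup F] [InnerProductSpace ℂ F] [CompleteSpace F]
  [NormedAddCommGroup H] [InnerProductSpace ℂ H] [CompleteSpace H]
  [NormedAddCommGroup K] [InnerProductSpace ℂ K] [CompleteSpace K]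
  [NormedAddCommGroup K'] [InnerProductSpace ℂ K'] [CompleteSpace K']
  {A : VonNeumannAlgebra H}

/-- The integrand `(id ⊗̄ ψ_s)(c E^ω) (I ⊗ M_s)`. -/
def integrand (ψ : ℝ≥0 → A.toStarSubalgebra →ₗ[ℂ] (F ⊗ₕ H →L[ℂ] F ⊗ₕ H)) (c : H →L[ℂ] K' ⊗ₕ H)
    (ω : K') (M : ℝ≥0 → F ⊗ₕ H →L[ℂ] F ⊗ₕ H) (s : ℝ≥0) : K' ⊗ₕ (F ⊗ₕ H) →L[ℂ] K' ⊗ₕ (F ⊗ₕ H) :=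
  ampliate A (ψ s) (c ∘L braE ω) ∘L hmap (1 : K' →L[ℂ] K') (M s)

/-- Solutions of the equation with respect to a frame. -/
structure IsFrameSolution (ψ : ℝ≥0 → A.toStarSubalgebra →ₗ[ℂ] (F ⊗ₕ H →L[ℂ] F ⊗ₕ H))
    (P : ℝ≥0 → F ⊗ₕ H →L[ℂ] F ⊗ₕ H) (v : ι → F ⊗ₕ H) (f : ι → ℝ → K) (c : H →L[ℂ] K' ⊗ₕ H)
    (ω : K') (inc : K →L[ℂ] K') (M : ℝ≥0 → F ⊗ₕ H →L[ℂ] F ⊗ₕ H) : Prop where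
  process : IsBoundedProcess (opTensor F (A : Set (H →L[ℂ] H))) M
  integrand_process : IsBoundedProcess (opTensor K' (opTensor F (A : Set (H →L[ℂ] H))))
    (integrand ψ c ω M)
  integrand_adapted : ∀ t, integrand ψ c ω M t = hmap (1 : K' →L[ℂ] K') (P t) ∘L
    integrand ψ c ω M t ∘L hmap (1 : K' →L[ℂ] K') (P t)
  memLp_k : ∀ t : ℝ≥0, MemLp (fun s : ℝ => ‖braE ω ∘L integrand ψ c ω M s.toNNReal ∘L ketE ω‖) 1
    (volume.restrict (Ico 0 (t : ℝ)))
  memLp_l : ∀ t : ℝ≥0, MemLp (fun s : ℝ => ‖(hmap inc (1 : F ⊗ₕ H →L[ℂ] F ⊗ₕ H)).adjoint ∘L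
    integrand ψ c ω M s.toNNReal ∘L ketE ω‖) 2 (volume.restrict (Ico 0 (t : ℝ)))
  memLp_m : ∀ t : ℝ≥0, MemLp (fun s : ℝ => ‖braE ω ∘L integrand ψ c ω M s.toNNReal ∘L
    hmap inc (1 : F ⊗ₕ H →L[ℂ] F ⊗ₕ H)‖) 2 (volume.restrict (Ico 0 (t : ℝ)))
  memLp_n : ∀ t : ℝ≥0, MemLp (fun s : ℝ => ‖(hmap inc (1 : F ⊗ₕ H →L[ℂ] F ⊗ₕ H)).adjoint ∘L
    integrand ψ c ω M s.toNNReal ∘L hmap inc (1 : F ⊗ₕ H →L[ℂ] F ⊗ₕ H)‖) ⊤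
    (volume.restrict (Ico 0 (t : ℝ)))
  integral_process : IsBoundedProcess (opTensor F (A : Set (H →L[ℂ] H))) fun t => M t - 1
  integral_adapted : ∀ t, M t - 1 = P t * (M t - 1) * P t
  inner_eq : ∀ (t : ℝ≥0) p q, ⟪v p, (M t - 1) (v q)⟫_ℂ = ∫ s in (0 : ℝ)..t,
    ⟪v p, (braE (ω + inc (f p s)) ∘L integrand ψ c ω M s.toNNReal ∘L ketE (ω + inc (f q s)))
      (v q)⟫_ℂ

variable {ψ : ℝ≥0 → A.toStarSubalgebra →ₗ[ℂ] (F ⊗ₕ H →L[ℂ] F ⊗ₕ H)}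
  {P : ℝ≥0 → F ⊗ₕ H →L[ℂ] F ⊗ₕ H} {v : ι → F ⊗ₕ H} {f : ι → ℝ → K} {κ : ι → ι → ℂ}
  {c : H →L[ℂ] K' ⊗ₕ H} {ω : K'} {inc : K →L[ℂ] K'}
  (hψ : IsHomFamily ψ P)
  (h : IsTruncFrame (fun s => P s.toNNReal) v f κ) (hω : ‖ω‖ = 1)
  (hc : ∀ x, braE x ∘L c ∈ A.toStarSubalgebra) (hinc : ‖inc‖ ≤ 1) (hincω : inc.adjoint ω = 0)
  {M : ℝ≥0 → F ⊗ₕ H →L[ℂ] F ⊗ₕ H}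

section
include hψ hω hc

omit [CompleteSpace F] in
theorem braE_integrand_ketE (s : ℝ) :
    braE ω ∘L integrand ψ c ω M s.toNNReal ∘L ketE ω = coeff₀ ψ c ω s ∘L M s.toNNReal := by
  rw [integrand, integrand_comp_ketE hω hc (hψ.cb _)]
  rfl

omit [CompleteSpace F] [CompleteSpace K] in
theorem adjoint_integrand_ketE (s : ℝ) : (hmap inc (1 : F ⊗ₕ H →L[ℂ] F ⊗ₕ H)).adjoint ∘L
    integrand ψ c ω M s.toNNReal ∘L ketE ω = coeff₁ ψ c ω inc s ∘L M s.toNNReal := by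
  rw [integrand, integrand_comp_ketE hω hc (hψ.cb _)]
  rfl

omit [CompleteSpace F] in
theorem inner_slice_integrand (hincω : inc.adjoint ω = 0) (x w : F ⊗ₕ H) (g g' : ℝ → K) (s : ℝ) :
    ⟪x, (braE (ω + inc (g s)) ∘L integrand ψ c ω M s.toNNReal ∘L ketE (ω + inc (g' s))) w⟫_ℂ =
      drive x g (coeff₀ ψ c ω) (coeff₁ ψ c ω inc) (fun s => M s.toNNReal w) s := by
  refine inner_integrand hψ hω hc M x w g s ?_
  rw [inner_add_right, inner_self_of_norm_one hω, ← ContinuousLinearMap.adjoint_inner_left, hincω,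
    inner_zero_left, add_zero]

omit [CompleteSpace F] in
-- Since `⟪ω, ω + inc x⟫ = 1` for every `x`, the function attached to the right-hand frame vector
-- disappears from the integrand.
theorem solvesAt_of_inner_eq (hincω : inc.adjoint ω = 0) (hM : IsFrameSolution ψ P v f c ω inc M)
    (q : ι) : SolvesAt v f (coeff₀ ψ c ω) (coeff₁ ψ c ω inc) M (v q) := by
  intro t p
  have h1 := hM.inner_eq t p q
  rw [sub_apply, one_apply_eq_self, inner_sub_right, sub_eq_iff_eq_add'] at h1
  refine h1.trans (congrArg _ ?_)
  exact intervalIntegral.integral_congr fun s _ =>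
    inner_slice_integrand hψ hω hc hincω (v p) (v q) (f p) (f q) s

omit [CompleteSpace F] in
theorem continuous_integrand (hcont : ∀ ξ, Continuous fun t => M t ξ) (ζ : K' ⊗ₕ (F ⊗ₕ H)) :
    Continuous fun t => integrand ψ c ω M t ζ := by
  have h1 : Continuous fun t => column (ψ t) c ω (M t (braE ω ζ)) :=
    continuous_apply_of_bounded (c := ‖c‖)
      (fun s => norm_column_le hω hc (hψ.cb s) (hψ.normal s) (hψ.mul s) (hψ.star s))
      (fun ξ => continuous_iff_continuousAt.2 fun s => tendsto_column hω hc hψ.cb hψ.normal hψ.mul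
        hψ.star (fun a z w => (hψ.cont a z w).tendsto s) ξ) (hcont _)
  have h2 : (fun t => integrand ψ c ω M t ζ) = fun t => column (ψ t) c ω (M t (braE ω ζ)) :=
    funext fun t => congrArg (fun T : _ →L[ℂ] _ => T ζ) (ampliate_comp_hmap hω hc (hψ.cb t) (M t))
  rwa [h2]

/-- The slices are scalar multiples of `ψ_t(E^x c) M_t`, so the slice criterion applies with the
inner tensor product as the set. -/
theorem integrand_mem (hmem : ∀ s a, ψ s a ∈ opTensor F (A : Set (H →L[ℂ] H)))
    (hM : ∀ t, M t ∈ opTensor F (A : Set (H →L[ℂ] H))) (t : ℝ≥0) :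
    integrand ψ c ω M t ∈ opTensor K' (opTensor F (A : Set (H →L[ℂ] H))) :=
  mem_opTensor_of_slices fun x y => by
    rw [integrand, slice_integrand hω hc (hψ.cb t)]
    exact smul_mem_opTensor _ (comp_mem_opTensor A (hmem _ _) (hM t))

end

section
include hψ h hω hc hinc

omit [CompleteSpace F] in
theorem exists_solvesAt : ∃ (M : ℝ≥0 → F ⊗ₕ H →L[ℂ] F ⊗ₕ H) (B : ℝ≥0 → ℝ),
    (∀ ξ, Continuous fun t => M t ξ) ∧ (∀ t r, r ≤ t → ‖M r‖ ≤ B t) ∧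
      ∀ ξ, SolvesAt v f (coeff₀ ψ c ω) (coeff₁ ψ c ω inc) M ξ := by
  obtain ⟨M, B, h1, h2, h3⟩ :=
    (hψ.isAdaptedDriver hω hc hinc).toIsDriver.exists_solution h.toIsExpFrame
  refine ⟨M, fun t => |B| * Real.exp (weight ‖c‖ * t), h1, fun t r hrt => (h2 r).trans ?_,
    fun ξ t p => h3 t ξ p⟩
  have hw : 0 ≤ weight ‖c‖ := by unfold weight; positivity
  exact mul_le_mul (le_abs_self B) (Real.exp_le_exp.2 (mul_le_mul_of_nonneg_left
    (NNReal.coe_le_coe.2 hrt) hw)) (Real.exp_pos _).le (abs_nonneg _)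

/-- The coefficients commute with `I ⊗ a'` for `a'` in the commutant, and `I ⊗ a'` acts on the frame
without changing the functions. By uniqueness the solution commutes with it too. -/
theorem solution_mem (hmem : ∀ s a, ψ s a ∈ opTensor F (A : Set (H →L[ℂ] H)))
    (hv : ∀ p (a : H →L[ℂ] H), ∃ p', hmap (1 : F →L[ℂ] F) a (v p) = v p' ∧ f p' = f p)
    (hcont : ∀ ξ, Continuous fun t => M t ξ)
    (hM : ∀ ξ, SolvesAt v f (coeff₀ ψ c ω) (coeff₁ ψ c ω inc) M ξ) (t : ℝ≥0) :
    M t ∈ opTensor F (A : Set (H →L[ℂ] H)) := by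
  refine (mem_opTensor_iff_commute A).2 fun a' ha' => ?_
  have hb := hψ.coeff_commute hω hc (inc := inc) (b := hmap 1 a')
    fun s a => (mem_opTensor_iff_commute A).1 (hmem s a) a' ha'
  refine (hψ.isAdaptedDriver hω hc hinc).toIsDriver.solution_commute h.toIsExpFrame hcont hM
    (fun s ξ => (hb s ξ).1) (fun s ξ => (hb s ξ).2) (fun p => ?_) t
  have h1 : (1 : F →L[ℂ] F).adjoint = 1 := star_one (F →L[ℂ] F)
  rw [adjoint_hmap, h1]
  exact hv p _

include hincω in
theorem isFrameSolution_of_solvesAt (hmem : ∀ s a, ψ s a ∈ opTensor F (A : Set (H →L[ℂ] H)))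
    (hv : ∀ p (a : H →L[ℂ] H), ∃ p', hmap (1 : F →L[ℂ] F) a (v p) = v p' ∧ f p' = f p)
    (hcont : ∀ ξ, Continuous fun t => M t ξ) {B : ℝ≥0 → ℝ} (hB : ∀ t r, r ≤ t → ‖M r‖ ≤ B t)
    (hM : ∀ ξ, SolvesAt v f (coeff₀ ψ c ω) (coeff₁ ψ c ω inc) M ξ) :
    IsFrameSolution ψ P v f c ω inc M := by
  have hd := hψ.isAdaptedDriver hω hc hinc
  have hMm := solution_mem hψ h hω hc hinc hmem hv hcont hM
  have hl : ∀ t, P t * (M t - 1) = M t - 1 := fun t => by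
    have := hd.proj_comp_solution h hM t
    rwa [Real.toNNReal_coe] at this
  have hr : ∀ t, (M t - 1) * P t = M t - 1 := fun t => by
    have := hd.solution_comp_proj h hcont hM t
    rwa [Real.toNNReal_coe] at this
  have hbd : ∀ (t : ℝ≥0) (s : ℝ), s ∈ Ico 0 (t : ℝ) → ‖M s.toNNReal‖ ≤ B t := fun t s hs =>
    hB t _ (Real.toNNReal_le_iff_le_coe.2 hs.2.le)
  have hwc := fun ξ => continuous_comp_toNNReal (hcont ξ)
  refine ⟨⟨hMm, fun ζ' ζ => (continuous_const.inner (hcont ζ)).measurable⟩,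
    ⟨integrand_mem hψ hω hc hmem hMm, fun ζ' ζ =>
      (continuous_const.inner (continuous_integrand hψ hω hc hcont ζ)).measurable⟩,
    fun t => integrand_adapted hω hc (hψ.cb t) (M t) (hψ.left t) (hψ.right t) (hr t),
    fun t => ?_, fun t => ?_, fun t => ?_, fun t => ?_,
    ⟨fun t => sub_mem_opTensor A (hMm t) (one_mem_opTensor A), fun ζ' ζ =>
      (continuous_const.inner ((hcont ζ).sub continuous_const)).measurable⟩,
    fun t => by rw [hl, hr], fun t p q => ?_⟩
  · simp only [braE_integrand_ketE hψ hω hc]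
    exact memLp_opNorm_comp hd.norm₀ hd.cont₀ hwc (hbd t) 1
  · simp only [adjoint_integrand_ketE hψ hω hc]
    exact memLp_opNorm_comp hd.norm₁ hd.cont₁ hwc (hbd t) 2
  · have h0 : ∀ s : ℝ, integrand ψ c ω M s.toNNReal ∘L hmap inc (1 : F ⊗ₕ H →L[ℂ] F ⊗ₕ H) = 0 :=
      fun s => integrand_comp_incl hω hc (hψ.cb _) _ hincω
    simp only [h0, ContinuousLinearMap.comp_zero, norm_zero]
    exact MemLp.zero
  · have h0 : ∀ s : ℝ, integrand ψ c ω M s.toNNReal ∘L hmap inc (1 : F ⊗ₕ H →L[ℂ] F ⊗ₕ H) = 0 :=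
      fun s => integrand_comp_incl hω hc (hψ.cb _) _ hincω
    simp only [h0, ContinuousLinearMap.comp_zero, norm_zero]
    exact MemLp.zero
  · rw [sub_apply, one_apply_eq_self, inner_sub_right, hM (v q) t p, add_sub_cancel_left]
    exact intervalIntegral.integral_congr fun s _ =>
      (inner_slice_integrand hψ hω hc hincω (v p) (v q) (f p) (f q) s).symm

include hincω in
omit [CompleteSpace F] in
theorem IsFrameSolution.eq (hcont : ∀ ξ, Continuous fun t => M t ξ)
    (hM : ∀ ξ, SolvesAt v f (coeff₀ ψ c ω) (coeff₁ ψ c ω inc) M ξ)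
    {M' : ℝ≥0 → F ⊗ₕ H →L[ℂ] F ⊗ₕ H} (hM' : IsFrameSolution ψ P v f c ω inc M') : M' = M := by
  -- Integrands are controlled on `[0, T)` and interval integrals live on `(0, T]`; the two differ
  -- by a null set.
  have hIoc : ∀ T : ℝ≥0, volume.restrict (Ico 0 (T : ℝ)) = volume.restrict (Ioc 0 (T : ℝ)) :=
    fun T => Measure.restrict_congr_set Ico_ae_eq_Ioc
  refine (hψ.isAdaptedDriver hω hc hinc).toIsDriver.solution_unique h.toIsExpFrame hcont hM
    (solvesAt_of_inner_eq hψ hω hc hincω hM')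
    (fun q x => ?_) (fun q z => ?_) (fun T => hIoc T ▸ hM'.memLp_k T)
    (fun T => hIoc T ▸ hM'.memLp_l T)
    (fun s => (congrArg norm (braE_integrand_ketE hψ hω hc s)).ge)
    (fun s => (congrArg norm (adjoint_integrand_ketE hψ hω hc s)).ge)
  -- Weak measurability of the coefficient terms is read off from the integrand by testing between
  -- `ω ⊗ x` and `ω ⊗ v q`; for the lower coefficient the left vector is the image of `z` under the
  -- inclusion.
  · have h1 := (hM'.integrand_process.2 (htmul ω x) (htmul ω (v q))).comp measurable_real_toNNReal
    convert h1 using 2 with s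
    have h2 := congrArg (fun T : _ →L[ℂ] _ => ⟪x, T (v q)⟫_ℂ)
      (braE_integrand_ketE (M := M') hψ hω hc s)
    simp only [ContinuousLinearMap.comp_apply, inner_braE, ketE_apply] at h2
    exact h2.symm
  · have h1 := (hM'.integrand_process.2 (hmap inc 1 z) (htmul ω (v q))).comp
      measurable_real_toNNReal
    convert h1 using 2 with s
    have h2 := congrArg (fun T : _ →L[ℂ] _ => ⟪z, T (v q)⟫_ℂ)
      (adjoint_integrand_ketE (M := M') (inc := inc) hψ hω hc s)
    simp only [ContinuousLinearMap.comp_apply, ContinuousLinearMap.adjoint_inner_right,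
      ketE_apply] at h2
    exact h2.symm

end

end Equation

/-! ### Flows -/

/-! ### Initial value and commutation with the projections. -/

section SolutionLaws
variable {ι K X : Type*}
  [NormedAddCommGroup K] [InnerProductSpace ℂ K] [CompleteSpace K]
  [NormedAddCommGroup X] [InnerProductSpace ℂ X] [CompleteSpace X]
  {P : ℝ≥0 → X →L[ℂ] X} {v : ι → X} {f : ι → ℝ → K} {κ : ι → ι → ℂ}
  {C₀ : ℝ → X →L[ℂ] X} {C₁ : ℝ → X →L[ℂ] K ⊗ₕ X} {c : ℝ} {M : ℝ≥0 → X →L[ℂ] X}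

omit [CompleteSpace K] [CompleteSpace X] in
theorem solution_zero (hv : (Submodule.span ℂ (range v)).topologicalClosure = ⊤)
    (hM : ∀ ξ, SolvesAt v f C₀ C₁ M ξ) : M 0 = 1 := by
  refine ContinuousLinearMap.ext fun ξ => ext_inner_of_total hv fun p => ?_
  rw [hM ξ 0 p, NNReal.coe_zero, intervalIntegral.integral_same, add_zero, one_apply_eq_self]

theorem solution_proj_comm (hC : IsAdaptedDriver (fun s => P s.toNNReal) C₀ C₁ c)
    (h : IsTruncFrame (fun s => P s.toNNReal) v f κ) (hcont : ∀ ξ, Continuous fun t => M t ξ)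
    (hM : ∀ ξ, SolvesAt v f C₀ C₁ M ξ) (t : ℝ≥0) : M t * P t = P t * M t := by
  have h1 : P t * (M t - 1) = M t - 1 := by
    have := hC.proj_comp_solution h hM t
    rwa [Real.toNNReal_coe] at this
  have h2 : (M t - 1) * P t = M t - 1 := by
    have := hC.solution_comp_proj h hcont hM t
    rwa [Real.toNNReal_coe] at this
  rw [mul_sub, mul_one] at h1
  rw [sub_mul, one_mul] at h2
  rw [sub_eq_iff_eq_add.1 h1, sub_eq_iff_eq_add.1 h2]

end SolutionLaws

/-! ### Flows as adapted families of homomorphisms, with `J_s` as a lifted shift. -/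

section Flow
variable {𝔥 𝔨 : Type*}
  [NormedAddCommGroup 𝔥] [InnerProductSpace ℂ 𝔥] [CompleteSpace 𝔥]
  [NormedAddCommGroup 𝔨] [InnerProductSpace ℂ 𝔨]
  {A : VonNeumannAlgebra 𝔥}
  {j : ℝ≥0 → A.toStarSubalgebra →ₗ[ℂ] (FH 𝔨 𝔥 →L[ℂ] FH 𝔨 𝔥)}

theorem IsFlow.isHomFamily (hj : IsFlow A j) : IsHomFamily j (vacP 𝔨 𝔥) where
  cb := hj.completelyBounded
  normal := hj.normal
  mul s := map_mul_of_adapted (splitting 𝔨 𝔥 s) norm_vacuum (L := localPart A j s) (fun _ => rfl)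
    (hj.adapted s) (hj.map_mul s)
  star s := map_star_of_adapted (splitting 𝔨 𝔥 s) norm_vacuum (L := localPart A j s) (fun _ => rfl)
    (hj.adapted s) (hj.map_star s)
  cont a z w := by
    let := ultraweak (FH 𝔨 𝔥) (FH 𝔨 𝔥)
    exact (continuous_inner_ultraweak z w).comp (hj.continuous a)
  left s := vacuum_comp_of_adapted (splitting 𝔨 𝔥 s) norm_vacuum (L := localPart A j s)
    (fun _ => rfl) (hj.adapted s)
  right s := comp_vacuum_of_adapted (splitting 𝔨 𝔥 s) norm_vacuum (L := localPart A j s)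
    (fun _ => rfl) (hj.adapted s)

/-- The restriction `j_{s)}` of `j_s` as a linear map. -/
def localMap (j : ℝ≥0 → A.toStarSubalgebra →ₗ[ℂ] (FH 𝔨 𝔥 →L[ℂ] FH 𝔨 𝔥)) (s : ℝ≥0) :
    A.toStarSubalgebra →ₗ[ℂ] (NoiseFock 𝔨 (Ico 0 (s : ℝ)) ⊗ₕ 𝔥 →L[ℂ]
      NoiseFock 𝔨 (Ico 0 (s : ℝ)) ⊗ₕ 𝔥) :=
  compression (unitKet (splitting 𝔨 𝔥 s) (vacuum 𝔨 (Ici (s : ℝ))) norm_vacuum) (j s)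

theorem localMap_apply (s : ℝ≥0) (a : A.toStarSubalgebra) :
    localMap j s a = localPart A j s a :=
  compression_unitKet (splitting 𝔨 𝔥 s) norm_vacuum (j s) a

theorem bigJ_eq (s : ℝ≥0) (T : FH 𝔨 𝔥 →L[ℂ] FH 𝔨 𝔥) : bigJ A j s T =
    liftedShift (splitting 𝔨 𝔥 s) (shiftFock 𝔨 s) (localMap j s) T := by
  have h : (localMap j s : _ → _) = localPart A j s := funext (localMap_apply s)
  unfold bigJ hatMap liftedShift
  rw [h]
  rfl

theorem IsFlow.isCompletelyBounded_localMap (hj : IsFlow A j) (s : ℝ≥0) :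
    IsCompletelyBounded A (localMap j s) :=
  IsCompletelyBounded.compression _ (hj.completelyBounded s)

theorem IsFlow.isNormal_localMap (hj : IsFlow A j) (s : ℝ≥0) : IsNormal A (localMap j s) :=
  IsNormal.compression _ (hj.normal s)

omit [CompleteSpace 𝔥] in
theorem exists_hmap_expFrame (p : L2 𝔨 (Ici (0 : ℝ)) × 𝔥) (a : 𝔥 →L[ℂ] 𝔥) :
    ∃ p' : L2 𝔨 (Ici (0 : ℝ)) × 𝔥, hmap (1 : NoiseFock 𝔨 (Ici 0) →L[ℂ] NoiseFock 𝔨 (Ici 0)) a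
      (expFrame p) = expFrame p' ∧ frameFun p' = frameFun p :=
  ⟨(p.1, a p.2), hmap_htmul _ _ _ _, rfl⟩

variable {c : 𝔥 →L[ℂ] KHat 𝔨 ⊗ₕ 𝔥} {M : ℝ≥0 → FH 𝔨 𝔥 →L[ℂ] FH 𝔨 𝔥}

/-- The only change beyond unfolding is the decomposition of `(1, x)` as `ω` plus the included
vector, which matches the abstract frame. -/
theorem isQSDESolution_iff : IsQSDESolution A j c M ↔
    IsFrameSolution j (vacP 𝔨 𝔥) expFrame frameFun c (omega 𝔨) (inclK 𝔨) M := by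
  have e : ∀ (t : ℝ≥0) (u v : 𝔥) (f g : L2 𝔨 (Ici (0 : ℝ))), (∫ s in (0 : ℝ)..t,
      ⟪htmul (expVec f) u, (braE (hatVec ((f : Lp 𝔨 2 (volume : Measure ℝ)) s)) ∘L
        integrand j c (omega 𝔨) M s.toNNReal ∘L
          ketE (hatVec ((g : Lp 𝔨 2 (volume : Measure ℝ)) s))) (htmul (expVec g) v)⟫_ℂ) =
      ∫ s in (0 : ℝ)..t, ⟪expFrame (f, u), (braE (omega 𝔨 + inclK 𝔨 (frameFun (f, u) s)) ∘L
        integrand j c (omega 𝔨) M s.toNNReal ∘L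
          ketE (omega 𝔨 + inclK 𝔨 (frameFun (g, v) s))) (expFrame (g, v))⟫_ℂ := by
    intro t u v f g
    simp only [hatVec_eq]
    rfl
  constructor
  · intro h
    exact ⟨h.process, h.equation.integrand.process, h.equation.integrand.adapted,
      h.equation.integrand.memLp_k, h.equation.integrand.memLp_l, h.equation.integrand.memLp_m,
      h.equation.integrand.memLp_n, h.equation.process, h.equation.adapted,
      fun t p q => (h.equation.inner_eq t p.2 q.2 p.1 q.1).trans (e t p.2 q.2 p.1 q.1)⟩
  · intro h
    exact ⟨h.process, ⟨⟨h.integrand_process, h.integrand_adapted, h.memLp_k, h.memLp_l, h.memLp_m,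
      h.memLp_n⟩, h.integral_process, h.integral_adapted, fun t u v f g =>
      (h.inner_eq t (f, u) (g, v)).trans (e t u v f g).symm⟩⟩

end Flow

/-! ### The multiplier property for flows. -/

section Main
variable {𝔥 𝔨 : Type*}
  [NormedAddCommGroup 𝔥] [InnerProductSpace ℂ 𝔥] [CompleteSpace 𝔥]
  [NormedAddCommGroup 𝔨] [InnerProductSpace ℂ 𝔨] [CompleteSpace 𝔨]
  {A : VonNeumannAlgebra 𝔥}
  {j : ℝ≥0 → A.toStarSubalgebra →ₗ[ℂ] (FH 𝔨 𝔥 →L[ℂ] FH 𝔨 𝔥)}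
  {c : 𝔥 →L[ℂ] KHat 𝔨 ⊗ₕ 𝔥} {M : ℝ≥0 → FH 𝔨 𝔥 →L[ℂ] FH 𝔨 𝔥}

/-- Strongly continuous solutions of the equation with respect to exponential vectors are
multipliers. -/
theorem IsFlow.isMultiplier_of_solvesAt (hj : IsFlow A j)
    (hc : ∀ x, braE x ∘L c ∈ A.toStarSubalgebra)
    (hcont : ∀ ξ, Continuous fun t => M t ξ) {B : ℝ≥0 → ℝ} (hB : ∀ t r, r ≤ t → ‖M r‖ ≤ B t)
    (hM : ∀ ξ, SolvesAt expFrame frameFun (coeff₀ j c (omega 𝔨)) (coeff₁ j c (omega 𝔨) (inclK 𝔨))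
      M ξ) : IsMultiplier A j M := by
  have hmem := solution_mem hj.isHomFamily isTruncFrame_expFrame norm_omega hc norm_inclK_le hj.mem
    exists_hmap_expFrame hcont hM
  have h0 := solution_zero total_expFrame hM
  refine ⟨hmem, h0, solution_proj_comm (hj.isHomFamily.isAdaptedDriver norm_omega hc norm_inclK_le)
    isTruncFrame_expFrame hcont hM, fun s t => ?_, hcont⟩
  rw [bigJ_eq]
  refine solution_cocycle hj.isHomFamily hj.mem isTruncFrame_expFrame.toIsExpFrame norm_omega hc
    norm_inclK_le (splitting 𝔨 𝔥 s) (shiftFock 𝔨 s) (hj.isCompletelyBounded_localMap s)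
    (hj.isNormal_localMap s) (fun a b => ?_) (fun a => ?_) ?_ s (fun r a => ?_) h0 hmem hcont hB hM
    (exists_shift_expFrame s) t
  · simp only [localMap_apply]
    exact hj.map_mul s a b
  · simp only [localMap_apply]
    exact hj.map_star s a
  · rw [localMap_apply]
    exact hj.map_one s
  · exact (hj.cocycle s r a).trans (bigJ_eq s (j r a))

end Main

end QSC

end

theorem theorem4p3 {𝔥 𝔨 : Type*}
    [NormedAddCommGroup 𝔥] [InnerProductSpace ℂ 𝔥] [CompleteSpace 𝔥]
    [NormedAddCommGroup 𝔨] [InnerProductSpace ℂ 𝔨] [CompleteSpace 𝔨]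
    (A : VonNeumannAlgebra 𝔥)
    (j : ℝ≥0 → A.toStarSubalgebra →ₗ[ℂ] (QSC.FH 𝔨 𝔥 →L[ℂ] QSC.FH 𝔨 𝔥))
    (hj : QSC.IsFlow A j)
    (c : 𝔥 →L[ℂ] QSC.HTensor (QSC.KHat 𝔨) 𝔥)
    (hc : c ∈ QSC.ketTensor (QSC.KHat 𝔨) (A : Set (𝔥 →L[ℂ] 𝔥))) :
    (∃! M : ℝ≥0 → (QSC.FH 𝔨 𝔥 →L[ℂ] QSC.FH 𝔨 𝔥), QSC.IsQSDESolution A j c M) ∧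
    ∀ M : ℝ≥0 → (QSC.FH 𝔨 𝔥 →L[ℂ] QSC.FH 𝔨 𝔥),
      QSC.IsQSDESolution A j c M → QSC.IsMultiplier A j M := by
  have hcA := QSC.braE_comp_mem_of_mem_ketTensor A hc
  obtain ⟨M, B, hcont, hB, hM⟩ := QSC.exists_solvesAt hj.isHomFamily QSC.isTruncFrame_expFrame
    QSC.norm_omega hcA QSC.norm_inclK_le
  have hsol : QSC.IsQSDESolution A j c M := QSC.isQSDESolution_iff.2
    (QSC.isFrameSolution_of_solvesAt hj.isHomFamily QSC.isTruncFrame_expFrame QSC.norm_omega hcA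
      QSC.norm_inclK_le QSC.adjoint_inclK_omega hj.mem QSC.exists_hmap_expFrame hcont hB hM)
  have huniq : ∀ M', QSC.IsQSDESolution A j c M' → M' = M := fun M' h' =>
    (QSC.isQSDESolution_iff.1 h').eq hj.isHomFamily QSC.isTruncFrame_expFrame QSC.norm_omega hcA
      QSC.norm_inclK_le QSC.adjoint_inclK_omega hcont hM
  refine ⟨⟨M, hsol, huniq⟩, fun M' h' => ?_⟩
  -- By uniqueness, the multiplier property need only be checked for the strongly continuous
  -- solution already constructed.
  rw [huniq M' h']
  exact hj.isMultiplier_of_solvesAt hcA hcont hB hM
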